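/- Let $N\ge 1$, let $\Omega\subset\mathbb{R}^N$ be a bounded domain, $T>0$, $1<p<2$, and write $\Omega_\tau=\Omega\times(0,\tau)$. Let $\lambda_1=\inf\{\int_\Omega|\nabla u|^p\,dx : u\in W^{1,p}_0(\Omega),\ \int_\Omega|u|^p\,dx=1\}$ and let $\lambda>\lambda_1$. For $f\in L^\infty(\Omega_T)$ and $u_0\in W^{1,p}_0(\Omega)\cap L^2(\Omega)$ consider $$\partial_t u-\Delta_p u=\lambda|u|^{p-2}u+f\ \text{ in }\Omega_T,\qquad u(\cdot,0)=u_0\ \text{ in }\Omega,\qquad u=0\ \text{ on }\partial\Omega\times(0,T).\tag{P}$$ A weak solution of (P) is a function $u\in C([0,T]\to L^2(\Omega))\cap L^p((0,T)\to W^{1,p}_0(\Omega))$ with $u(\cdot,0)=u_0$ such that $$\int_\Omega u\varphi\,dx\Big|_{t=0}^{t=\tau}+\int_{\Omega_\tau}\bigl(-u\,\partial_t\varphi+|\nabla_x u|^{p-2}\langle\nabla_x u,\nabla_x\varphi\rangle\bigr)\,dx\,dt=\lambda\int_{\Omega_\tau}|u|^{p-2}u\varphi\,dx\,dt+\int_{\Omega_\tau}f\varphi\,dx\,dt$$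 for all $\tau\in(0,T]$ and all $\varphi\in W^{1,2}((0,\tau)\to L^2(\Omega))\cap L^p((0,\tau)\to W^{1,p}_0(\Omega))$. For given data, the maximum and comparison principles are the following assertions (inequalities and equalities between functions hold a.e.). WMP: if $f\ge0$ and $u_0\ge0$, then every weak solution satisfies $u\ge0$ in $\Omega_T$. SMP: if $f\ge0$ and $u_0\ge0$, then every weak solution satisfies $u\ge0$ in $\Omega_T$ and, moreover, if $u$ vanishes at some $(x_0,t_0)\in\Omega_T$ (i.e. has essential limit $0$ there), then $u=0$ in $\Omega_{t_0}$. WCP: if $f\le g$ and $u_0\le v_0$, then any weak solutions $u$, $v$ of (P) with the data $(f,u_0)$, $(g,v_0)$ satisfy $u\le v$ in $\Omega_T$. SCP: if $f\le g$ and $u_0\le v_0$, then any such $u,v$ satisfy $u\le v$ in $\Omega_T$ and, moreover, if $v-u$ vanishes at some $(x_0,t_0)\in\Omega_T$ (in the same sense), then $u=v$ in $\Omega_{t_0}$. Then: (1) The logistic problem $-\Delta_p w=\lambda|w|^{p-2}w-w$ in $\Omega$, $w=0$ on $\partial\Omega$, has a positive weak solution, i.e. there is $w\in W^{1,p}_0(\Omega)\cap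 L^2(\Omega)$ with $w>0$ a.e. in $\Omega$ and $\int_\Omega|\nabla w|^{p-2}\langle\nabla w,\nabla\varphi\rangle\,dx=\int_\Omega(\lambda|w|^{p-2}w-w)\varphi\,dx$ for all $\varphi\in W^{1,p}_0(\Omega)\cap L^2(\Omega)$. (2) Let $v(t)=((2-p)t)^{1/(2-p)}$. For every positive weak solution $w$ of the logistic problem, the functions $u\equiv0$ and $u_\pm(x,t)=\pm w(x)v(t)$ are three weak solutions of (P) with $f\equiv0$ and $u_0\equiv0$; moreover $u_+>0$ and $u_-<0$ a.e. in $\Omega_T$, and the three solutions are pairwise distinct as elements of $L^p(\Omega_T)$. (3) Consequently, WMP, SMP, WCP and SCP all fail for (P), already for the data $f\equiv g\equiv0$ and $u_0\equiv v_0\equiv0$. -/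

import Mathlib

open MeasureTheory Set Filter Topology
open scoped ContDiff ENNReal

noncomputable section

namespace PLap

variable {N : ℕ}

/-! ### Sobolev spaces on an open set `Ω` of `ℝ^N` -/

/-- `φ ∈ C_c^∞(Ω)`. -/
structure IsTestFunction (Ω : Set (EuclideanSpace ℝ (Fin N)))
    (φ : EuclideanSpace ℝ (Fin N) → ℝ) : Prop where
  smooth : ContDiff ℝ ∞ φ
  compact : HasCompactSupport φ
  supp : tsupport φ ⊆ Ω

/-- `u ∈ W^{1,p}(Ω)` with weak gradient `g`. -/
structure MemW1p (Ω : Set (EuclideanSpace ℝ (Fin N))) (p : ℝ)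
    (u : EuclideanSpace ℝ (Fin N) → ℝ)
    (g : EuclideanSpace ℝ (Fin N) → EuclideanSpace ℝ (Fin N)) : Prop where
  memLp : MemLp u (ENNReal.ofReal p) (volume.restrict Ω)
  memLp_grad : MemLp g (ENNReal.ofReal p) (volume.restrict Ω)
  weak_grad : ∀ φ, IsTestFunction Ω φ →
    ∫ x in Ω, u x • gradient φ x = - ∫ x in Ω, φ x • g x

/-- `u ∈ W_0^{1,p}(Ω)` with weak gradient `g`: the closure of `C_c^∞(Ω)` in `W^{1,p}(Ω)`. -/
structure MemW01p (Ω : Set (EuclideanSpace ℝ (Fin N))) (p : ℝ)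
    (u : EuclideanSpace ℝ (Fin N) → ℝ)
    (g : EuclideanSpace ℝ (Fin N) → EuclideanSpace ℝ (Fin N)) : Prop
    extends MemW1p Ω p u g where
  approx : ∃ φ : ℕ → EuclideanSpace ℝ (Fin N) → ℝ, (∀ n, IsTestFunction Ω (φ n)) ∧
    Tendsto (fun n => eLpNorm (fun x => φ n x - u x) (ENNReal.ofReal p) (volume.restrict Ω))
      atTop (𝓝 0) ∧
    Tendsto (fun n => eLpNorm (fun x => gradient (φ n) x - g x) (ENNReal.ofReal p)
      (volume.restrict Ω)) atTop (𝓝 0)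

/-- The first Dirichlet eigenvalue `λ₁` of the `p`-Laplacian:
the infimum of `∫ |∇u|^p` over `u ∈ W_0^{1,p}(Ω)` with `∫ |u|^p = 1`. -/
def firstEigenvalue (Ω : Set (EuclideanSpace ℝ (Fin N))) (p : ℝ) : ℝ :=
  sInf {a : ℝ | ∃ u g, MemW01p Ω p u g ∧ ∫ x in Ω, |u x| ^ p = 1 ∧ a = ∫ x in Ω, ‖g x‖ ^ p}

/-- `|s|^{p-2} s`, equal to `0` at `s = 0`. -/
def spow (p s : ℝ) : ℝ := |s| ^ (p - 2) * s

/-- `|ξ|^{p-2} ξ`, equal to `0` at `ξ = 0`. -/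
def flux (p : ℝ) (ξ : EuclideanSpace ℝ (Fin N)) : EuclideanSpace ℝ (Fin N) :=
  ‖ξ‖ ^ (p - 2) • ξ

/-! ### The stationary logistic problem -/

/-- `w` is a positive weak solution of `-Δ_p w = λ |w|^{p-2} w - w` in `Ω`, `w = 0` on `∂Ω`,
in the energy space `W_0^{1,p}(Ω) ∩ L²(Ω)`. -/
def IsPositiveLogisticSolution (Ω : Set (EuclideanSpace ℝ (Fin N))) (p lam : ℝ)
    (w : EuclideanSpace ℝ (Fin N) → ℝ) : Prop :=
  (∀ᵐ x ∂(volume.restrict Ω), 0 < w x) ∧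
  MemLp w 2 (volume.restrict Ω) ∧
  ∃ g, MemW01p Ω p w g ∧
    ∀ φ Φ, MemLp φ 2 (volume.restrict Ω) → MemW01p Ω p φ Φ →
      ∫ x in Ω, inner ℝ (flux p (g x)) (Φ x) = ∫ x in Ω, (lam * spow p (w x) - w x) * φ x

/-! ### The parabolic problem. Functions of `(x, t)` live on `ℝ^N × ℝ`. -/

/-- The open cylinder `Ω_τ = Ω × (0, τ)`. -/
def cyl (Ω : Set (EuclideanSpace ℝ (Fin N))) (τ : ℝ) : Set (EuclideanSpace ℝ (Fin N) × ℝ) :=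
  Ω ×ˢ Ioo 0 τ

/-- `u ∈ C([0, T] → L²(Ω))`. -/
structure MemCL2 (Ω : Set (EuclideanSpace ℝ (Fin N))) (T : ℝ)
    (u : EuclideanSpace ℝ (Fin N) × ℝ → ℝ) : Prop where
  slice : ∀ t ∈ Icc 0 T, MemLp (fun x => u (x, t)) 2 (volume.restrict Ω)
  cont : ∀ s ∈ Icc 0 T,
    Tendsto (fun t => eLpNorm (fun x => u (x, t) - u (x, s)) 2 (volume.restrict Ω))
      (𝓝[Icc 0 T] s) (𝓝 0)

/-- `u ∈ L^p((0, T) → W_0^{1,p}(Ω))` with spatial weak gradient `G`. -/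
structure MemLpW01p (Ω : Set (EuclideanSpace ℝ (Fin N))) (T p : ℝ)
    (u : EuclideanSpace ℝ (Fin N) × ℝ → ℝ)
    (G : EuclideanSpace ℝ (Fin N) × ℝ → EuclideanSpace ℝ (Fin N)) : Prop where
  memLp : MemLp u (ENNReal.ofReal p) (volume.restrict (cyl Ω T))
  memLp_grad : MemLp G (ENNReal.ofReal p) (volume.restrict (cyl Ω T))
  slice : ∀ᵐ t ∂(volume.restrict (Ioo 0 T)),
    MemW01p Ω p (fun x => u (x, t)) (fun x => G (x, t))

/-- `φ ∈ W^{1,2}((0, τ) → L²(Ω))` with weak time derivative `ψ`; here `φ` is the absolutely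
continuous representative, so that its values at each `t ∈ [0, τ]` are meaningful. -/
structure MemW12L2 (Ω : Set (EuclideanSpace ℝ (Fin N))) (τ : ℝ)
    (φ ψ : EuclideanSpace ℝ (Fin N) × ℝ → ℝ) : Prop where
  memLp : MemLp φ 2 (volume.restrict (cyl Ω τ))
  memLp_deriv : MemLp ψ 2 (volume.restrict (cyl Ω τ))
  slice : ∀ t ∈ Icc 0 τ, MemLp (fun x => φ (x, t)) 2 (volume.restrict Ω)
  ftc : ∀ s ∈ Icc 0 τ, ∀ t ∈ Icc 0 τ, ∀ᵐ x ∂(volume.restrict Ω),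
    φ (x, t) - φ (x, s) = ∫ r in s..t, ψ (x, r)

/-- `u` is a weak solution of `∂_t u - Δ_p u = λ |u|^{p-2} u + f` in `Ω × (0, T)` with
`u(·, 0) = u₀` and `u = 0` on `∂Ω × (0, T)`; the lateral condition (zero trace) is expressed by
`u(·, t) ∈ W_0^{1,p}(Ω)` for a.e. `t`. -/
def IsWeakSolution (Ω : Set (EuclideanSpace ℝ (Fin N))) (T p lam : ℝ)
    (f : EuclideanSpace ℝ (Fin N) × ℝ → ℝ) (u₀ : EuclideanSpace ℝ (Fin N) → ℝ)
    (u : EuclideanSpace ℝ (Fin N) × ℝ → ℝ) : Prop :=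
  MemCL2 Ω T u ∧ (∀ᵐ x ∂(volume.restrict Ω), u (x, 0) = u₀ x) ∧
  ∃ G, MemLpW01p Ω T p u G ∧
    ∀ τ ∈ Ioc 0 T, ∀ φ ψ Φ, MemW12L2 Ω τ φ ψ → MemLpW01p Ω τ p φ Φ →
      (∫ x in Ω, u (x, τ) * φ (x, τ)) - (∫ x in Ω, u (x, 0) * φ (x, 0))
        + ∫ z in cyl Ω τ, (-(u z * ψ z) + inner ℝ (flux p (G z)) (Φ z))
      = lam * (∫ z in cyl Ω τ, spow p (u z) * φ z) + ∫ z in cyl Ω τ, f z * φ z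

/-- Admissible data: `f ∈ L^∞(Ω_T)` and `u₀ ∈ W_0^{1,p}(Ω) ∩ L²(Ω)`. -/
structure AdmissibleData (Ω : Set (EuclideanSpace ℝ (Fin N))) (T p : ℝ)
    (f : EuclideanSpace ℝ (Fin N) × ℝ → ℝ) (u₀ : EuclideanSpace ℝ (Fin N) → ℝ) : Prop where
  source : MemLp f ∞ (volume.restrict (cyl Ω T))
  initial : MemLp u₀ 2 (volume.restrict Ω) ∧ ∃ g, MemW01p Ω p u₀ g

/-! ### Maximum and comparison principles for given data -/

/-- `u` vanishes at the point `z`, for functions given up to a.e. equality: `0` is the essential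
limit of `u` at `z`. For `u` continuous at `z` this means `u z = 0`. -/
def VanishesAt (u : EuclideanSpace ℝ (Fin N) × ℝ → ℝ) (z : EuclideanSpace ℝ (Fin N) × ℝ) : Prop :=
  Tendsto u (𝓝 z ⊓ ae volume) (𝓝 0)

/-- WMP for the data `f`, `u₀`: if `f ≥ 0` and `u₀ ≥ 0`, then every weak solution is `≥ 0`. -/
def WeakMaximumPrinciple (Ω : Set (EuclideanSpace ℝ (Fin N))) (T p lam : ℝ)
    (f : EuclideanSpace ℝ (Fin N) × ℝ → ℝ) (u₀ : EuclideanSpace ℝ (Fin N) → ℝ) : Prop :=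
  AdmissibleData Ω T p f u₀ →
  (∀ᵐ z ∂(volume.restrict (cyl Ω T)), 0 ≤ f z) → (∀ᵐ x ∂(volume.restrict Ω), 0 ≤ u₀ x) →
  ∀ u, IsWeakSolution Ω T p lam f u₀ u → ∀ᵐ z ∂(volume.restrict (cyl Ω T)), 0 ≤ u z

/-- SMP for the data `f`, `u₀`: if `f ≥ 0` and `u₀ ≥ 0`, then every weak solution is `≥ 0` and,
moreover, if it vanishes at `(x₀, t₀) ∈ Ω_T` then it is `0` in `Ω_{t₀}`. -/
def StrongMaximumPrinciple (Ω : Set (EuclideanSpace ℝ (Fin N))) (T p lam : ℝ)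
    (f : EuclideanSpace ℝ (Fin N) × ℝ → ℝ) (u₀ : EuclideanSpace ℝ (Fin N) → ℝ) : Prop :=
  AdmissibleData Ω T p f u₀ →
  (∀ᵐ z ∂(volume.restrict (cyl Ω T)), 0 ≤ f z) → (∀ᵐ x ∂(volume.restrict Ω), 0 ≤ u₀ x) →
  ∀ u, IsWeakSolution Ω T p lam f u₀ u →
    (∀ᵐ z ∂(volume.restrict (cyl Ω T)), 0 ≤ u z) ∧
    ∀ z₀ ∈ cyl Ω T, VanishesAt u z₀ → ∀ᵐ z ∂(volume.restrict (cyl Ω z₀.2)), u z = 0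

/-- WCP for the data `(f, u₀)`, `(g, v₀)`: if `f ≤ g` and `u₀ ≤ v₀`, then `u ≤ v` for all
corresponding weak solutions `u`, `v`. -/
def WeakComparisonPrinciple (Ω : Set (EuclideanSpace ℝ (Fin N))) (T p lam : ℝ)
    (f g : EuclideanSpace ℝ (Fin N) × ℝ → ℝ) (u₀ v₀ : EuclideanSpace ℝ (Fin N) → ℝ) : Prop :=
  AdmissibleData Ω T p f u₀ → AdmissibleData Ω T p g v₀ →
  (∀ᵐ z ∂(volume.restrict (cyl Ω T)), f z ≤ g z) →
  (∀ᵐ x ∂(volume.restrict Ω), u₀ x ≤ v₀ x) →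
  ∀ u v, IsWeakSolution Ω T p lam f u₀ u → IsWeakSolution Ω T p lam g v₀ v →
    ∀ᵐ z ∂(volume.restrict (cyl Ω T)), u z ≤ v z

/-- SCP for the data `(f, u₀)`, `(g, v₀)`: if `f ≤ g` and `u₀ ≤ v₀`, then `u ≤ v` for all
corresponding weak solutions and, moreover, if `u = v` at `(x₀, t₀) ∈ Ω_T` then `u = v` in
`Ω_{t₀}`. -/
def StrongComparisonPrinciple (Ω : Set (EuclideanSpace ℝ (Fin N))) (T p lam : ℝ)
    (f g : EuclideanSpace ℝ (Fin N) × ℝ → ℝ) (u₀ v₀ : EuclideanSpace ℝ (Fin N) → ℝ) : Prop :=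
  AdmissibleData Ω T p f u₀ → AdmissibleData Ω T p g v₀ →
  (∀ᵐ z ∂(volume.restrict (cyl Ω T)), f z ≤ g z) →
  (∀ᵐ x ∂(volume.restrict Ω), u₀ x ≤ v₀ x) →
  ∀ u v, IsWeakSolution Ω T p lam f u₀ u → IsWeakSolution Ω T p lam g v₀ v →
    (∀ᵐ z ∂(volume.restrict (cyl Ω T)), u z ≤ v z) ∧
    ∀ z₀ ∈ cyl Ω T, VanishesAt (fun z => v z - u z) z₀ →
      ∀ᵐ z ∂(volume.restrict (cyl Ω z₀.2)), u z = v z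

/-- `v(t) = ((2 - p) t)^{1/(2-p)}`. -/
def timeProfile (p t : ℝ) : ℝ := ((2 - p) * t) ^ (1 / (2 - p))

/-- `u(x, t) = w(x) v(t)`. -/
def separated (p : ℝ) (w : EuclideanSpace ℝ (Fin N) → ℝ)
    (z : EuclideanSpace ℝ (Fin N) × ℝ) : ℝ := w z.1 * timeProfile p z.2

end PLap

end

open MeasureTheory Set Filter Topology
open scoped ContDiff ENNReal

noncomputable section

namespace PLap

variable {N : ℕ}

/-! ### Convergence in `L^p` -/

section Lp

variable {α F : Type*} [MeasurableSpace α] {μ : Measure α} [NormedAddCommGroup F]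

lemma tendsto_eLpNorm_zero_of_dominated {q : ℝ≥0∞} (hq0 : q ≠ 0) (hq : q ≠ ⊤) {f : ℕ → α → F}
    {b : α → ℝ} (hf : ∀ n, AEStronglyMeasurable (f n) μ) (hb : MemLp b q μ)
    (hfb : ∀ n, ∀ᵐ x ∂μ, ‖f n x‖ ≤ b x)
    (hlim : ∀ᵐ x ∂μ, Tendsto (fun n => f n x) atTop (𝓝 0)) :
    Tendsto (fun n => eLpNorm (f n) q μ) atTop (𝓝 0) := by
  have hq' : 0 < q.toReal := ENNReal.toReal_pos hq0 hq
  have key : Tendsto (fun n => ∫⁻ x, ‖f n x‖ₑ ^ q.toReal ∂μ) atTop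
      (𝓝 (∫⁻ _, (0 : ℝ≥0∞) ∂μ)) := by
    refine tendsto_lintegral_of_dominated_convergence' (fun x => ‖b x‖ₑ ^ q.toReal)
      (fun n => ((hf n).enorm.pow_const _)) (fun n => ?_) ?_ ?_
    · filter_upwards [hfb n] with x hx
      refine ENNReal.rpow_le_rpow ?_ hq'.le
      rw [enorm_le_iff_norm_le]
      exact hx.trans (Real.le_norm_self _)
    · exact (lintegral_rpow_enorm_lt_top_of_eLpNorm_lt_top hq0 hq hb.2).ne
    · filter_upwards [hlim] with x hx
      have h1 : Tendsto (fun n => ‖f n x‖ₑ) atTop (𝓝 0) := by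
        simpa using hx.enorm
      have h2 := ((ENNReal.continuous_rpow_const (y := q.toReal)).tendsto 0).comp h1
      rwa [ENNReal.zero_rpow_of_pos hq'] at h2
  simp_rw [eLpNorm_eq_lintegral_rpow_enorm_toReal hq0 hq]
  rw [lintegral_zero] at key
  have h2 := ((ENNReal.continuous_rpow_const (y := 1 / q.toReal)).tendsto 0).comp key
  rwa [ENNReal.zero_rpow_of_pos (by positivity)] at h2

lemma tendsto_eLpNorm_of_exponent_le [IsFiniteMeasure μ] {ι : Type*} {l : Filter ι}
    {r q : ℝ≥0∞} (hr : r ≠ 0) (hrq : r ≤ q) {f : ι → α → F}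
    (hf : ∀ n, AEStronglyMeasurable (f n) μ)
    (h : Tendsto (fun n => eLpNorm (f n) q μ) l (𝓝 0)) :
    Tendsto (fun n => eLpNorm (f n) r μ) l (𝓝 0) := by
  have hc : μ univ ^ (1 / r.toReal - 1 / q.toReal) ≠ ⊤ := by
    refine (ENNReal.rpow_lt_top_of_nonneg ?_ (measure_ne_top μ univ)).ne
    rcases eq_or_ne q ⊤ with rfl | hq
    · simp
    · rw [sub_nonneg]
      exact one_div_le_one_div_of_le (ENNReal.toReal_pos hr (ne_top_of_le_ne_top hq hrq))
        (ENNReal.toReal_mono hq hrq)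
  have h2 := ENNReal.Tendsto.mul_const h (Or.inr hc)
  rw [zero_mul] at h2
  exact tendsto_of_tendsto_of_tendsto_of_le_of_le tendsto_const_nhds h2 (fun _ => zero_le)
    (fun n => eLpNorm_le_eLpNorm_mul_rpow_measure_univ hrq (hf n))

lemma exists_subseq_tendsto_ae {q : ℝ≥0∞} (hq : q ≠ 0) {f : ℕ → α → F} {g : α → F}
    (hf : ∀ n, AEStronglyMeasurable (f n) μ) (hg : AEStronglyMeasurable g μ)
    (h : Tendsto (fun n => eLpNorm (fun x => f n x - g x) q μ) atTop (𝓝 0)) :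
    ∃ k : ℕ → ℕ, StrictMono k ∧
      ∀ᵐ x ∂μ, Tendsto (fun n => f (k n) x) atTop (𝓝 (g x)) :=
  (tendstoInMeasure_of_tendsto_eLpNorm hq hf hg h).exists_seq_tendsto_ae

lemma tendsto_eLpNorm_add {q : ℝ≥0∞} (hq : 1 ≤ q) {ι : Type*} {l : Filter ι} {f g : ι → α → F}
    (hf : ∀ n, AEStronglyMeasurable (f n) μ) (hg : ∀ n, AEStronglyMeasurable (g n) μ)
    (h : Tendsto (fun n => eLpNorm (f n) q μ) l (𝓝 0))
    (h' : Tendsto (fun n => eLpNorm (g n) q μ) l (𝓝 0)) :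
    Tendsto (fun n => eLpNorm (fun x => f n x + g n x) q μ) l (𝓝 0) := by
  have h2 := h.add h'
  rw [add_zero] at h2
  exact tendsto_of_tendsto_of_tendsto_of_le_of_le tendsto_const_nhds h2 (fun _ => zero_le)
    (fun n => eLpNorm_add_le (hf n) (hg n) hq)

lemma tendsto_eLpNorm_of_le_mul {G : Type*} [NormedAddCommGroup G] {q : ℝ≥0∞} {ι : Type*}
    {l : Filter ι} {f : ι → α → F} {g : ι → α → G} (C : ℝ)
    (hfg : ∀ n, ∀ᵐ x ∂μ, ‖f n x‖ ≤ C * ‖g n x‖)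
    (h : Tendsto (fun n => eLpNorm (g n) q μ) l (𝓝 0)) :
    Tendsto (fun n => eLpNorm (f n) q μ) l (𝓝 0) := by
  have h2 := ENNReal.Tendsto.const_mul h (Or.inr (ENNReal.ofReal_ne_top (r := C)))
  rw [mul_zero] at h2
  exact tendsto_of_tendsto_of_tendsto_of_le_of_le tendsto_const_nhds h2 (fun _ => zero_le)
    (fun n => eLpNorm_le_mul_eLpNorm_of_ae_le_mul (hfg n) q)

end Lp

/-! ### Test functions -/

section Test

variable {Ω : Set (EuclideanSpace ℝ (Fin N))} {φ ψ : EuclideanSpace ℝ (Fin N) → ℝ}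

lemma gradient_eq_toDual_symm (φ : EuclideanSpace ℝ (Fin N) → ℝ) (x : EuclideanSpace ℝ (Fin N)) :
    gradient φ x = (InnerProductSpace.toDual ℝ _).symm (fderiv ℝ φ x) := rfl

lemma inner_gradient (φ : EuclideanSpace ℝ (Fin N) → ℝ) (x v : EuclideanSpace ℝ (Fin N)) :
    inner ℝ (gradient φ x) v = fderiv ℝ φ x v := by
  simp [gradient_eq_toDual_symm]

lemma IsTestFunction.differentiable (h : IsTestFunction Ω φ) : Differentiable ℝ φ :=
  h.smooth.differentiable (by simp)

lemma IsTestFunction.continuous_gradient (h : IsTestFunction Ω φ) :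
    Continuous (gradient φ) :=
  (InnerProductSpace.toDual ℝ (EuclideanSpace ℝ (Fin N))).symm.continuous.comp
    (h.smooth.continuous_fderiv (by simp))

lemma IsTestFunction.hasCompactSupport_gradient (h : IsTestFunction Ω φ) :
    HasCompactSupport (gradient φ) :=
  (h.compact.fderiv ℝ).comp_left (g := (InnerProductSpace.toDual ℝ _).symm) (map_zero _)

lemma IsTestFunction.eq_zero (h : IsTestFunction Ω φ) {x : EuclideanSpace ℝ (Fin N)}
    (hx : x ∉ Ω) : φ x = 0 :=
  image_eq_zero_of_notMem_tsupport (fun hx' => hx (h.supp hx'))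

lemma IsTestFunction.gradient_eq_zero (h : IsTestFunction Ω φ) {x : EuclideanSpace ℝ (Fin N)}
    (hx : x ∉ Ω) : gradient φ x = 0 := by
  have : fderiv ℝ φ x = 0 :=
    image_eq_zero_of_notMem_tsupport (fun hx' => hx (h.supp (tsupport_fderiv_subset ℝ hx')))
  simp [gradient_eq_toDual_symm, this]

lemma IsTestFunction.memLp (h : IsTestFunction Ω φ) (q : ℝ≥0∞)
    (μ : Measure (EuclideanSpace ℝ (Fin N))) [IsFiniteMeasureOnCompacts μ] : MemLp φ q μ :=
  h.smooth.continuous.memLp_of_hasCompactSupport h.compact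

lemma IsTestFunction.memLp_gradient (h : IsTestFunction Ω φ) (q : ℝ≥0∞)
    (μ : Measure (EuclideanSpace ℝ (Fin N))) [IsFiniteMeasureOnCompacts μ] :
    MemLp (gradient φ) q μ :=
  h.continuous_gradient.memLp_of_hasCompactSupport h.hasCompactSupport_gradient

lemma IsTestFunction.bounded (h : IsTestFunction Ω φ) : ∃ C, ∀ x, ‖φ x‖ ≤ C :=
  h.compact.exists_bound_of_continuous h.smooth.continuous

lemma IsTestFunction.bounded_gradient (h : IsTestFunction Ω φ) : ∃ C, ∀ x, ‖gradient φ x‖ ≤ C :=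
  h.hasCompactSupport_gradient.exists_bound_of_continuous h.continuous_gradient

lemma isTestFunction_zero (Ω : Set (EuclideanSpace ℝ (Fin N))) : IsTestFunction Ω 0 :=
  ⟨contDiff_const, HasCompactSupport.zero, by simp⟩

lemma gradient_zero_fun : gradient (0 : EuclideanSpace ℝ (Fin N) → ℝ) = 0 := by
  ext1 x; simp [gradient_eq_toDual_symm]

lemma IsTestFunction.add (h : IsTestFunction Ω φ) (h' : IsTestFunction Ω ψ) :
    IsTestFunction Ω (fun x => φ x + ψ x) :=
  ⟨h.smooth.add h'.smooth, h.compact.add h'.compact,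
    (tsupport_add φ ψ).trans (union_subset h.supp h'.supp)⟩

lemma IsTestFunction.gradient_add (h : IsTestFunction Ω φ) (h' : IsTestFunction Ω ψ)
    (x : EuclideanSpace ℝ (Fin N)) :
    gradient (fun x => φ x + ψ x) x = gradient φ x + gradient ψ x := by
  simp only [gradient_eq_toDual_symm]
  rw [fderiv_fun_add (h.differentiable x) (h'.differentiable x), map_add]

lemma IsTestFunction.mul_left (h : IsTestFunction Ω φ) (hψ : ContDiff ℝ ∞ ψ) :
    IsTestFunction Ω (fun x => ψ x * φ x) :=
  ⟨hψ.mul h.smooth, h.compact.mul_left, (tsupport_mul_subset_right).trans h.supp⟩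

lemma IsTestFunction.gradient_mul_left (h : IsTestFunction Ω φ) (hψ : ContDiff ℝ ∞ ψ)
    (x : EuclideanSpace ℝ (Fin N)) :
    gradient (fun x => ψ x * φ x) x = ψ x • gradient φ x + φ x • gradient ψ x := by
  simp only [gradient_eq_toDual_symm]
  rw [fderiv_fun_mul (hψ.differentiable (by simp) x) (h.differentiable x)]
  simp

lemma IsTestFunction.const_mul (h : IsTestFunction Ω φ) (c : ℝ) :
    IsTestFunction Ω (fun x => c * φ x) := h.mul_left contDiff_const

lemma IsTestFunction.gradient_const_mul (h : IsTestFunction Ω φ) (c : ℝ)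
    (x : EuclideanSpace ℝ (Fin N)) :
    gradient (fun x => c * φ x) x = c • gradient φ x := by
  rw [h.gradient_mul_left contDiff_const]
  simp [gradient_eq_toDual_symm]

lemma IsTestFunction.comp (h : IsTestFunction Ω φ) {F : ℝ → ℝ} (hF : ContDiff ℝ ∞ F)
    (hF0 : F 0 = 0) : IsTestFunction Ω (fun x => F (φ x)) :=
  ⟨hF.comp h.smooth, h.compact.comp_left hF0,
    (closure_mono (fun x hx => by
      simp only [Function.mem_support] at hx ⊢
      exact fun h0 => hx (by rw [h0, hF0]))).trans h.supp⟩

lemma IsTestFunction.gradient_comp (h : IsTestFunction Ω φ) {F : ℝ → ℝ} (hF : ContDiff ℝ ∞ F)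
    (x : EuclideanSpace ℝ (Fin N)) :
    gradient (fun x => F (φ x)) x = deriv F (φ x) • gradient φ x := by
  have h1 := ((hF.differentiable (by simp) (φ x)).hasDerivAt).comp_hasFDerivAt x
    (h.differentiable x).hasFDerivAt
  have h2 : fderiv ℝ (fun x => F (φ x)) x = deriv F (φ x) • fderiv ℝ φ x := h1.fderiv
  simp only [gradient_eq_toDual_symm, h2]
  simp

lemma IsTestFunction.integral_smul_gradient (h : IsTestFunction Ω φ) (h' : IsTestFunction Ω ψ) :
    ∫ x in Ω, φ x • gradient ψ x = - ∫ x in Ω, ψ x • gradient φ x := by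
  -- Both integrands vanish off `Ω`, so the integration by parts takes place on the whole space and
  -- has no boundary term.
  rw [setIntegral_eq_integral_of_forall_compl_eq_zero (fun x hx => by simp [h.eq_zero hx]),
    setIntegral_eq_integral_of_forall_compl_eq_zero (fun x hx => by simp [h'.eq_zero hx])]
  have i1 : Integrable (fun x => φ x • gradient ψ x) :=
    (h.smooth.continuous.smul h'.continuous_gradient).integrable_of_hasCompactSupport
      h.compact.smul_right
  have i2 : Integrable (fun x => ψ x • gradient φ x) :=
    (h'.smooth.continuous.smul h.continuous_gradient).integrable_of_hasCompactSupport
      h'.compact.smul_right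
  refine ext_inner_right ℝ fun v => ?_
  rw [inner_neg_left, real_inner_comm, ← integral_inner i1 v, real_inner_comm,
    ← integral_inner i2 v]
  have e1 : ∀ x, inner ℝ v (φ x • gradient ψ x) = φ x * fderiv ℝ ψ x v := fun x => by
    rw [inner_smul_right, real_inner_comm, inner_gradient]
  have e2 : ∀ x, inner ℝ v (ψ x • gradient φ x) = fderiv ℝ φ x v * ψ x := fun x => by
    rw [inner_smul_right, real_inner_comm, inner_gradient, mul_comm]
  have i1' := i1.const_inner (𝕜 := ℝ) v
  have i2' := i2.const_inner (𝕜 := ℝ) v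
  simp only [e1, e2] at i1' i2' ⊢
  refine integral_mul_fderiv_eq_neg_fderiv_mul_of_integrable i2' i1' ?_
    (fun x _ => h.differentiable x) (fun x _ => h'.differentiable x)
  exact (h.smooth.continuous.mul h'.smooth.continuous).integrable_of_hasCompactSupport
      h.compact.mul_right

end Test

/-! ### The space `W_0^{1,p}` -/

section W01p

variable {Ω : Set (EuclideanSpace ℝ (Fin N))} {p : ℝ}
  {u v : EuclideanSpace ℝ (Fin N) → ℝ}
  {g h : EuclideanSpace ℝ (Fin N) → EuclideanSpace ℝ (Fin N)}

lemma one_le_ofReal (hp : 1 ≤ p) : (1 : ℝ≥0∞) ≤ ENNReal.ofReal p := by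
  simpa using ENNReal.ofReal_le_ofReal hp

lemma ofReal_ne_zero' (hp : 1 ≤ p) : ENNReal.ofReal p ≠ 0 :=
  (zero_lt_one.trans_le (one_le_ofReal hp)).ne'

/-- Approximability alone suffices. The weak gradient identity is integration by parts for the
approximants, and it passes to the limit because on a finite measure `L^p` convergence implies `L^1`
convergence, while the fixed test function and its gradient are bounded. -/
lemma MemW01p.of_approx [IsFiniteMeasure (volume.restrict Ω)] (hp : 1 ≤ p)
    (hu : MemLp u (ENNReal.ofReal p) (volume.restrict Ω))
    (hg : MemLp g (ENNReal.ofReal p) (volume.restrict Ω))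
    {φ : ℕ → EuclideanSpace ℝ (Fin N) → ℝ} (hφ : ∀ n, IsTestFunction Ω (φ n))
    (h1 : Tendsto (fun n => eLpNorm (fun x => φ n x - u x) (ENNReal.ofReal p)
      (volume.restrict Ω)) atTop (𝓝 0))
    (h2 : Tendsto (fun n => eLpNorm (fun x => gradient (φ n) x - g x) (ENNReal.ofReal p)
      (volume.restrict Ω)) atTop (𝓝 0)) : MemW01p Ω p u g := by
  refine ⟨⟨hu, hg, fun ψ hψ => ?_⟩, φ, hφ, h1, h2⟩
  obtain ⟨C, hC⟩ := hψ.bounded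
  obtain ⟨D, hD⟩ := hψ.bounded_gradient
  have h1' := tendsto_eLpNorm_of_exponent_le one_ne_zero (one_le_ofReal hp)
    (fun n => (((hφ n).memLp _ _).sub hu).aestronglyMeasurable) h1
  have h2' := tendsto_eLpNorm_of_exponent_le one_ne_zero (one_le_ofReal hp)
    (fun n => (((hφ n).memLp_gradient _ _).sub hg).aestronglyMeasurable) h2
  have l1 : Tendsto (fun n => ∫ x in Ω, φ n x • gradient ψ x) atTop
      (𝓝 (∫ x in Ω, u x • gradient ψ x)) := by
    refine tendsto_integral_of_L1' _ (hu.aestronglyMeasurable.smul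
      hψ.continuous_gradient.aestronglyMeasurable) (Eventually.of_forall fun n =>
      (((hφ n).smooth.continuous.smul hψ.continuous_gradient).integrable_of_hasCompactSupport
      (hφ n).compact.smul_right).restrict) ?_
    refine tendsto_eLpNorm_of_le_mul D (fun n => Eventually.of_forall fun x => ?_) h1'
    change ‖φ n x • gradient ψ x - u x • gradient ψ x‖ ≤ _
    rw [← sub_smul, norm_smul, mul_comm]
    exact mul_le_mul_of_nonneg_right (hD x) (norm_nonneg _)
  have l2 : Tendsto (fun n => ∫ x in Ω, ψ x • gradient (φ n) x) atTop
      (𝓝 (∫ x in Ω, ψ x • g x)) := by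
    refine tendsto_integral_of_L1' _ (hψ.smooth.continuous.aestronglyMeasurable.smul
      hg.aestronglyMeasurable) (Eventually.of_forall fun n =>
      ((hψ.smooth.continuous.smul (hφ n).continuous_gradient).integrable_of_hasCompactSupport
      hψ.compact.smul_right).restrict) ?_
    refine tendsto_eLpNorm_of_le_mul C (fun n => Eventually.of_forall fun x => ?_) h2'
    change ‖ψ x • gradient (φ n) x - ψ x • g x‖ ≤ _
    rw [← smul_sub, norm_smul]
    exact mul_le_mul_of_nonneg_right (hC x) (norm_nonneg _)
  refine tendsto_nhds_unique l1 ?_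
  simpa only [(hφ _).integral_smul_gradient hψ] using l2.neg

lemma IsTestFunction.memW01p [IsFiniteMeasure (volume.restrict Ω)] (hp : 1 ≤ p)
    {φ : EuclideanSpace ℝ (Fin N) → ℝ} (hφ : IsTestFunction Ω φ) :
    MemW01p Ω p φ (gradient φ) :=
  MemW01p.of_approx hp (hφ.memLp _ _) (hφ.memLp_gradient _ _) (φ := fun _ => φ) (fun _ => hφ)
    (by simp) (by simp)

/-- Diagonal choice with errors at most `1/(n+1)`. The limits give closedness of `W_0^{1,p}`; the
uniform bound `1` transfers norm bounds to the test functions in the compactness proof. -/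
lemma exists_seq_isTestFunction {U : ℕ → EuclideanSpace ℝ (Fin N) → ℝ}
    {G : ℕ → EuclideanSpace ℝ (Fin N) → EuclideanSpace ℝ (Fin N)}
    (hU : ∀ n, MemW01p Ω p (U n) (G n)) :
    ∃ φ : ℕ → EuclideanSpace ℝ (Fin N) → ℝ, (∀ n, IsTestFunction Ω (φ n)) ∧
      (∀ n, eLpNorm (fun x => φ n x - U n x) (ENNReal.ofReal p) (volume.restrict Ω) ≤ 1) ∧
      (∀ n, eLpNorm (fun x => gradient (φ n) x - G n x) (ENNReal.ofReal p)
        (volume.restrict Ω) ≤ 1) ∧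
      Tendsto (fun n => eLpNorm (fun x => φ n x - U n x) (ENNReal.ofReal p)
        (volume.restrict Ω)) atTop (𝓝 0) ∧
      Tendsto (fun n => eLpNorm (fun x => gradient (φ n) x - G n x) (ENNReal.ofReal p)
        (volume.restrict Ω)) atTop (𝓝 0) := by
  have key : ∀ n, ∃ φ, IsTestFunction Ω φ ∧
      eLpNorm (fun x => φ x - U n x) (ENNReal.ofReal p) (volume.restrict Ω) ≤
        (((n : ℝ≥0∞) + 1))⁻¹ ∧
      eLpNorm (fun x => gradient φ x - G n x) (ENNReal.ofReal p) (volume.restrict Ω) ≤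
        (((n : ℝ≥0∞) + 1))⁻¹ := by
    intro n
    obtain ⟨φ, hφ, a1, a2⟩ := (hU n).approx
    have hpos : (0 : ℝ≥0∞) < ((n : ℝ≥0∞) + 1)⁻¹ := by simp [ENNReal.inv_pos]
    obtain ⟨k, hk1, hk2⟩ := ((a1.eventually (gt_mem_nhds hpos)).and
      (a2.eventually (gt_mem_nhds hpos))).exists
    exact ⟨φ k, hφ k, hk1.le, hk2.le⟩
  choose φ hφ b1 b2 using key
  have h0 : Tendsto (fun n : ℕ => ((n : ℝ≥0∞) + 1)⁻¹) atTop (𝓝 0) := by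
    have := (tendsto_add_atTop_iff_nat 1).2 ENNReal.tendsto_inv_nat_nhds_zero
    simpa using this
  have c1 := tendsto_of_tendsto_of_tendsto_of_le_of_le tendsto_const_nhds h0
    (fun _ => zero_le) b1
  have c2 := tendsto_of_tendsto_of_tendsto_of_le_of_le tendsto_const_nhds h0
    (fun _ => zero_le) b2
  have le1 : ∀ n : ℕ, ((n : ℝ≥0∞) + 1)⁻¹ ≤ 1 := fun n => by simp
  exact ⟨φ, hφ, fun n => (b1 n).trans (le1 n), fun n => (b2 n).trans (le1 n), c1, c2⟩

lemma MemW01p.of_tendsto [IsFiniteMeasure (volume.restrict Ω)] (hp : 1 ≤ p)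
    (hu : MemLp u (ENNReal.ofReal p) (volume.restrict Ω))
    (hg : MemLp g (ENNReal.ofReal p) (volume.restrict Ω))
    {U : ℕ → EuclideanSpace ℝ (Fin N) → ℝ}
    {G : ℕ → EuclideanSpace ℝ (Fin N) → EuclideanSpace ℝ (Fin N)}
    (hU : ∀ n, MemW01p Ω p (U n) (G n))
    (h1 : Tendsto (fun n => eLpNorm (fun x => U n x - u x) (ENNReal.ofReal p)
      (volume.restrict Ω)) atTop (𝓝 0))
    (h2 : Tendsto (fun n => eLpNorm (fun x => G n x - g x) (ENNReal.ofReal p)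
      (volume.restrict Ω)) atTop (𝓝 0)) : MemW01p Ω p u g := by
  obtain ⟨φ, hφ, -, -, c1, c2⟩ := exists_seq_isTestFunction hU
  refine MemW01p.of_approx hp hu hg hφ ?_ ?_
  · have := tendsto_eLpNorm_add (one_le_ofReal hp)
      (fun n => (((hφ n).memLp _ _).sub (hU n).memLp).aestronglyMeasurable)
      (fun n => ((hU n).memLp.sub hu).aestronglyMeasurable) c1 h1
    simpa using this
  · have := tendsto_eLpNorm_add (one_le_ofReal hp)
      (fun n => (((hφ n).memLp_gradient _ _).sub (hU n).memLp_grad).aestronglyMeasurable)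
      (fun n => ((hU n).memLp_grad.sub hg).aestronglyMeasurable) c2 h2
    simpa using this

lemma MemW01p.congr [IsFiniteMeasure (volume.restrict Ω)] (hp : 1 ≤ p) (hu : MemW01p Ω p u g)
    (h1 : u =ᵐ[volume.restrict Ω] v) (h2 : g =ᵐ[volume.restrict Ω] h) : MemW01p Ω p v h := by
  refine MemW01p.of_tendsto hp (hu.memLp.ae_eq h1) (hu.memLp_grad.ae_eq h2) (fun _ => hu) ?_ ?_
  · have : (fun x => u x - v x) =ᵐ[volume.restrict Ω] 0 := by
      filter_upwards [h1] with x hx; simp [hx]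
    simp [eLpNorm_congr_ae this]
  · have : (fun x => g x - h x) =ᵐ[volume.restrict Ω] 0 := by
      filter_upwards [h2] with x hx; simp [hx]
    simp [eLpNorm_congr_ae this]

lemma MemW01p.add [IsFiniteMeasure (volume.restrict Ω)] (hp : 1 ≤ p) (hu : MemW01p Ω p u g)
    (hv : MemW01p Ω p v h) : MemW01p Ω p (fun x => u x + v x) (fun x => g x + h x) := by
  obtain ⟨φ, hφ, a1, a2⟩ := hu.approx
  obtain ⟨ψ, hψ, b1, b2⟩ := hv.approx
  refine MemW01p.of_approx hp (hu.memLp.add hv.memLp) (hu.memLp_grad.add hv.memLp_grad)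
    (fun n => (hφ n).add (hψ n)) ?_ ?_
  · have := tendsto_eLpNorm_add (one_le_ofReal hp)
      (fun n => (((hφ n).memLp _ _).sub hu.memLp).aestronglyMeasurable)
      (fun n => (((hψ n).memLp _ _).sub hv.memLp).aestronglyMeasurable) a1 b1
    refine this.congr fun n => ?_
    congr 1; ext x; simp only [Pi.sub_apply]; ring
  · have := tendsto_eLpNorm_add (one_le_ofReal hp)
      (fun n => (((hφ n).memLp_gradient _ _).sub hu.memLp_grad).aestronglyMeasurable)
      (fun n => (((hψ n).memLp_gradient _ _).sub hv.memLp_grad).aestronglyMeasurable) a2 b2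
    refine this.congr fun n => ?_
    congr 1; ext1 x
    rw [(hφ n).gradient_add (hψ n)]; simp only [Pi.sub_apply]; abel

lemma MemW01p.const_mul [IsFiniteMeasure (volume.restrict Ω)] (hp : 1 ≤ p) (hu : MemW01p Ω p u g)
    (c : ℝ) : MemW01p Ω p (fun x => c * u x) (fun x => c • g x) := by
  obtain ⟨φ, hφ, a1, a2⟩ := hu.approx
  refine MemW01p.of_approx hp (hu.memLp.const_mul c) (hu.memLp_grad.const_smul c)
    (fun n => (hφ n).const_mul c) ?_ ?_
  · refine tendsto_eLpNorm_of_le_mul |c| (fun n => Eventually.of_forall fun x => ?_) a1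
    rw [← mul_sub, norm_mul, Real.norm_eq_abs]
  · refine tendsto_eLpNorm_of_le_mul |c| (fun n => Eventually.of_forall fun x => ?_) a2
    rw [(hφ n).gradient_const_mul, ← smul_sub, norm_smul, Real.norm_eq_abs]

lemma memW01p_zero [IsFiniteMeasure (volume.restrict Ω)] (hp : 1 ≤ p) : MemW01p Ω p 0 0 := by
  have := (isTestFunction_zero Ω).memW01p hp
  rwa [gradient_zero_fun] at this

/-- Approximation by test functions converging also almost everywhere. -/
lemma MemW01p.exists_approx_ae (hp : 1 ≤ p) (hu : MemW01p Ω p u g) :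
    ∃ φ : ℕ → EuclideanSpace ℝ (Fin N) → ℝ, (∀ n, IsTestFunction Ω (φ n)) ∧
    Tendsto (fun n => eLpNorm (fun x => φ n x - u x) (ENNReal.ofReal p) (volume.restrict Ω))
      atTop (𝓝 0) ∧
    Tendsto (fun n => eLpNorm (fun x => gradient (φ n) x - g x) (ENNReal.ofReal p)
      (volume.restrict Ω)) atTop (𝓝 0) ∧
    ∀ᵐ x ∂(volume.restrict Ω), Tendsto (fun n => φ n x) atTop (𝓝 (u x)) := by
  obtain ⟨φ, hφ, a1, a2⟩ := hu.approx
  obtain ⟨k, hk, hae⟩ := exists_subseq_tendsto_ae (ofReal_ne_zero' hp)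
    (fun n => ((hφ n).memLp (ENNReal.ofReal p) (volume.restrict Ω)).aestronglyMeasurable)
    hu.memLp.aestronglyMeasurable a1
  exact ⟨fun n => φ (k n), fun n => hφ _, a1.comp hk.tendsto_atTop, a2.comp hk.tendsto_atTop, hae⟩

lemma norm_image_sub_le_of_deriv_le' {F : ℝ → ℝ} {C : ℝ} (hF : ContDiff ℝ ∞ F)
    (hC : ∀ s, |deriv F s| ≤ C) (s t : ℝ) : ‖F s - F t‖ ≤ C * ‖s - t‖ :=
  Convex.norm_image_sub_le_of_norm_deriv_le (s := univ)
    (fun x _ => hF.differentiable (by simp) x) (fun x _ => hC x) convex_univ (mem_univ _)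
    (mem_univ _)

/-- The gradient error splits as `F'(φ_n)(∇φ_n - g) + (F'(φ_n) - F'(u)) g`. The first part is
controlled by the bound on `F'`; the second tends to zero by dominated convergence along
approximants that also converge a.e. The condition `F 0 = 0` keeps `F ∘ φ_n` compactly supported in
`Ω`. -/
lemma MemW01p.comp [IsFiniteMeasure (volume.restrict Ω)] (hp : 1 ≤ p) (hu : MemW01p Ω p u g)
    {F : ℝ → ℝ} (hF : ContDiff ℝ ∞ F) (hF0 : F 0 = 0) {C : ℝ} (hC : ∀ s, |deriv F s| ≤ C) :
    MemW01p Ω p (fun x => F (u x)) (fun x => deriv F (u x) • g x) := by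
  obtain ⟨φ, hφ, a1, a2, hae⟩ := hu.exists_approx_ae hp
  have hF' : Continuous (deriv F) := hF.continuous_deriv (by simp)
  have mu : MemLp (fun x => F (u x)) (ENNReal.ofReal p) (volume.restrict Ω) := by
    refine hu.memLp.of_le_mul (c := C)
      (hF.continuous.comp_aestronglyMeasurable hu.memLp.aestronglyMeasurable)
      (Eventually.of_forall fun x => ?_)
    simpa [hF0] using norm_image_sub_le_of_deriv_le' hF hC (u x) 0
  have mdu := hF'.comp_aestronglyMeasurable hu.memLp.aestronglyMeasurable
  have mg : MemLp (fun x => deriv F (u x) • g x) (ENNReal.ofReal p) (volume.restrict Ω) := by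
    refine hu.memLp_grad.of_le_mul (c := C) (mdu.smul hu.memLp_grad.aestronglyMeasurable)
      (Eventually.of_forall fun x => ?_)
    rw [norm_smul]
    exact mul_le_mul_of_nonneg_right (hC _) (norm_nonneg _)
  refine MemW01p.of_approx hp mu mg (fun n => (hφ n).comp hF hF0) ?_ ?_
  · exact tendsto_eLpNorm_of_le_mul C
      (fun n => Eventually.of_forall fun x => norm_image_sub_le_of_deriv_le' hF hC _ _) a1
  · have mn : ∀ n, AEStronglyMeasurable (fun x => deriv F (φ n x)) (volume.restrict Ω) :=
      fun n => (hF'.comp (hφ n).smooth.continuous).aestronglyMeasurable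
    have b1 : Tendsto (fun n => eLpNorm (fun x => deriv F (φ n x) • (gradient (φ n) x - g x))
        (ENNReal.ofReal p) (volume.restrict Ω)) atTop (𝓝 0) := by
      refine tendsto_eLpNorm_of_le_mul C (fun n => Eventually.of_forall fun x => ?_) a2
      rw [norm_smul]
      exact mul_le_mul_of_nonneg_right (hC _) (norm_nonneg _)
    have b2 : Tendsto (fun n => eLpNorm (fun x => (deriv F (φ n x) - deriv F (u x)) • g x)
        (ENNReal.ofReal p) (volume.restrict Ω)) atTop (𝓝 0) := by
      refine tendsto_eLpNorm_zero_of_dominated (b := fun x => (C + C) * ‖g x‖)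
        (ofReal_ne_zero' hp) ENNReal.ofReal_ne_top
        (fun n => ((mn n).sub mdu).smul hu.memLp_grad.aestronglyMeasurable)
        (hu.memLp_grad.norm.const_mul _) (fun n => Eventually.of_forall fun x => ?_) ?_
      · rw [norm_smul]
        exact mul_le_mul_of_nonneg_right ((norm_sub_le _ _).trans (add_le_add (hC _) (hC _)))
          (norm_nonneg _)
      · filter_upwards [hae] with x hx
        have h3 := (((hF'.tendsto _).comp hx).sub_const (deriv F (u x))).smul_const (g x)
        simpa using h3
    have := tendsto_eLpNorm_add (one_le_ofReal hp)
      (fun n => (mn n).smul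
        (((hφ n).memLp_gradient (ENNReal.ofReal p) _).sub hu.memLp_grad).aestronglyMeasurable)
      (fun n => ((mn n).sub mdu).smul hu.memLp_grad.aestronglyMeasurable) b1 b2
    refine this.congr fun n => ?_
    congr 1; ext1 x
    rw [(hφ n).gradient_comp hF]
    simp only [Pi.smul_apply', Pi.sub_apply, smul_sub, sub_smul]
    abel

lemma MemW01p.mul_test [IsFiniteMeasure (volume.restrict Ω)] (hp : 1 ≤ p) (hu : MemW01p Ω p u g)
    {η : EuclideanSpace ℝ (Fin N) → ℝ} (hη : IsTestFunction Ω η) :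
    MemW01p Ω p (fun x => η x * u x) (fun x => η x • g x + u x • gradient η x) := by
  obtain ⟨φ, hφ, a1, a2⟩ := hu.approx
  obtain ⟨C, hC⟩ := hη.bounded
  obtain ⟨D, hD⟩ := hη.bounded_gradient
  have mη : AEStronglyMeasurable η (volume.restrict Ω) :=
    hη.smooth.continuous.aestronglyMeasurable
  have mη' : AEStronglyMeasurable (gradient η) (volume.restrict Ω) :=
    hη.continuous_gradient.aestronglyMeasurable
  have le1 : ∀ (x : EuclideanSpace ℝ (Fin N)) (s : ℝ), ‖η x * s‖ ≤ C * ‖s‖ := fun x s => by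
    rw [norm_mul]; exact mul_le_mul_of_nonneg_right (hC _) (norm_nonneg _)
  have le2 : ∀ x (s : EuclideanSpace ℝ (Fin N)), ‖η x • s‖ ≤ C * ‖s‖ := fun x s => by
    rw [norm_smul]; exact mul_le_mul_of_nonneg_right (hC _) (norm_nonneg _)
  have le3 : ∀ (x : EuclideanSpace ℝ (Fin N)) (s : ℝ), ‖s • gradient η x‖ ≤ D * ‖s‖ :=
    fun x s => by
      rw [norm_smul, mul_comm]; exact mul_le_mul_of_nonneg_right (hD _) (norm_nonneg _)
  refine MemW01p.of_approx hp
    (hu.memLp.of_le_mul (mη.mul hu.memLp.aestronglyMeasurable)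
      (Eventually.of_forall fun x => le1 x (u x)))
    ((hu.memLp_grad.of_le_mul (mη.smul hu.memLp_grad.aestronglyMeasurable)
      (Eventually.of_forall fun x => le2 x (g x))).add
     (hu.memLp.of_le_mul (hu.memLp.aestronglyMeasurable.smul mη')
      (Eventually.of_forall fun x => le3 x (u x))))
    (fun n => (hφ n).mul_left hη.smooth) ?_ ?_
  · refine tendsto_eLpNorm_of_le_mul C (fun n => Eventually.of_forall fun x => ?_) a1
    rw [← mul_sub]; exact le1 x _
  · have b1 : Tendsto (fun n => eLpNorm (fun x => η x • (gradient (φ n) x - g x))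
        (ENNReal.ofReal p) (volume.restrict Ω)) atTop (𝓝 0) :=
      tendsto_eLpNorm_of_le_mul C (fun n => Eventually.of_forall fun x => le2 x _) a2
    have b2 : Tendsto (fun n => eLpNorm (fun x => (φ n x - u x) • gradient η x)
        (ENNReal.ofReal p) (volume.restrict Ω)) atTop (𝓝 0) :=
      tendsto_eLpNorm_of_le_mul D (fun n => Eventually.of_forall fun x => le3 x _) a1
    have := tendsto_eLpNorm_add (one_le_ofReal hp)
      (fun n => mη.smul
        (((hφ n).memLp_gradient (ENNReal.ofReal p) _).sub hu.memLp_grad).aestronglyMeasurable)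
      (fun n => (((hφ n).memLp (ENNReal.ofReal p) _).sub
        hu.memLp).aestronglyMeasurable.smul mη') b1 b2
    refine this.congr fun n => ?_
    congr 1; ext1 x
    rw [(hφ n).gradient_mul_left hη.smooth]
    simp only [Pi.smul_apply', Pi.sub_apply, smul_sub, sub_smul]
    abel

/-! ### The absolute value of a Sobolev function -/

lemma contDiff_sqrt_sq_add {δ : ℝ} (hδ : 0 < δ) :
    ContDiff ℝ ∞ (fun s : ℝ => √(s ^ 2 + δ ^ 2)) :=
  ContDiff.sqrt (by fun_prop) (fun s => by positivity)

lemma deriv_sqrt_sq_add {δ : ℝ} (hδ : 0 < δ) (s : ℝ) :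
    deriv (fun s : ℝ => √(s ^ 2 + δ ^ 2) - δ) s = s / √(s ^ 2 + δ ^ 2) := by
  have h1 : HasDerivAt (fun s : ℝ => s ^ 2 + δ ^ 2) (2 * s) s := by
    simpa using (hasDerivAt_pow 2 s).add_const (δ ^ 2)
  rw [((h1.sqrt (by positivity)).sub_const δ).deriv]
  field_simp

lemma abs_le_sqrt_sq_add (s δ : ℝ) : |s| ≤ √(s ^ 2 + δ ^ 2) :=
  Real.abs_le_sqrt (by nlinarith [sq_nonneg δ])

lemma sqrt_sq_add_le (s : ℝ) {δ : ℝ} (hδ : 0 ≤ δ) : √(s ^ 2 + δ ^ 2) ≤ |s| + δ := by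
  rw [Real.sqrt_le_left (by positivity)]
  nlinarith [sq_abs s, mul_nonneg (abs_nonneg s) hδ]

/-- The functions `√(s² + δ²) - δ` are smooth, vanish at `0`, have slopes bounded by `1`, and
converge with their derivatives to `|s|` and `sign s`. Since `s/√(s² + δ²)` is `0` at `s = 0`, the
limit gradient is `0` on `{u = 0}` without any knowledge of `g` there. -/
lemma MemW01p.abs [IsFiniteMeasure (volume.restrict Ω)] (hp : 1 ≤ p) (hu : MemW01p Ω p u g) :
    MemW01p Ω p (fun x => |u x|) (fun x => (SignType.sign (u x) : ℝ) • g x) := by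
  have hδ : ∀ n : ℕ, (0 : ℝ) < 1 / ((n : ℝ) + 1) := fun n => by positivity
  have hlim := tendsto_one_div_add_atTop_nhds_zero_nat (𝕜 := ℝ)
  have hsq : ∀ s : ℝ, Tendsto (fun n : ℕ => √(s ^ 2 + (1 / ((n : ℝ) + 1)) ^ 2)) atTop (𝓝 |s|) := by
    intro s
    have h1 : Tendsto (fun n : ℕ => s ^ 2 + (1 / ((n : ℝ) + 1)) ^ 2) atTop (𝓝 (s ^ 2)) := by
      simpa using (hlim.pow 2).const_add (s ^ 2)
    simpa [Real.sqrt_sq_eq_abs] using h1.sqrt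
  have hsign : ∀ s : ℝ, Tendsto (fun n : ℕ => s / √(s ^ 2 + (1 / ((n : ℝ) + 1)) ^ 2)) atTop
      (𝓝 (SignType.sign s : ℝ)) := by
    intro s
    rcases eq_or_ne s 0 with rfl | hs
    · simp
    · have := (tendsto_const_nhds (x := s)).div (hsq s) (abs_ne_zero.2 hs)
      rwa [div_eq_of_eq_mul (abs_ne_zero.2 hs) (sign_mul_abs s).symm] at this
  have hle : ∀ (n : ℕ) (s : ℝ), |s / √(s ^ 2 + (1 / ((n : ℝ) + 1)) ^ 2)| ≤ 1 := fun n s => by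
    rw [abs_div, abs_of_nonneg (Real.sqrt_nonneg _)]
    exact div_le_one_of_le₀ (abs_le_sqrt_sq_add _ _) (Real.sqrt_nonneg _)
  have hW := fun n : ℕ => hu.comp (F := fun s => √(s ^ 2 + (1 / ((n : ℝ) + 1)) ^ 2)
    - 1 / ((n : ℝ) + 1)) hp
    ((contDiff_sqrt_sq_add (hδ n)).sub contDiff_const)
    (by rw [zero_pow two_ne_zero, zero_add, Real.sqrt_sq (hδ n).le, sub_self]) (C := 1)
    (fun s => by rw [deriv_sqrt_sq_add (hδ n)]; exact hle n s)
  simp only [deriv_sqrt_sq_add (hδ _)] at hW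
  have sgn_le : ∀ s : ℝ, ‖(SignType.sign s : ℝ)‖ ≤ 1 := fun s => by
    rcases lt_trichotomy s 0 with h | h | h <;> simp [h]
  have mg : AEStronglyMeasurable (fun x => (SignType.sign (u x) : ℝ) • g x) (volume.restrict Ω) := by
    refine aestronglyMeasurable_of_tendsto_ae atTop (fun n => (hW n).memLp_grad.aestronglyMeasurable)
      (Eventually.of_forall fun x => ?_)
    exact (hsign (u x)).smul_const (g x)
  have mg' : MemLp (fun x => (SignType.sign (u x) : ℝ) • g x) (ENNReal.ofReal p) (volume.restrict Ω) :=
    hu.memLp_grad.of_le mg (Eventually.of_forall fun x => by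
      rw [norm_smul]
      exact mul_le_of_le_one_left (norm_nonneg _) (sgn_le _))
  refine MemW01p.of_tendsto hp hu.memLp.abs mg' hW ?_ ?_
  · refine tendsto_eLpNorm_zero_of_dominated (b := fun _ => 1)
      (ofReal_ne_zero' hp) ENNReal.ofReal_ne_top
      (fun n => ((hW n).memLp.sub hu.memLp.abs).aestronglyMeasurable)
      (memLp_const 1) (fun n => Eventually.of_forall fun x => ?_)
      (Eventually.of_forall fun x => ?_)
    · have h1 := abs_le_sqrt_sq_add (u x) (1 / ((n : ℝ) + 1))
      have h2 := sqrt_sq_add_le (u x) (hδ n).le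
      have h3 : 1 / ((n : ℝ) + 1) ≤ 1 := by
        rw [div_le_one (by positivity)]; linarith [Nat.cast_nonneg (α := ℝ) n]
      rw [Real.norm_eq_abs, abs_le]
      constructor <;> linarith
    · simpa using ((hsq (u x)).sub hlim).sub_const |u x|
  · refine tendsto_eLpNorm_zero_of_dominated (b := fun x => 2 * ‖g x‖)
      (ofReal_ne_zero' hp) ENNReal.ofReal_ne_top
      (fun n => ((hW n).memLp_grad.sub mg').aestronglyMeasurable)
      (hu.memLp_grad.norm.const_mul _) (fun n => Eventually.of_forall fun x => ?_)
      (Eventually.of_forall fun x => ?_)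
    · rw [← sub_smul, norm_smul]
      refine mul_le_mul_of_nonneg_right ((norm_sub_le _ _).trans ?_) (norm_nonneg _)
      linarith [hle n (u x), sgn_le (u x), Real.norm_eq_abs (u x / √(u x ^ 2 + (1 / ((n : ℝ) + 1)) ^ 2))]
    · have := ((hsign (u x)).smul_const (g x)).sub_const ((SignType.sign (u x) : ℝ) • g x)
      rw [sub_self] at this
      exact this

end W01p

/-! ### Translation estimates -/

section Translation

variable {p : ℝ}

/-- Jensen's inequality for `s ↦ s^p`, read off from the monotonicity of `L^q` norms on a
probability space. -/
lemma rpow_lintegral_le {α : Type*} [MeasurableSpace α] {ν : Measure α} [IsProbabilityMeasure ν]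
    (hp : 1 ≤ p) {f : α → ℝ≥0∞} (hf : AEMeasurable f ν) :
    (∫⁻ a, f a ∂ν) ^ p ≤ ∫⁻ a, f a ^ p ∂ν := by
  have hp0 : 0 < p := by linarith
  have h := eLpNorm_le_eLpNorm_of_exponent_le (μ := ν) (one_le_ofReal hp) hf.aestronglyMeasurable
  rw [eLpNorm_one_eq_lintegral_enorm, eLpNorm_eq_lintegral_rpow_enorm_toReal
    (ofReal_ne_zero' hp) ENNReal.ofReal_ne_top, ENNReal.toReal_ofReal hp0.le] at h
  have h2 := ENNReal.rpow_le_rpow h hp0.le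
  rw [← ENNReal.rpow_mul, one_div_mul_cancel hp0.ne', ENNReal.rpow_one] at h2
  simpa using h2

lemma enorm_sub_le_lintegral_gradient {φ : EuclideanSpace ℝ (Fin N) → ℝ} (hφ : ContDiff ℝ 1 φ)
    (y h : EuclideanSpace ℝ (Fin N)) :
    ‖φ (y + h) - φ y‖ₑ ≤ ‖h‖ₑ * ∫⁻ s in Icc (0 : ℝ) 1, ‖gradient φ (y + s • h)‖ₑ := by
  have hc : Continuous (gradient φ) :=
    (InnerProductSpace.toDual ℝ (EuclideanSpace ℝ (Fin N))).symm.continuous.comp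
      (hφ.continuous_fderiv one_ne_zero)
  have hd : ∀ s : ℝ, HasDerivAt (fun s : ℝ => φ (y + s • h)) (fderiv ℝ φ (y + s • h) h) s := by
    intro s
    have h1 : HasDerivAt (fun s : ℝ => y + s • h) h s := by
      simpa using ((hasDerivAt_id s).smul_const h).const_add y
    exact (hφ.differentiable one_ne_zero _).hasFDerivAt.comp_hasDerivAt s h1
  have h2 : ∫ s in (0 : ℝ)..1, fderiv ℝ φ (y + s • h) h = φ (y + h) - φ y := by
    rw [intervalIntegral.integral_eq_sub_of_hasDerivAt (fun s _ => hd s)]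
    · simp
    · refine Continuous.intervalIntegrable ?_ _ _
      exact ((hφ.continuous_fderiv one_ne_zero).comp (by fun_prop)).clm_apply continuous_const
  rw [← h2, intervalIntegral.integral_of_le zero_le_one, ← integral_Icc_eq_integral_Ioc]
  refine (enorm_integral_le_lintegral_enorm _).trans ?_
  have hm : Measurable fun s : ℝ => ‖gradient φ (y + s • h)‖ₑ :=
    (hc.comp (by fun_prop : Continuous fun s : ℝ => y + s • h)).enorm.measurable
  rw [← lintegral_const_mul _ hm]
  refine lintegral_mono fun s => ?_
  have hle : ‖fderiv ℝ φ (y + s • h) h‖ ≤ ‖h‖ * ‖gradient φ (y + s • h)‖ := by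
    rw [← inner_gradient, mul_comm]
    exact norm_inner_le_norm _ _
  simpa only [← ofReal_norm, ENNReal.ofReal_mul (norm_nonneg h)] using ENNReal.ofReal_le_ofReal hle

/-- Jensen along the segment from `y` to `y + h`, Fubini, and translation invariance. Keeping `A`
and `D` separate serves two uses: the whole space, and `A = D ∩ (D - h)` with `D` convex. -/
lemma lintegral_translate_sub_le {φ : EuclideanSpace ℝ (Fin N) → ℝ} (hφ : ContDiff ℝ 1 φ)
    (hp : 1 ≤ p) (h : EuclideanSpace ℝ (Fin N)) {A D : Set (EuclideanSpace ℝ (Fin N))}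
    (hA : MeasurableSet A) (hD : MeasurableSet D)
    (hAD : ∀ y ∈ A, ∀ s ∈ Icc (0 : ℝ) 1, y + s • h ∈ D) :
    ∫⁻ y in A, ‖φ (y + h) - φ y‖ₑ ^ p ≤ ‖h‖ₑ ^ p * ∫⁻ x in D, ‖gradient φ x‖ₑ ^ p := by
  have hp0 : 0 ≤ p := by linarith
  have hc : Continuous (gradient φ) :=
    (InnerProductSpace.toDual ℝ (EuclideanSpace ℝ (Fin N))).symm.continuous.comp
      (hφ.continuous_fderiv one_ne_zero)
  have : IsProbabilityMeasure (volume.restrict (Icc (0 : ℝ) 1)) := ⟨by simp⟩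
  have h1 : ∀ y, ‖φ (y + h) - φ y‖ₑ ^ p ≤
      ‖h‖ₑ ^ p * ∫⁻ s in Icc (0 : ℝ) 1, ‖gradient φ (y + s • h)‖ₑ ^ p := by
    intro y
    refine (ENNReal.rpow_le_rpow (enorm_sub_le_lintegral_gradient hφ y h) hp0).trans ?_
    rw [ENNReal.mul_rpow_of_nonneg _ _ hp0]
    gcongr
    exact rpow_lintegral_le hp (hc.comp
      (by fun_prop : Continuous fun s : ℝ => y + s • h)).enorm.measurable.aemeasurable
  have hm : Measurable (fun z : EuclideanSpace ℝ (Fin N) × ℝ =>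
      ‖gradient φ (z.1 + z.2 • h)‖ₑ ^ p) := by
    have : Continuous fun z : EuclideanSpace ℝ (Fin N) × ℝ => gradient φ (z.1 + z.2 • h) :=
      hc.comp (by fun_prop)
    exact this.enorm.measurable.pow_const _
  calc ∫⁻ y in A, ‖φ (y + h) - φ y‖ₑ ^ p
      ≤ ∫⁻ y in A, ‖h‖ₑ ^ p * ∫⁻ s in Icc (0 : ℝ) 1, ‖gradient φ (y + s • h)‖ₑ ^ p :=
        lintegral_mono h1
    _ = ‖h‖ₑ ^ p * ∫⁻ y in A, ∫⁻ s in Icc (0 : ℝ) 1, ‖gradient φ (y + s • h)‖ₑ ^ p :=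
        lintegral_const_mul _ hm.lintegral_prod_right'
    _ = ‖h‖ₑ ^ p * ∫⁻ s in Icc (0 : ℝ) 1, ∫⁻ y in A, ‖gradient φ (y + s • h)‖ₑ ^ p := by
        rw [lintegral_lintegral_swap hm.aemeasurable]
    _ ≤ ‖h‖ₑ ^ p * ∫⁻ s in Icc (0 : ℝ) 1, ∫⁻ x in D, ‖gradient φ x‖ₑ ^ p := by
        refine mul_le_mul_right ?_ _
        refine setLIntegral_mono measurable_const fun s hs => ?_
        rw [← lintegral_indicator hA, ← lintegral_indicator hD]
        rw [← lintegral_add_right_eq_self (D.indicator fun x => ‖gradient φ x‖ₑ ^ p) (s • h)]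
        refine lintegral_mono fun y => ?_
        by_cases hy : y ∈ A
        · rw [indicator_of_mem hy, indicator_of_mem (hAD y hy s hs)]
        · rw [indicator_of_notMem hy]; exact zero_le
    _ = ‖h‖ₑ ^ p * ∫⁻ x in D, ‖gradient φ x‖ₑ ^ p := by simp

/-- Substitute `x = y + h` and exchange the integrals. For fixed `h` the variable `y` runs through
`D ∩ (D - h)`, and convexity keeps the segments inside `D`. Only `‖h‖ ≤ R` contributes, whence the
volume of the ball. -/
lemma lintegral_lintegral_sub_le {φ : EuclideanSpace ℝ (Fin N) → ℝ} (hφ : ContDiff ℝ 1 φ)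
    (hp : 1 ≤ p) {D : Set (EuclideanSpace ℝ (Fin N))} (hD : MeasurableSet D) (hconv : Convex ℝ D)
    {R : ℝ} (hR : ∀ x ∈ D, ∀ y ∈ D, dist x y ≤ R) :
    ∫⁻ y in D, ∫⁻ x in D, ‖φ x - φ y‖ₑ ^ p ≤
      volume (Metric.closedBall (0 : EuclideanSpace ℝ (Fin N)) R) * ENNReal.ofReal R ^ p *
        ∫⁻ x in D, ‖gradient φ x‖ₑ ^ p := by
  have hp0 : 0 ≤ p := by linarith
  have hφc := hφ.continuous
  let f : EuclideanSpace ℝ (Fin N) → EuclideanSpace ℝ (Fin N) → ℝ≥0∞ := fun y x =>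
    D.indicator (fun y => D.indicator (fun x => ‖φ x - φ y‖ₑ ^ p) x) y
  have hf : Measurable (fun z : EuclideanSpace ℝ (Fin N) × EuclideanSpace ℝ (Fin N) =>
      f z.1 (z.1 + z.2)) := by
    have : (fun z : EuclideanSpace ℝ (Fin N) × EuclideanSpace ℝ (Fin N) => f z.1 (z.1 + z.2)) =
        indicator {z | z.1 ∈ D ∧ z.1 + z.2 ∈ D} (fun z => ‖φ (z.1 + z.2) - φ z.1‖ₑ ^ p) := by
      ext z
      by_cases h1 : z.1 ∈ D <;> by_cases h2 : z.1 + z.2 ∈ D <;> simp [f, h1, h2]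
    rw [this]
    refine Measurable.indicator ?_ ((measurable_fst hD).inter
      ((measurable_fst.add measurable_snd) hD))
    have : Continuous fun z : EuclideanSpace ℝ (Fin N) × EuclideanSpace ℝ (Fin N) =>
      φ (z.1 + z.2) - φ z.1 := by fun_prop
    exact this.enorm.measurable.pow_const _
  calc ∫⁻ y in D, ∫⁻ x in D, ‖φ x - φ y‖ₑ ^ p
      = ∫⁻ y, ∫⁻ x, f y x := by
        rw [← lintegral_indicator hD]
        refine lintegral_congr fun y => ?_
        by_cases hy : y ∈ D
        · simp only [f, indicator_of_mem hy, lintegral_indicator hD]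
        · simp [f, indicator_of_notMem hy]
    _ = ∫⁻ y, ∫⁻ h, f y (y + h) :=
        lintegral_congr fun y => (lintegral_add_left_eq_self (f y) y).symm
    _ = ∫⁻ h, ∫⁻ y, f y (y + h) := lintegral_lintegral_swap hf.aemeasurable
    _ ≤ ∫⁻ h, (Metric.closedBall (0 : EuclideanSpace ℝ (Fin N)) R).indicator
          (fun _ => ENNReal.ofReal R ^ p * ∫⁻ x in D, ‖gradient φ x‖ₑ ^ p) h := by
        refine lintegral_mono fun h => ?_
        by_cases hh : h ∈ Metric.closedBall (0 : EuclideanSpace ℝ (Fin N)) R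
        · rw [indicator_of_mem hh]
          have hA : MeasurableSet (D ∩ (fun y => y + h) ⁻¹' D) :=
            hD.inter ((measurable_add_const h) hD)
          have e : ∀ y, f y (y + h) = (D ∩ (fun y => y + h) ⁻¹' D).indicator
              (fun y => ‖φ (y + h) - φ y‖ₑ ^ p) y := by
            intro y
            by_cases h1 : y ∈ D <;> by_cases h2 : y + h ∈ D <;> simp [f, h1, h2]
          simp only [e]
          rw [lintegral_indicator hA]
          refine (lintegral_translate_sub_le hφ hp h hA hD fun y hy s hs => ?_).trans ?_
          · have := hconv hy.1 hy.2 (sub_nonneg.2 hs.2) hs.1 (by ring)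
            convert this using 1
            module
          · gcongr
            rw [mem_closedBall_zero_iff] at hh
            rw [← ofReal_norm]
            exact ENNReal.ofReal_le_ofReal hh
        · rw [indicator_of_notMem hh, nonpos_iff_eq_zero, ← lintegral_zero]
          refine lintegral_congr fun y => ?_
          by_cases h1 : y ∈ D <;> by_cases h2 : y + h ∈ D <;> simp only [f, h1, h2,
            indicator_of_mem, not_false_eq_true, indicator_of_notMem]
          exact absurd (by simpa [mem_closedBall_zero_iff] using hR _ h2 _ h1) hh
    _ = _ := by
        rw [lintegral_indicator measurableSet_closedBall]
        simp only [lintegral_const, MeasurableSet.univ, Measure.restrict_apply, univ_inter]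
        ring

/-- Poincaré-type estimate on bounded convex sets, for Sobolev functions. -/
lemma MemW01p.lintegral_lintegral_sub_le {Ω : Set (EuclideanSpace ℝ (Fin N))}
    {u : EuclideanSpace ℝ (Fin N) → ℝ}
    {g : EuclideanSpace ℝ (Fin N) → EuclideanSpace ℝ (Fin N)} (hp : 1 ≤ p)
    (hu : MemW01p Ω p u g) {D : Set (EuclideanSpace ℝ (Fin N))} (hD : MeasurableSet D)
    (hDΩ : D ⊆ Ω) (hconv : Convex ℝ D) {R : ℝ} (hR : ∀ x ∈ D, ∀ y ∈ D, dist x y ≤ R) :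
    ∫⁻ y in D, ∫⁻ x in D, ‖u x - u y‖ₑ ^ p ≤
      volume (Metric.closedBall (0 : EuclideanSpace ℝ (Fin N)) R) * ENNReal.ofReal R ^ p *
        ∫⁻ x in D, ‖g x‖ₑ ^ p := by
  have hp0 : 0 < p := by linarith
  obtain ⟨φ, hφ, -, a2, hae⟩ := hu.exists_approx_ae hp
  have hae' := ae_restrict_of_ae_restrict_of_subset hDΩ hae
  have mono_D : volume.restrict D ≤ volume.restrict Ω := Measure.restrict_mono_set _ hDΩ
  have hgl : Tendsto (fun n => ∫⁻ x in D, ‖gradient (φ n) x‖ₑ ^ p) atTop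
      (𝓝 (∫⁻ x in D, ‖g x‖ₑ ^ p)) := by
    have a3 : Tendsto (fun n => eLpNorm (fun x => gradient (φ n) x - g x) (ENNReal.ofReal p)
        (volume.restrict D)) atTop (𝓝 0) :=
      tendsto_of_tendsto_of_tendsto_of_le_of_le tendsto_const_nhds a2 (fun _ => zero_le)
        (fun n => eLpNorm_mono_measure _ mono_D)
    have hgD := hu.memLp_grad.mono_measure mono_D
    have a4 : Tendsto (fun n => eLpNorm (gradient (φ n)) (ENNReal.ofReal p)
        (volume.restrict D)) atTop (𝓝 (eLpNorm g (ENNReal.ofReal p) (volume.restrict D))) := by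
      have : Fact (1 ≤ ENNReal.ofReal p) := ⟨one_le_ofReal hp⟩
      have hφD := fun n => (hφ n).memLp_gradient (ENNReal.ofReal p) (volume.restrict D)
      have b := (Lp.tendsto_Lp_iff_tendsto_eLpNorm'' _ hφD g hgD).2 a3
      have b2 := b.enorm
      simpa [Lp.enorm_toLp] using b2
    have a5 := ((ENNReal.continuous_rpow_const (y := p)).tendsto _).comp a4
    have e : ∀ f : EuclideanSpace ℝ (Fin N) → EuclideanSpace ℝ (Fin N),
        eLpNorm f (ENNReal.ofReal p) (volume.restrict D) ^ p = ∫⁻ x in D, ‖f x‖ₑ ^ p := fun f => by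
      rw [eLpNorm_eq_lintegral_rpow_enorm_toReal (ofReal_ne_zero' hp) ENNReal.ofReal_ne_top,
        ENNReal.toReal_ofReal hp0.le, ← ENNReal.rpow_mul, one_div_mul_cancel hp0.ne',
        ENNReal.rpow_one]
    rw [e] at a5
    exact a5.congr fun n => e _
  have hmeas : ∀ n, Measurable (fun z : EuclideanSpace ℝ (Fin N) × EuclideanSpace ℝ (Fin N) =>
      ‖φ n z.2 - φ n z.1‖ₑ ^ p) := fun n => by
    have := (hφ n).smooth.continuous
    have : Continuous fun z : EuclideanSpace ℝ (Fin N) × EuclideanSpace ℝ (Fin N) =>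
      φ n z.2 - φ n z.1 := by fun_prop
    exact this.enorm.measurable.pow_const _
  -- Fatou in each variable on the left, and convergence of the gradient integrals on the right.
  calc ∫⁻ y in D, ∫⁻ x in D, ‖u x - u y‖ₑ ^ p
      ≤ ∫⁻ y in D, liminf (fun n => ∫⁻ x in D, ‖φ n x - φ n y‖ₑ ^ p) atTop := by
        refine lintegral_mono_ae ?_
        filter_upwards [hae'] with y hy
        calc ∫⁻ x in D, ‖u x - u y‖ₑ ^ p
            ≤ ∫⁻ x in D, liminf (fun n => ‖φ n x - φ n y‖ₑ ^ p) atTop := by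
              refine lintegral_mono_ae ?_
              filter_upwards [hae'] with x hx
              have : Tendsto (fun n => ‖φ n x - φ n y‖ₑ ^ p) atTop (𝓝 (‖u x - u y‖ₑ ^ p)) :=
                ((ENNReal.continuous_rpow_const (y := p)).tendsto _).comp (hx.sub hy).enorm
              exact this.liminf_eq.ge
          _ ≤ _ := lintegral_liminf_le fun n => (hmeas n).comp measurable_prodMk_left
    _ ≤ liminf (fun n => ∫⁻ y in D, ∫⁻ x in D, ‖φ n x - φ n y‖ₑ ^ p) atTop :=
        lintegral_liminf_le fun n => (hmeas n).lintegral_prod_right'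
    _ ≤ liminf (fun n => volume (Metric.closedBall (0 : EuclideanSpace ℝ (Fin N)) R) *
          ENNReal.ofReal R ^ p * ∫⁻ x in D, ‖gradient (φ n) x‖ₑ ^ p) atTop :=
        liminf_le_liminf (Eventually.of_forall fun n =>
          PLap.lintegral_lintegral_sub_le ((hφ n).smooth.of_le (by simp)) hp hD hconv hR)
    _ = _ := by
        refine Tendsto.liminf_eq (ENNReal.Tendsto.const_mul hgl (Or.inr ?_))
        exact ENNReal.mul_ne_top measure_closedBall_lt_top.ne
          (ENNReal.rpow_ne_top_of_nonneg hp0.le ENNReal.ofReal_ne_top)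

end Translation

/-! ### Compactness -/

section Cauchy

variable {α F : Type*} [MeasurableSpace α] {μ : Measure α} [NormedAddCommGroup F]

lemma exists_tendsto_eLpNorm_of_cauchy [CompleteSpace F] {q : ℝ≥0∞} (hq : 1 ≤ q) {f : ℕ → α → F}
    (hf : ∀ n, MemLp (f n) q μ)
    (h : Tendsto (fun nm : ℕ × ℕ => eLpNorm (fun x => f nm.1 x - f nm.2 x) q μ) atTop (𝓝 0)) :
    ∃ g, MemLp g q μ ∧ Tendsto (fun n => eLpNorm (fun x => f n x - g x) q μ) atTop (𝓝 0) := by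
  have : Fact (1 ≤ q) := ⟨hq⟩
  have hc : CauchySeq fun n => (hf n).toLp (f n) := by
    rw [cauchySeq_iff_tendsto_dist_atTop_0]
    have h2 := (ENNReal.tendsto_toReal ENNReal.zero_ne_top).comp h
    refine h2.congr fun nm => ?_
    rw [Lp.dist_def]
    refine congrArg ENNReal.toReal (eLpNorm_congr_ae ?_)
    filter_upwards [(hf nm.1).coeFn_toLp, (hf nm.2).coeFn_toLp] with x h1 h2
    simp [h1, h2]
  obtain ⟨g, hg⟩ := cauchySeq_tendsto_of_complete hc
  refine ⟨g, Lp.memLp g, ?_⟩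
  have := (Lp.tendsto_Lp_iff_tendsto_eLpNorm'' f hf g (Lp.memLp g)).1 (by simpa using hg)
  exact this

lemma tendsto_prod_eLpNorm_sub {q : ℝ≥0∞} (hq : 1 ≤ q) {f : ℕ → α → F} {g : α → F}
    (hf : ∀ n, AEStronglyMeasurable (f n) μ) (hg : AEStronglyMeasurable g μ)
    (h : Tendsto (fun n => eLpNorm (fun x => f n x - g x) q μ) atTop (𝓝 0)) :
    Tendsto (fun nm : ℕ × ℕ => eLpNorm (fun x => f nm.1 x - f nm.2 x) q μ) atTop (𝓝 0) := by
  rw [← prod_atTop_atTop_eq]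
  have h2 := tendsto_eLpNorm_add hq (fun nm : ℕ × ℕ => (hf nm.1).sub hg)
    (fun nm : ℕ × ℕ => hg.sub (hf nm.2)) (h.comp tendsto_fst)
    ((h.comp tendsto_snd).congr fun nm => ?_)
  · simpa using h2
  · exact eLpNorm_sub_comm _ _ _ _

end Cauchy

lemma exists_subseq_tendsto_inner {H : Type*} [NormedAddCommGroup H] [InnerProductSpace ℝ H]
    [TopologicalSpace.SeparableSpace H] [CompleteSpace H] {x : ℕ → H} {K : ℝ}
    (hx : ∀ n, ‖x n‖ ≤ K) :
    ∃ k : ℕ → ℕ, StrictMono k ∧ ∀ y : H, ∃ a : ℝ, Tendsto (fun n => inner ℝ (x (k n)) y)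
      atTop (𝓝 a) := by
  have hs := WeakDual.isSeqCompact_closedBall ℝ H 0 K
  obtain ⟨a, -, k, hk, hlim⟩ := hs (x := fun n => StrongDual.toWeakDual
    (InnerProductSpace.toDual ℝ H (x n))) (fun n => by simpa using hx n)
  refine ⟨k, hk, fun y => ⟨a y, ?_⟩⟩
  have := ((WeakDual.eval_continuous y).tendsto a).comp hlim
  exact this

/-- Weak sequential compactness in `L²`, tested only on indicators: the ball averages used below
need nothing more. -/
lemma exists_subseq_tendsto_setIntegral {Ω : Set (EuclideanSpace ℝ (Fin N))}
    [IsFiniteMeasure (volume.restrict Ω)]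
    {u : ℕ → EuclideanSpace ℝ (Fin N) → ℝ} (hu : ∀ n, MemLp (u n) 2 (volume.restrict Ω))
    {K : ℝ≥0∞} (hKtop : K ≠ ⊤) (hK : ∀ n, eLpNorm (u n) 2 (volume.restrict Ω) ≤ K) :
    ∃ k : ℕ → ℕ, StrictMono k ∧ ∀ s : Set (EuclideanSpace ℝ (Fin N)), MeasurableSet s →
      ∃ a : ℝ, Tendsto (fun n => ∫ x in s, u (k n) x ∂(volume.restrict Ω)) atTop (𝓝 a) := by
  have : Fact ((2 : ℝ≥0∞) ≠ ⊤) := ⟨by norm_num⟩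
  obtain ⟨k, hk, h⟩ := exists_subseq_tendsto_inner (x := fun n => (hu n).toLp (u n))
    (K := K.toReal) (fun n => by
      rw [Lp.norm_toLp]; exact ENNReal.toReal_mono hKtop (hK n))
  refine ⟨k, hk, fun s hs => ?_⟩
  obtain ⟨a, ha⟩ := h (indicatorConstLp 2 hs (measure_ne_top _ s) 1)
  refine ⟨a, ha.congr fun n => ?_⟩
  rw [real_inner_comm, L2.inner_indicatorConstLp_one]
  exact setIntegral_congr_ae hs ((hu (k n)).coeFn_toLp.mono fun x hx _ => hx)

/-! ### Rellich compactness through ball averages -/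

section Rellich

variable {p : ℝ}

/-- The left side is an average of differences `φ(x + h) - φ(x)`, so Jensen and Fubini reduce it to
the translation estimate. Working with compact support on the whole space spares any regularity of
`∂Ω`. -/
lemma lintegral_average_sub_le {φ : EuclideanSpace ℝ (Fin N) → ℝ} (hφ : ContDiff ℝ 1 φ)
    (hφc : HasCompactSupport φ) (hp : 1 ≤ p) {ν : Measure (EuclideanSpace ℝ (Fin N))}
    [IsProbabilityMeasure ν] {ε : ℝ} (hν : ∀ᵐ h ∂ν, ‖h‖ ≤ ε) :
    ∫⁻ x, ‖φ x - ∫ h, φ (x + h) ∂ν‖ₑ ^ p ≤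
      ENNReal.ofReal ε ^ p * ∫⁻ x, ‖gradient φ x‖ₑ ^ p := by
  have hp0 : 0 ≤ p := by linarith
  have hc := hφ.continuous
  obtain ⟨C, hC⟩ := hφc.exists_bound_of_continuous hc
  have hint : ∀ x, Integrable (fun h => φ (x + h)) ν := fun x =>
    Integrable.of_bound (hc.comp (by fun_prop)).aestronglyMeasurable C
      (Eventually.of_forall fun h => hC _)
  have h1 : ∀ x, ‖φ x - ∫ h, φ (x + h) ∂ν‖ₑ ^ p ≤ ∫⁻ h, ‖φ (x + h) - φ x‖ₑ ^ p ∂ν := by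
    intro x
    have e : φ x - ∫ h, φ (x + h) ∂ν = - ∫ h, (φ (x + h) - φ x) ∂ν := by
      rw [integral_sub (hint x) (integrable_const _)]; simp
    rw [e, enorm_neg]
    refine (ENNReal.rpow_le_rpow (enorm_integral_le_lintegral_enorm _) hp0).trans ?_
    exact rpow_lintegral_le hp
      (by fun_prop : Continuous fun h => φ (x + h) - φ x).enorm.measurable.aemeasurable
  have hm : Measurable (fun z : EuclideanSpace ℝ (Fin N) × EuclideanSpace ℝ (Fin N) =>
      ‖φ (z.1 + z.2) - φ z.1‖ₑ ^ p) :=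
    (by fun_prop : Continuous fun z : EuclideanSpace ℝ (Fin N) × EuclideanSpace ℝ (Fin N) =>
      φ (z.1 + z.2) - φ z.1).enorm.measurable.pow_const _
  calc ∫⁻ x, ‖φ x - ∫ h, φ (x + h) ∂ν‖ₑ ^ p
      ≤ ∫⁻ x, ∫⁻ h, ‖φ (x + h) - φ x‖ₑ ^ p ∂ν := lintegral_mono h1
    _ = ∫⁻ h, (∫⁻ x, ‖φ (x + h) - φ x‖ₑ ^ p) ∂ν := lintegral_lintegral_swap hm.aemeasurable
    _ ≤ ∫⁻ _, (ENNReal.ofReal ε ^ p * ∫⁻ x, ‖gradient φ x‖ₑ ^ p) ∂ν := by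
        refine lintegral_mono_ae ?_
        filter_upwards [hν] with h hh
        have := lintegral_translate_sub_le hφ hp h MeasurableSet.univ MeasurableSet.univ
          (fun _ _ _ _ => mem_univ _)
        simp only [Measure.restrict_univ] at this
        refine this.trans ?_
        gcongr
        rw [← ofReal_norm]
        exact ENNReal.ofReal_le_ofReal hh
    _ = _ := by simp

lemma eLpNorm_average_sub_le {Ω : Set (EuclideanSpace ℝ (Fin N))}
    {φ : EuclideanSpace ℝ (Fin N) → ℝ} (hφ : IsTestFunction Ω φ) (hp : 1 ≤ p)
    {ν : Measure (EuclideanSpace ℝ (Fin N))}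
    [IsProbabilityMeasure ν] {ε : ℝ} (hν : ∀ᵐ h ∂ν, ‖h‖ ≤ ε) (hΩ : MeasurableSet Ω) :
    eLpNorm (fun x => φ x - ∫ h, φ (x + h) ∂ν) (ENNReal.ofReal p) (volume.restrict Ω) ≤
      ENNReal.ofReal ε * eLpNorm (gradient φ) (ENNReal.ofReal p) (volume.restrict Ω) := by
  have hp0 : 0 < p := by linarith
  have h1 := (setLIntegral_le_lintegral Ω _).trans
    (lintegral_average_sub_le (hφ.smooth.of_le (by simp)) hφ.compact hp hν)
  have h2 : ∫⁻ x, ‖gradient φ x‖ₑ ^ p = ∫⁻ x in Ω, ‖gradient φ x‖ₑ ^ p := by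
    rw [← lintegral_indicator hΩ]
    refine lintegral_congr fun x => ?_
    by_cases hx : x ∈ Ω
    · rw [indicator_of_mem hx]
    · rw [indicator_of_notMem hx, hφ.gradient_eq_zero hx, enorm_zero, ENNReal.zero_rpow_of_pos hp0]
  rw [h2] at h1
  simp only [eLpNorm_eq_lintegral_rpow_enorm_toReal (ofReal_ne_zero' hp) ENNReal.ofReal_ne_top,
    ENNReal.toReal_ofReal hp0.le]
  refine (ENNReal.rpow_le_rpow h1 (by positivity : 0 ≤ 1 / p)).trans ?_
  rw [ENNReal.mul_rpow_of_nonneg _ _ (by positivity : 0 ≤ 1 / p), ← ENNReal.rpow_mul,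
    mul_one_div_cancel hp0.ne', ENNReal.rpow_one]

/-- Kolmogorov–Riesz argument. Averaging over balls of radius `ε` changes `φ n` by at most `ε K` in
`L^p`, uniformly in `n`. For fixed `ε` the averages are set integrals, hence converge pointwise, and
they are bounded, so they converge in `L^p` on the finite measure. Three errors of size `δ/3`
remain. -/
lemma IsTestFunction.cauchy_of_tendsto_setIntegral {Ω : Set (EuclideanSpace ℝ (Fin N))}
    [IsFiniteMeasure (volume.restrict Ω)] (hΩ : MeasurableSet Ω) (hp : 1 ≤ p)
    {φ : ℕ → EuclideanSpace ℝ (Fin N) → ℝ} (hφ : ∀ n, IsTestFunction Ω (φ n))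
    {K : ℝ≥0∞} (hKtop : K ≠ ⊤)
    (hK : ∀ n, eLpNorm (gradient (φ n)) (ENNReal.ofReal p) (volume.restrict Ω) ≤ K)
    {L : ℝ} (hL : ∀ n, ∫ x in Ω, ‖φ n x‖ ≤ L)
    (hlim : ∀ s : Set (EuclideanSpace ℝ (Fin N)), MeasurableSet s →
      ∃ a : ℝ, Tendsto (fun n => ∫ x in s, φ n x ∂(volume.restrict Ω)) atTop (𝓝 a)) :
    Tendsto (fun nm : ℕ × ℕ => eLpNorm (fun x => φ nm.1 x - φ nm.2 x) (ENNReal.ofReal p)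
      (volume.restrict Ω)) atTop (𝓝 0) := by
  rw [ENNReal.tendsto_nhds_zero]
  intro δ hδ
  obtain ⟨ε, hε, hεK⟩ : ∃ ε : ℝ, 0 < ε ∧ ENNReal.ofReal ε * K ≤ δ / 3 := by
    have h3 : δ / 3 ≠ 0 := (ENNReal.div_pos hδ.ne' (by norm_num)).ne'
    have ht : Tendsto (fun ε : ℝ => ENNReal.ofReal ε * K) (𝓝[>] 0) (𝓝 0) := by
      have : Tendsto (fun ε : ℝ => ENNReal.ofReal ε) (𝓝[>] 0) (𝓝 0) := by
        have := (ENNReal.continuous_ofReal.tendsto 0).mono_left (nhdsWithin_le_nhds (s := Ioi 0))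
        simpa using this
      simpa using ENNReal.Tendsto.mul_const this (Or.inr hKtop)
    obtain ⟨ε, h1, h2⟩ := ((ht.eventually (ge_mem_nhds (pos_iff_ne_zero.2 h3))).and
      self_mem_nhdsWithin).exists
    exact ⟨ε, h2, h1⟩
  let B := Metric.ball (0 : EuclideanSpace ℝ (Fin N)) ε
  have hB0 : volume B ≠ 0 := (Metric.measure_ball_pos volume _ hε).ne'
  have hBt : volume B ≠ ⊤ := measure_ball_lt_top.ne
  let ν : Measure (EuclideanSpace ℝ (Fin N)) := (volume B)⁻¹ • volume.restrict B
  have hνp : IsProbabilityMeasure ν := ⟨by simp [ν, ENNReal.inv_mul_cancel hB0 hBt]⟩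
  have hν : ∀ᵐ h ∂ν, ‖h‖ ≤ ε := by
    refine Measure.ae_smul_measure ?_ _
    filter_upwards [ae_restrict_mem measurableSet_ball] with h hh
    exact (mem_ball_zero_iff.1 hh).le
  let c : ℝ := ((volume B)⁻¹).toReal
  -- Since `φ n` vanishes off `Ω`, its average is a multiple of the integral over `ball x ε` with
  -- respect to the restricted measure, which is the quantity that converges by hypothesis.
  have hS : ∀ n x, ∫ h, φ n (x + h) ∂ν =
      c * ∫ y in Metric.ball x ε, φ n y ∂(volume.restrict Ω) := by
    intro n x
    rw [integral_smul_measure, smul_eq_mul]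
    congr 1
    rw [← integral_indicator measurableSet_ball, ← integral_indicator measurableSet_ball,
      ← integral_indicator hΩ, ← integral_add_left_eq_self (Ω.indicator _) x]
    refine integral_congr_ae (Eventually.of_forall fun h => ?_)
    beta_reduce
    have hm : x + h ∈ Metric.ball x ε ↔ h ∈ B := by simp [B]
    by_cases hh : h ∈ B
    · by_cases hx : x + h ∈ Ω
      · rw [indicator_of_mem hh, indicator_of_mem hx, indicator_of_mem (hm.2 hh)]
      · rw [indicator_of_mem hh, indicator_of_notMem hx, (hφ n).eq_zero hx]
    · by_cases hx : x + h ∈ Ω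
      · rw [indicator_of_notMem hh, indicator_of_mem hx, indicator_of_notMem (hm.not.2 hh)]
      · rw [indicator_of_notMem hh, indicator_of_notMem hx]
  have hlim' := fun x => hlim (Metric.ball x ε) measurableSet_ball
  choose a ha using hlim'
  have hSm : ∀ n, StronglyMeasurable fun x => ∫ h, φ n (x + h) ∂ν := fun n => by
    have : Continuous fun z : EuclideanSpace ℝ (Fin N) × EuclideanSpace ℝ (Fin N) =>
      φ n (z.1 + z.2) := (hφ n).smooth.continuous.comp (by fun_prop)
    exact this.stronglyMeasurable.integral_prod_right'
  have hSlim : ∀ x, Tendsto (fun n => ∫ h, φ n (x + h) ∂ν) atTop (𝓝 (c * a x)) := fun x => by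
    simp only [hS]; exact (ha x).const_mul c
  have hSb : ∀ n x, ‖∫ h, φ n (x + h) ∂ν‖ ≤ c * L := fun n x => by
    rw [hS, norm_mul, Real.norm_of_nonneg (ENNReal.toReal_nonneg)]
    refine mul_le_mul_of_nonneg_left ?_ ENNReal.toReal_nonneg
    refine (norm_integral_le_integral_norm _).trans ((setIntegral_le_integral ?_ ?_).trans (hL n))
    · exact (((hφ n).memLp 1 (volume.restrict Ω)).integrable le_rfl).norm
    · exact Eventually.of_forall fun x => norm_nonneg _
  have ham : StronglyMeasurable fun x => c * a x :=
    stronglyMeasurable_of_tendsto atTop hSm (tendsto_pi_nhds.2 hSlim)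
  have hab : ∀ x, ‖c * a x‖ ≤ c * L := fun x =>
    le_of_tendsto (hSlim x).norm (Eventually.of_forall fun n => hSb n x)
  have hSLp : Tendsto (fun n => eLpNorm (fun x => (∫ h, φ n (x + h) ∂ν) - c * a x)
      (ENNReal.ofReal p) (volume.restrict Ω)) atTop (𝓝 0) := by
    refine tendsto_eLpNorm_zero_of_dominated (b := fun _ => c * L + c * L)
      (ofReal_ne_zero' hp) ENNReal.ofReal_ne_top
      (fun n => ((hSm n).sub ham).aestronglyMeasurable) (memLp_const _)
      (fun n => Eventually.of_forall fun x =>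
        (norm_sub_le _ _).trans (add_le_add (hSb n x) (hab x)))
      (Eventually.of_forall fun x => ?_)
    simpa using (hSlim x).sub_const (c * a x)
  have hSc := tendsto_prod_eLpNorm_sub (one_le_ofReal hp)
    (fun n => (hSm n).aestronglyMeasurable) ham.aestronglyMeasurable hSLp
  have h3 : (0 : ℝ≥0∞) < δ / 3 := ENNReal.div_pos hδ.ne' (by norm_num)
  filter_upwards [hSc.eventually (ge_mem_nhds h3)] with nm hnm
  have hA : ∀ n, eLpNorm (fun x => φ n x - ∫ h, φ n (x + h) ∂ν) (ENNReal.ofReal p)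
      (volume.restrict Ω) ≤ δ / 3 := fun n =>
    (eLpNorm_average_sub_le (hφ n) hp hν hΩ).trans ((mul_le_mul_right (hK n) _).trans hεK)
  have hAm : ∀ n, AEStronglyMeasurable (fun x => φ n x - ∫ h, φ n (x + h) ∂ν)
      (volume.restrict Ω) := fun n =>
    ((hφ n).smooth.continuous.stronglyMeasurable.sub (hSm n)).aestronglyMeasurable
  have e : (fun x => φ nm.1 x - φ nm.2 x) =
      ((fun x => φ nm.1 x - ∫ h, φ nm.1 (x + h) ∂ν) +
      (fun x => (∫ h, φ nm.1 (x + h) ∂ν) - ∫ h, φ nm.2 (x + h) ∂ν)) -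
      (fun x => φ nm.2 x - ∫ h, φ nm.2 (x + h) ∂ν) := by
    ext x; simp only [Pi.add_apply, Pi.sub_apply]; ring
  have hmid : AEStronglyMeasurable (fun x => (∫ h, φ nm.1 (x + h) ∂ν) - ∫ h, φ nm.2 (x + h) ∂ν)
      (volume.restrict Ω) := ((hSm _).sub (hSm _)).aestronglyMeasurable
  rw [e]
  calc _ ≤ (δ / 3 + δ / 3) + δ / 3 := by
        refine (eLpNorm_sub_le ((hAm _).add hmid) (hAm _) (one_le_ofReal hp)).trans ?_
        refine add_le_add ((eLpNorm_add_le (hAm _) hmid (one_le_ofReal hp)).trans ?_) (hA _)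
        exact add_le_add (hA _) hnm
    _ = δ := ENNReal.add_thirds δ

/-- The Hölder factor is `μ(univ)^{1 - 1/q}` with exponent in `[0, 1]`, so `max 1 (μ univ)` serves
for all `q` at once, in particular for both `p` and `2`. -/
lemma exists_eLpNorm_one_le {α : Type*} [MeasurableSpace α] (μ : Measure α) [IsFiniteMeasure μ] :
    ∃ C : ℝ≥0∞, C ≠ ⊤ ∧ ∀ f : α → ℝ, AEStronglyMeasurable f μ → ∀ q : ℝ≥0∞, 1 ≤ q →
      eLpNorm f 1 μ ≤ eLpNorm f q μ * C := by
  refine ⟨max 1 (μ univ), (max_lt (by simp) (measure_lt_top _ _)).ne, ?_⟩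
  intro f hf q hq
  refine (eLpNorm_le_eLpNorm_mul_rpow_measure_univ hq hf).trans ?_
  gcongr
  have hex : (1 / (1 : ℝ≥0∞).toReal - 1 / q.toReal) ≤ 1 := by simp
  have hex0 : 0 ≤ (1 / (1 : ℝ≥0∞).toReal - 1 / q.toReal) := by
    rcases eq_or_ne q ⊤ with rfl | hq'
    · simp
    · have : 1 ≤ q.toReal := by simpa using ENNReal.toReal_mono hq' hq
      simp only [ENNReal.toReal_one, div_one, sub_nonneg]
      exact div_le_one_of_le₀ this (by linarith)
  rcases le_total (μ univ) 1 with h | h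
  · exact (ENNReal.rpow_le_one h hex0).trans (le_max_left _ _)
  · exact (ENNReal.rpow_le_rpow_of_exponent_le h hex).trans (by simp)

/-- Rellich-type compactness: a sequence bounded in `W_0^{1,p} ∩ L²` has a subsequence that is
convergent in `L^p`. -/
lemma exists_subseq_tendsto_of_memW01p {Ω : Set (EuclideanSpace ℝ (Fin N))}
    [IsFiniteMeasure (volume.restrict Ω)] (hΩ : MeasurableSet Ω) (hp : 1 ≤ p)
    {u : ℕ → EuclideanSpace ℝ (Fin N) → ℝ}
    {g : ℕ → EuclideanSpace ℝ (Fin N) → EuclideanSpace ℝ (Fin N)}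
    (hu : ∀ n, MemW01p Ω p (u n) (g n)) (hu2 : ∀ n, MemLp (u n) 2 (volume.restrict Ω))
    {K : ℝ≥0∞} (hKtop : K ≠ ⊤) (hK2 : ∀ n, eLpNorm (u n) 2 (volume.restrict Ω) ≤ K)
    (hKg : ∀ n, eLpNorm (g n) (ENNReal.ofReal p) (volume.restrict Ω) ≤ K) :
    ∃ k : ℕ → ℕ, StrictMono k ∧ ∃ v, MemLp v (ENNReal.ofReal p) (volume.restrict Ω) ∧
      Tendsto (fun n => eLpNorm (fun x => u (k n) x - v x) (ENNReal.ofReal p)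
        (volume.restrict Ω)) atTop (𝓝 0) := by
  obtain ⟨φ, hφ, b1, b2, c1, -⟩ := exists_seq_isTestFunction hu
  have c1' := tendsto_eLpNorm_of_exponent_le one_ne_zero (one_le_ofReal hp)
    (fun n => (((hφ n).memLp _ _).sub (hu n).memLp).aestronglyMeasurable) c1
  obtain ⟨k, hk, hlim⟩ := exists_subseq_tendsto_setIntegral hu2 hKtop hK2
  have hφi : ∀ n, Integrable (φ n) (volume.restrict Ω) := fun n =>
    ((hφ n).memLp 1 _).integrable le_rfl
  have hui : ∀ n, Integrable (u n) (volume.restrict Ω) := fun n =>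
    (hu2 n).integrable (by norm_num)
  have hlim' : ∀ s : Set (EuclideanSpace ℝ (Fin N)), MeasurableSet s →
      ∃ a : ℝ, Tendsto (fun n => ∫ x in s, φ (k n) x ∂(volume.restrict Ω)) atTop (𝓝 a) := by
    intro s hs
    obtain ⟨a, ha⟩ := hlim s hs
    -- The test functions approach `u n` in `L^1`, so they inherit the convergence of set integrals.
    have hd : Tendsto (fun n => ∫ x in s, (φ n x - u n x) ∂(volume.restrict Ω)) atTop (𝓝 0) := by
      have := tendsto_setIntegral_of_L1' (μ := volume.restrict Ω) (fun _ => (0 : ℝ))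
        aestronglyMeasurable_const
        (F := fun n x => φ n x - u n x) (Eventually.of_forall fun n => (hφi n).sub (hui n))
        (l := atTop) (by
          refine c1'.congr fun n => ?_
          congr 1; ext x; simp) s
      simpa using this
    refine ⟨a, ?_⟩
    have := (hd.comp hk.tendsto_atTop).add ha
    rw [zero_add] at this
    refine this.congr fun n => ?_
    simp only [Function.comp]
    rw [integral_sub (hφi _).integrableOn (hui _).integrableOn, sub_add_cancel]
  have hgb : ∀ n, eLpNorm (gradient (φ n)) (ENNReal.ofReal p) (volume.restrict Ω) ≤ 1 + K := by
    intro n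
    have e : gradient (φ n) = (fun x => gradient (φ n) x - g n x) + g n := by ext1 x; simp
    rw [e]
    refine (eLpNorm_add_le
      (((hφ n).memLp_gradient _ _).sub (hu n).memLp_grad).aestronglyMeasurable
      (hu n).memLp_grad.aestronglyMeasurable (one_le_ofReal hp)).trans ?_
    exact add_le_add (b2 n) (hKg n)
  obtain ⟨L, hL⟩ : ∃ L : ℝ, ∀ n, ∫ x in Ω, ‖φ n x‖ ≤ L := by
    obtain ⟨C1, hC1⟩ := exists_eLpNorm_one_le (volume.restrict Ω)
    refine ⟨((1 + K) * C1).toReal, fun n => ?_⟩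
    have hn : eLpNorm (φ n) 1 (volume.restrict Ω) ≤ (1 + K) * C1 := by
      have e : φ n = (fun x => φ n x - u n x) + u n := by ext1 x; simp
      rw [e, add_mul]
      refine (eLpNorm_add_le ((hφi n).sub (hui n)).aestronglyMeasurable
        (hui n).aestronglyMeasurable le_rfl).trans ?_
      refine add_le_add ?_ ?_
      · refine (hC1.2 _ ((hφi n).sub (hui n)).aestronglyMeasurable _ (one_le_ofReal hp)).trans ?_
        gcongr
        exact b1 n
      · refine (hC1.2 _ (hui n).aestronglyMeasurable 2 (by norm_num)).trans ?_
        gcongr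
        exact hK2 n
    rw [integral_norm_eq_lintegral_enorm (hφi n).aestronglyMeasurable,
      ← eLpNorm_one_eq_lintegral_enorm]
    exact ENNReal.toReal_mono (ENNReal.mul_ne_top (by simp [hKtop]) hC1.1) hn
  have hcau := IsTestFunction.cauchy_of_tendsto_setIntegral hΩ hp (fun n => hφ (k n))
    (K := 1 + K) (by simp [hKtop]) (fun n => hgb _) (fun n => hL _) hlim'
  obtain ⟨v, hv, hvlim⟩ := exists_tendsto_eLpNorm_of_cauchy (one_le_ofReal hp)
    (fun n => (hφ (k n)).memLp (ENNReal.ofReal p) (volume.restrict Ω)) hcau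
  refine ⟨k, hk, v, hv, ?_⟩
  have c2 : Tendsto (fun n => eLpNorm (fun x => u (k n) x - φ (k n) x) (ENNReal.ofReal p)
      (volume.restrict Ω)) atTop (𝓝 0) :=
    (c1.comp hk.tendsto_atTop).congr fun n => eLpNorm_sub_comm (φ (k n)) (u (k n)) _ _
  have := tendsto_eLpNorm_add (one_le_ofReal hp)
    (fun n => ((hu (k n)).memLp.sub
      ((hφ (k n)).memLp (ENNReal.ofReal p) _)).aestronglyMeasurable)
    (fun n => (((hφ (k n)).memLp (ENNReal.ofReal p) _).sub hv).aestronglyMeasurable) c2 hvlim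
  simpa using this

end Rellich

/-! ### Integrals of powers of the norm -/

section Power

variable {α F : Type*} [MeasurableSpace α] {μ : Measure α} [NormedAddCommGroup F] {q : ℝ}

lemma integrable_norm_rpow (hq : 1 ≤ q) {f : α → F} (hf : MemLp f (ENNReal.ofReal q) μ) :
    Integrable (fun x => ‖f x‖ ^ q) μ := by
  have := hf.integrable_norm_rpow (ofReal_ne_zero' hq) ENNReal.ofReal_ne_top
  rwa [ENNReal.toReal_ofReal (by linarith)] at this

lemma integral_norm_rpow_eq (hq : 1 ≤ q) {f : α → F} (hf : MemLp f (ENNReal.ofReal q) μ) :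
    ∫ x, ‖f x‖ ^ q ∂μ = (eLpNorm f (ENNReal.ofReal q) μ).toReal ^ q := by
  have hq0 : 0 < q := by linarith
  have hnn : 0 ≤ ∫ x, ‖f x‖ ^ q ∂μ := integral_nonneg fun x => by positivity
  rw [hf.eLpNorm_eq_integral_rpow_norm (ofReal_ne_zero' hq) ENNReal.ofReal_ne_top,
    ENNReal.toReal_ofReal hq0.le, ENNReal.toReal_ofReal (by positivity), ← Real.rpow_mul hnn,
    inv_mul_cancel₀ hq0.ne', Real.rpow_one]

lemma eLpNorm_eq_ofReal_integral (hq : 1 ≤ q) {f : α → F} (hf : MemLp f (ENNReal.ofReal q) μ) :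
    eLpNorm f (ENNReal.ofReal q) μ = ENNReal.ofReal ((∫ x, ‖f x‖ ^ q ∂μ) ^ q⁻¹) := by
  rw [hf.eLpNorm_eq_integral_rpow_norm (ofReal_ne_zero' hq) ENNReal.ofReal_ne_top,
    ENNReal.toReal_ofReal (by linarith)]

lemma tendsto_integral_norm_rpow (hq : 1 ≤ q) {ι : Type*} {l : Filter ι} {f : ι → α → F}
    {g : α → F} (hf : ∀ n, MemLp (f n) (ENNReal.ofReal q) μ) (hg : MemLp g (ENNReal.ofReal q) μ)
    (h : Tendsto (fun n => eLpNorm (fun x => f n x - g x) (ENNReal.ofReal q) μ) l (𝓝 0)) :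
    Tendsto (fun n => ∫ x, ‖f n x‖ ^ q ∂μ) l (𝓝 (∫ x, ‖g x‖ ^ q ∂μ)) := by
  have : Fact (1 ≤ ENNReal.ofReal q) := ⟨one_le_ofReal hq⟩
  have b := ((Lp.tendsto_Lp_iff_tendsto_eLpNorm'' _ hf g hg).2 h).norm
  simp only [Lp.norm_toLp] at b
  have b2 := b.rpow_const (p := q) (Or.inr (by linarith))
  rw [integral_norm_rpow_eq hq hg]
  exact b2.congr fun n => (integral_norm_rpow_eq hq (hf n)).symm

lemma tendsto_eLpNorm_of_tendsto_integral (hq : 1 ≤ q) {ι : Type*} {l : Filter ι} {f : ι → α → F}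
    (hf : ∀ n, MemLp (f n) (ENNReal.ofReal q) μ)
    (h : Tendsto (fun n => ∫ x, ‖f n x‖ ^ q ∂μ) l (𝓝 0)) :
    Tendsto (fun n => eLpNorm (f n) (ENNReal.ofReal q) μ) l (𝓝 0) := by
  have h2 := h.rpow_const (p := q⁻¹) (Or.inr (by positivity))
  rw [Real.zero_rpow (by positivity)] at h2
  have h3 := ENNReal.tendsto_ofReal h2
  rw [ENNReal.ofReal_zero] at h3
  exact h3.congr fun n => (eLpNorm_eq_ofReal_integral hq (hf n)).symm

end Power

/-! ### A compactness form of uniform convexity -/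

section UniformConvexity

variable {F : Type*} [NormedAddCommGroup F] [InnerProductSpace ℝ F] {q : ℝ}

lemma norm_half_add_rpow_le (hq : 1 ≤ q) (a b : F) :
    ‖(1 / 2 : ℝ) • (a + b)‖ ^ q ≤ 1 / 2 * ‖a‖ ^ q + 1 / 2 * ‖b‖ ^ q := by
  have h1 : ‖(1 / 2 : ℝ) • (a + b)‖ ≤ 1 / 2 * ‖a‖ + 1 / 2 * ‖b‖ := by
    rw [norm_smul, Real.norm_of_nonneg (by norm_num), ← mul_add]
    exact mul_le_mul_of_nonneg_left (norm_add_le _ _) (by norm_num)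
  refine (Real.rpow_le_rpow (norm_nonneg _) h1 (by linarith)).trans ?_
  have := (convexOn_rpow hq).2 (norm_nonneg a) (norm_nonneg b) (by norm_num : (0 : ℝ) ≤ 1 / 2)
    (by norm_num : (0 : ℝ) ≤ 1 / 2) (by norm_num)
  simpa using this

/-- Equal norms: the norm itself is strictly convex. Different norms: the power `s ↦ s^q` is. -/
lemma norm_half_add_rpow_lt (hq : 1 < q) {a b : F} (hab : a ≠ b) :
    ‖(1 / 2 : ℝ) • (a + b)‖ ^ q < 1 / 2 * ‖a‖ ^ q + 1 / 2 * ‖b‖ ^ q := by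
  have hq0 : 0 < q := by linarith
  rcases eq_or_ne ‖a‖ ‖b‖ with h | h
  · have h1 : ‖(1 / 2 : ℝ) • (a + b)‖ < ‖b‖ := by
      have := norm_combo_lt_of_ne (h.le) (le_refl ‖b‖) hab (by norm_num : (0 : ℝ) < 1 / 2)
        (by norm_num : (0 : ℝ) < 1 / 2) (by norm_num)
      rwa [← smul_add] at this
    have h2 := Real.rpow_lt_rpow (norm_nonneg _) h1 hq0
    rw [h]; linarith
  · have h1 : ‖(1 / 2 : ℝ) • (a + b)‖ ≤ 1 / 2 * ‖a‖ + 1 / 2 * ‖b‖ := by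
      rw [norm_smul, Real.norm_of_nonneg (by norm_num), ← mul_add]
      exact mul_le_mul_of_nonneg_left (norm_add_le _ _) (by norm_num)
    refine (Real.rpow_le_rpow (norm_nonneg _) h1 hq0.le).trans_lt ?_
    have := (strictConvexOn_rpow hq).2 (norm_nonneg a) (norm_nonneg b) h
      (by norm_num : (0 : ℝ) < 1 / 2) (by norm_num : (0 : ℝ) < 1 / 2) (by norm_num)
    simpa using this

/-- The convexity defect is continuous and positive on the compact set of pairs with `‖a‖^q + ‖b‖^q
= 1` and `‖a - b‖^q ≥ δ`, so it has a positive minimum there; all terms being `q`-homogeneous,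
scaling gives the general case. This treats `q < 2` and `q = 2` alike, without Clarkson's
inequalities. -/
lemma exists_norm_sub_rpow_le [FiniteDimensional ℝ F] (hq : 1 < q) {δ : ℝ} (hδ : 0 < δ) :
    ∃ C : ℝ, 0 ≤ C ∧ ∀ a b : F, ‖a - b‖ ^ q ≤ δ * (‖a‖ ^ q + ‖b‖ ^ q) +
      C * (1 / 2 * ‖a‖ ^ q + 1 / 2 * ‖b‖ ^ q - ‖(1 / 2 : ℝ) • (a + b)‖ ^ q) := by
  have hq0 : 0 < q := by linarith
  have : ProperSpace F := FiniteDimensional.proper_real F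
  let D : F × F → ℝ := fun z =>
    1 / 2 * ‖z.1‖ ^ q + 1 / 2 * ‖z.2‖ ^ q - ‖(1 / 2 : ℝ) • (z.1 + z.2)‖ ^ q
  have hrc : Continuous fun s : ℝ => s ^ q := Real.continuous_rpow_const hq0.le
  have hn : Continuous fun a : F => ‖a‖ ^ q := hrc.comp continuous_norm
  have hDc : Continuous D := by
    have h1 := hn.comp (continuous_fst (X := F) (Y := F))
    have h2 := hn.comp (continuous_snd (X := F) (Y := F))
    have h3 := hn.comp (by fun_prop : Continuous fun z : F × F => (1 / 2 : ℝ) • (z.1 + z.2))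
    exact ((continuous_const.mul h1).add (continuous_const.mul h2)).sub h3
  let K : Set (F × F) := {z | ‖z.1‖ ^ q + ‖z.2‖ ^ q = 1} ∩ {z | δ ≤ ‖z.1 - z.2‖ ^ q}
  have hone : ∀ a b : F, ‖a‖ ^ q + ‖b‖ ^ q = 1 → ‖a‖ ≤ 1 := fun a b h => by
    by_contra! h1
    have := Real.one_lt_rpow h1 hq0
    have : 0 ≤ ‖b‖ ^ q := by positivity
    linarith
  have hK : IsCompact K := by
    refine Metric.isCompact_of_isClosed_isBounded (IsClosed.inter ?_ ?_) ?_
    · exact isClosed_eq ((hn.comp continuous_fst).add (hn.comp continuous_snd)) continuous_const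
    · exact isClosed_le continuous_const
        (hn.comp (by fun_prop : Continuous fun z : F × F => z.1 - z.2))
    · refine (Metric.isBounded_closedBall (x := (0 : F × F)) (r := 1)).subset fun z hz => ?_
      rw [mem_closedBall_zero_iff, Prod.norm_def, max_le_iff]
      exact ⟨hone _ _ hz.1, hone _ z.1 (by rw [add_comm]; exact hz.1)⟩
  obtain ⟨c, hc, hcD⟩ : ∃ c : ℝ, 0 < c ∧ ∀ z ∈ K, c ≤ D z := by
    rcases K.eq_empty_or_nonempty with h | h
    · exact ⟨1, one_pos, by simp [h]⟩
    · obtain ⟨z, hz, hmin⟩ := hK.exists_isMinOn h hDc.continuousOn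
      refine ⟨D z, ?_, fun w hw => hmin hw⟩
      have hne : z.1 ≠ z.2 := fun he => by
        have h2 : δ ≤ ‖z.1 - z.2‖ ^ q := hz.2
        rw [he, sub_self, norm_zero, Real.zero_rpow hq0.ne'] at h2
        linarith
      exact sub_pos.2 (norm_half_add_rpow_lt hq hne)
  -- On normalised pairs `‖a - b‖ ≤ 2` and the defect is at least `c`, so `2^q / c` times the defect
  -- dominates `‖a - b‖^q`.
  refine ⟨2 ^ q / c, by positivity, fun a b => ?_⟩
  have hDnn : 0 ≤ D (a, b) := sub_nonneg.2 (norm_half_add_rpow_le hq.le a b)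
  change _ ≤ _ + _ * D (a, b)
  have hT : 0 ≤ ‖a‖ ^ q + ‖b‖ ^ q := by positivity
  rcases le_or_gt (‖a - b‖ ^ q) (δ * (‖a‖ ^ q + ‖b‖ ^ q)) with h | h
  · have : 0 ≤ 2 ^ q / c * D (a, b) := by positivity
    linarith
  have hTpos : 0 < ‖a‖ ^ q + ‖b‖ ^ q := by
    refine lt_of_le_of_ne hT fun h0 => ?_
    have ha : ‖a‖ ^ q = 0 := by
      have : 0 ≤ ‖a‖ ^ q := by positivity
      have : 0 ≤ ‖b‖ ^ q := by positivity
      linarith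
    have hb : ‖b‖ ^ q = 0 := by linarith
    rw [Real.rpow_eq_zero (norm_nonneg _) hq0.ne', norm_eq_zero] at ha hb
    simp [ha, hb, Real.zero_rpow hq0.ne'] at h
  set s : ℝ := (‖a‖ ^ q + ‖b‖ ^ q) ^ q⁻¹ with hs
  have hspos : 0 < s := by positivity
  have hsq : s ^ q = ‖a‖ ^ q + ‖b‖ ^ q := by
    rw [hs, ← Real.rpow_mul hT, inv_mul_cancel₀ hq0.ne', Real.rpow_one]
  have hsc : ∀ x : F, ‖s⁻¹ • x‖ ^ q = ‖x‖ ^ q / s ^ q := fun x => by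
    rw [norm_smul, Real.norm_of_nonneg (by positivity), Real.mul_rpow (by positivity)
      (norm_nonneg _), Real.inv_rpow hspos.le, div_eq_inv_mul]
  have hmem : (s⁻¹ • a, s⁻¹ • b) ∈ K := by
    constructor
    · change ‖s⁻¹ • a‖ ^ q + ‖s⁻¹ • b‖ ^ q = 1
      rw [hsc, hsc, ← add_div, ← hsq, div_self (by positivity)]
    · change δ ≤ ‖s⁻¹ • a - s⁻¹ • b‖ ^ q
      rw [← smul_sub, hsc, le_div_iff₀ (by positivity), hsq]
      exact h.le
  have h1 := hcD _ hmem
  have h2 : D (s⁻¹ • a, s⁻¹ • b) = D (a, b) / s ^ q := by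
    simp only [D]
    rw [← smul_add, smul_comm, hsc, hsc, hsc]
    ring
  rw [h2, le_div_iff₀ (by positivity), hsq] at h1
  have h3 : ‖a - b‖ ^ q ≤ 2 ^ q * (‖a‖ ^ q + ‖b‖ ^ q) := by
    have h4 : ‖s⁻¹ • a - s⁻¹ • b‖ ≤ 2 := by
      refine (norm_sub_le _ _).trans ?_
      have := hone _ _ hmem.1
      have := hone _ (s⁻¹ • a) (by rw [add_comm]; exact hmem.1)
      simp only at *
      linarith
    have h5 := Real.rpow_le_rpow (norm_nonneg _) h4 hq0.le
    rwa [← smul_sub, hsc, div_le_iff₀ (by positivity), hsq] at h5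
  have h6 : 2 ^ q * (‖a‖ ^ q + ‖b‖ ^ q) ≤ 2 ^ q / c * D (a, b) := by
    rw [div_mul_eq_mul_div, le_div_iff₀ hc, mul_assoc, mul_comm _ c]
    exact mul_le_mul_of_nonneg_left h1 (by positivity)
  have : 0 ≤ δ * (‖a‖ ^ q + ‖b‖ ^ q) := by positivity
  linarith

variable {α : Type*} [MeasurableSpace α] {μ : Measure α}

lemma tendsto_eLpNorm_sub_of_midpoint [FiniteDimensional ℝ F] (hq : 1 < q) {f : ℕ → α → F}
    (hf : ∀ n, MemLp (f n) (ENNReal.ofReal q) μ) {K : ℝ} (hK : ∀ n, ∫ x, ‖f n x‖ ^ q ∂μ ≤ K)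
    (h : Tendsto (fun nm : ℕ × ℕ => 1 / 2 * ∫ x, ‖f nm.1 x‖ ^ q ∂μ + 1 / 2 * ∫ x, ‖f nm.2 x‖ ^ q ∂μ
      - ∫ x, ‖(1 / 2 : ℝ) • (f nm.1 x + f nm.2 x)‖ ^ q ∂μ) atTop (𝓝 0)) :
    Tendsto (fun nm : ℕ × ℕ => eLpNorm (fun x => f nm.1 x - f nm.2 x) (ENNReal.ofReal q) μ)
      atTop (𝓝 0) := by
  refine tendsto_eLpNorm_of_tendsto_integral hq.le (fun nm => (hf nm.1).sub (hf nm.2)) ?_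
  rw [Metric.tendsto_nhds]
  intro ε hε
  have hK0 : 0 ≤ K := (integral_nonneg fun x => by positivity).trans (hK 0)
  -- With this `δ` the first term integrates to at most `ε/2`, as each integral is bounded by `K`;
  -- the `+ 1` only avoids dividing by zero. The defect term tends to zero for the resulting fixed
  -- `C`.
  obtain ⟨C, hC0, hC⟩ := exists_norm_sub_rpow_le (F := F) hq
    (δ := ε / (4 * (K + 1))) (by positivity)
  have h2 := h.const_mul C
  rw [mul_zero] at h2
  filter_upwards [h2.eventually (gt_mem_nhds (half_pos hε))] with nm hnm
  rw [Real.dist_eq, sub_zero, abs_of_nonneg (integral_nonneg fun x => by positivity)]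
  have i1 := integrable_norm_rpow hq.le (hf nm.1)
  have i2 := integrable_norm_rpow hq.le (hf nm.2)
  have i3 := integrable_norm_rpow hq.le (((hf nm.1).add (hf nm.2)).const_smul (1 / 2 : ℝ))
  have i4 := integrable_norm_rpow hq.le ((hf nm.1).sub (hf nm.2))
  simp only [Pi.smul_apply, Pi.add_apply, Pi.sub_apply] at i3 i4
  have hle := integral_mono i4 (((i1.add i2).const_mul (ε / (4 * (K + 1)))).add
    ((((i1.const_mul (1 / 2)).add (i2.const_mul (1 / 2))).sub i3).const_mul C))
    (fun x => hC (f nm.1 x) (f nm.2 x))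
  have hint : ∫ x, ((fun x => ε / (4 * (K + 1)) * (((fun x => ‖f nm.1 x‖ ^ q) +
      fun x => ‖f nm.2 x‖ ^ q) x)) + fun x => C * ((((fun x => 1 / 2 * ‖f nm.1 x‖ ^ q) +
      fun x => 1 / 2 * ‖f nm.2 x‖ ^ q) -
      fun x => ‖(1 / 2 : ℝ) • (f nm.1 x + f nm.2 x)‖ ^ q) x)) x ∂μ =
      ε / (4 * (K + 1)) * (∫ x, ‖f nm.1 x‖ ^ q ∂μ + ∫ x, ‖f nm.2 x‖ ^ q ∂μ) +
      C * (1 / 2 * ∫ x, ‖f nm.1 x‖ ^ q ∂μ + 1 / 2 * ∫ x, ‖f nm.2 x‖ ^ q ∂μ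
      - ∫ x, ‖(1 / 2 : ℝ) • (f nm.1 x + f nm.2 x)‖ ^ q ∂μ) := by
    rw [integral_add' ((i1.add i2).const_mul _)
      ((((i1.const_mul (1 / 2)).add (i2.const_mul (1 / 2))).sub i3).const_mul C),
      integral_const_mul, integral_const_mul, integral_add' i1 i2,
      integral_sub' ((i1.const_mul (1 / 2)).add (i2.const_mul (1 / 2))) i3,
      integral_add' (i1.const_mul (1 / 2)) (i2.const_mul (1 / 2)), integral_const_mul,
      integral_const_mul]
  refine lt_of_le_of_lt (hle.trans hint.le) ?_
  have h5 : ε / (4 * (K + 1)) * (∫ x, ‖f nm.1 x‖ ^ q ∂μ + ∫ x, ‖f nm.2 x‖ ^ q ∂μ) ≤ ε / 2 := by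
    calc _ ≤ ε / (4 * (K + 1)) * ((K + 1) + (K + 1)) := by
          gcongr <;> linarith [hK nm.1, hK nm.2]
      _ = ε / 2 := by field_simp; ring
  linarith

end UniformConvexity

/-! ### First variation of an integral of a power of the norm -/

section Variation

variable {F : Type*} [NormedAddCommGroup F] [InnerProductSpace ℝ F] {q : ℝ}
  {α : Type*} [MeasurableSpace α] {μ : Measure α}

lemma norm_rpow_mul_inner_le (hq : 1 < q) (a b : F) :
    ‖q * ‖a‖ ^ (q - 2) * inner ℝ a b‖ ≤ q * (‖a‖ ^ (q - 1) * ‖b‖) := by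
  have h1 : ‖a‖ ^ (q - 2) * ‖a‖ = ‖a‖ ^ (q - 1) := by
    rw [← Real.rpow_add_one' (norm_nonneg _) (by linarith)]
    ring_nf
  rw [norm_mul, norm_mul, Real.norm_of_nonneg (by linarith : (0 : ℝ) ≤ q),
    Real.norm_of_nonneg (by positivity), ← h1, mul_assoc, mul_assoc]
  gcongr
  exact norm_inner_le_norm a b

/-- Differentiation under the integral for `|t| < 1`, where the derivative is dominated by `q (‖f‖ +
‖h‖)^q`. The exponent `q > 1` makes `‖·‖^q` differentiable at the origin as well. -/
lemma hasDerivAt_integral_norm_rpow (hq : 1 < q) {f h : α → F}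
    (hf : MemLp f (ENNReal.ofReal q) μ) (hh : MemLp h (ENNReal.ofReal q) μ) :
    HasDerivAt (fun t : ℝ => ∫ x, ‖f x + t • h x‖ ^ q ∂μ)
      (∫ x, q * ‖f x‖ ^ (q - 2) * inner ℝ (f x) (h x) ∂μ) 0 := by
  have hq0 : 0 < q := by linarith
  have hft : ∀ t : ℝ, MemLp (fun x => f x + t • h x) (ENNReal.ofReal q) μ := fun t =>
    hf.add (hh.const_smul t)
  have key := hasDerivAt_integral_of_dominated_loc_of_deriv_le (μ := μ) (x₀ := (0 : ℝ))
    (s := Metric.ball 0 1) (F := fun t x => ‖f x + t • h x‖ ^ q)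
    (F' := fun t x => q * ‖f x + t • h x‖ ^ (q - 2) * inner ℝ (f x + t • h x) (h x))
    (bound := fun x => q * ‖‖f x‖ + ‖h x‖‖ ^ q)
    (Metric.ball_mem_nhds _ one_pos)
    (Eventually.of_forall fun t => (integrable_norm_rpow hq.le (hft t)).aestronglyMeasurable)
    (integrable_norm_rpow hq.le (hft 0)) ?_ (Eventually.of_forall fun x t ht => ?_)
    ((integrable_norm_rpow hq.le (hf.norm.add hh.norm)).const_mul q)
    (Eventually.of_forall fun x t _ => ?_)
  · simpa using key.2
  · have h0 := (hft 0).aestronglyMeasurable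
    exact ((h0.norm.aemeasurable.pow_const _).aestronglyMeasurable.const_mul q).mul
      (h0.inner hh.aestronglyMeasurable)
  · refine (norm_rpow_mul_inner_le hq _ _).trans ?_
    have ht' : |t| ≤ 1 := by simpa using (mem_ball_zero_iff.1 ht).le
    have h1 : ‖f x + t • h x‖ ≤ ‖f x‖ + ‖h x‖ := by
      refine (norm_add_le _ _).trans ?_
      rw [norm_smul]
      gcongr
      exact mul_le_of_le_one_left (norm_nonneg _) ht'
    have h2 : (‖f x‖ + ‖h x‖) ^ q = (‖f x‖ + ‖h x‖) ^ (q - 1) * (‖f x‖ + ‖h x‖) := by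
      rw [← Real.rpow_add_one' (by positivity) (by linarith)]
      ring_nf
    rw [Real.norm_of_nonneg (by positivity), h2]
    gcongr
    linarith [norm_nonneg (f x)]
  · have h1 : HasDerivAt (fun t : ℝ => f x + t • h x) (h x) t := by
      simpa using ((hasDerivAt_id t).smul_const (h x)).const_add (f x)
    have := (hasFDerivAt_norm_rpow (f x + t • h x) hq).comp_hasDerivAt t h1
    simp only [_root_.smul_apply, innerSL_apply_apply, smul_eq_mul] at this
    exact this

/-- Each factor is at most the matching power of `‖f‖ + ‖h‖`, so the product is dominated by `(‖f‖ +
‖h‖)^q`, without conjugate exponents. -/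
lemma integrable_norm_rpow_mul {E E' : Type*} [NormedAddCommGroup E] [NormedAddCommGroup E']
    (hq : 1 < q) {f : α → E} {h : α → E'} (hf : MemLp f (ENNReal.ofReal q) μ) (hh : MemLp h (ENNReal.ofReal q) μ) :
    Integrable (fun x => ‖f x‖ ^ (q - 1) * ‖h x‖) μ := by
  refine (integrable_norm_rpow hq.le (hf.norm.add hh.norm)).mono'
    ((hf.aestronglyMeasurable.norm.aemeasurable.pow_const _).aestronglyMeasurable.mul
      hh.aestronglyMeasurable.norm) (Eventually.of_forall fun x => ?_)
  have h1 : (‖f x‖ + ‖h x‖) ^ q = (‖f x‖ + ‖h x‖) ^ (q - 1) * (‖f x‖ + ‖h x‖) := by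
    rw [← Real.rpow_add_one' (by positivity) (by linarith)]
    ring_nf
  have h2 : ‖((fun x => ‖f x‖) + fun x => ‖h x‖ : α → ℝ) x‖ = ‖f x‖ + ‖h x‖ :=
    Real.norm_of_nonneg (add_nonneg (norm_nonneg (f x)) (norm_nonneg (h x)))
  have h3 : ‖f x‖ ≤ ‖f x‖ + ‖h x‖ := by linarith [norm_nonneg (h x)]
  have h4 : ‖h x‖ ≤ ‖f x‖ + ‖h x‖ := by linarith [norm_nonneg (f x)]
  rw [Real.norm_of_nonneg (by positivity), h2, h1]
  exact mul_le_mul (Real.rpow_le_rpow (norm_nonneg _) h3 (by linarith)) h4 (norm_nonneg _)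
    (by positivity)

lemma norm_spow (hq : 1 < q) (s : ℝ) : ‖spow q s‖ = ‖s‖ ^ (q - 1) := by
  rw [spow, norm_mul, Real.norm_of_nonneg (by positivity), ← Real.norm_eq_abs,
    ← Real.rpow_add_one' (norm_nonneg _) (by linarith)]
  ring_nf

lemma norm_flux {N : ℕ} (hq : 1 < q) (ξ : EuclideanSpace ℝ (Fin N)) :
    ‖flux q ξ‖ = ‖ξ‖ ^ (q - 1) := by
  rw [flux, norm_smul, Real.norm_of_nonneg (by positivity),
    ← Real.rpow_add_one' (norm_nonneg _) (by linarith)]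
  ring_nf

lemma integrable_spow_mul (hq : 1 < q) {f h : α → ℝ} (hf : MemLp f (ENNReal.ofReal q) μ)
    (hh : MemLp h (ENNReal.ofReal q) μ) : Integrable (fun x => spow q (f x) * h x) μ := by
  have hm := hf.aestronglyMeasurable
  refine (integrable_norm_rpow_mul hq hf hh).mono'
    (((hm.norm.aemeasurable.pow_const _).aestronglyMeasurable.mul hm).mul
      hh.aestronglyMeasurable) (Eventually.of_forall fun x => ?_)
  rw [norm_mul, norm_spow hq]

lemma integrable_inner_flux {N : ℕ} (hq : 1 < q) {f h : α → EuclideanSpace ℝ (Fin N)}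
    (hf : MemLp f (ENNReal.ofReal q) μ) (hh : MemLp h (ENNReal.ofReal q) μ) :
    Integrable (fun x => inner ℝ (flux q (f x)) (h x)) μ := by
  have hm := hf.aestronglyMeasurable
  refine (integrable_norm_rpow_mul hq hf hh).mono'
    (((hm.norm.aemeasurable.pow_const _).aestronglyMeasurable.smul hm).inner
      hh.aestronglyMeasurable) (Eventually.of_forall fun x => ?_)
  rw [← norm_flux hq]
  exact norm_inner_le_norm _ _

end Variation

/-! ### The energy of the logistic problem -/

/-- The energy `(1/p) ∫ |g|^p - (λ/p) ∫ |u|^p + (1/2) ∫ u²`. -/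
def energy (Ω : Set (EuclideanSpace ℝ (Fin N))) (p lam : ℝ) (u : EuclideanSpace ℝ (Fin N) → ℝ)
    (g : EuclideanSpace ℝ (Fin N) → EuclideanSpace ℝ (Fin N)) : ℝ :=
  1 / p * (∫ x in Ω, ‖g x‖ ^ p) - lam / p * (∫ x in Ω, ‖u x‖ ^ p)
    + 1 / 2 * ∫ x in Ω, ‖u x‖ ^ (2 : ℝ)

/-- The energy space `W_0^{1,p} ∩ L²`, as a set of pairs (function, weak gradient). -/
def MemEnergySpace (Ω : Set (EuclideanSpace ℝ (Fin N))) (p : ℝ)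
    (u : EuclideanSpace ℝ (Fin N) → ℝ)
    (g : EuclideanSpace ℝ (Fin N) → EuclideanSpace ℝ (Fin N)) : Prop :=
  MemW01p Ω p u g ∧ MemLp u (ENNReal.ofReal 2) (volume.restrict Ω)

section Energy

variable {Ω : Set (EuclideanSpace ℝ (Fin N))} {p lam : ℝ}
  {u v : EuclideanSpace ℝ (Fin N) → ℝ}
  {g h : EuclideanSpace ℝ (Fin N) → EuclideanSpace ℝ (Fin N)}

lemma MemEnergySpace.add [IsFiniteMeasure (volume.restrict Ω)] (hp : 1 ≤ p)
    (hu : MemEnergySpace Ω p u g) (hv : MemEnergySpace Ω p v h) :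
    MemEnergySpace Ω p (fun x => u x + v x) (fun x => g x + h x) :=
  ⟨hu.1.add hp hv.1, hu.2.add hv.2⟩

lemma MemEnergySpace.const_mul [IsFiniteMeasure (volume.restrict Ω)] (hp : 1 ≤ p)
    (hu : MemEnergySpace Ω p u g) (c : ℝ) :
    MemEnergySpace Ω p (fun x => c * u x) (fun x => c • g x) :=
  ⟨hu.1.const_mul hp c, hu.2.const_mul c⟩

lemma memEnergySpace_zero [IsFiniteMeasure (volume.restrict Ω)] (hp : 1 ≤ p) :
    MemEnergySpace Ω p 0 0 := ⟨memW01p_zero hp, MemLp.zero⟩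

/-- Here `p < 2` enters: the quadratic term beats the `p`-th power for every `λ ≥ 0`, and the energy
is coercive although `λ > λ₁`. The threshold `S` solves `S^{2-p} = 4λ/p`; beyond it the quarter of
`s²` wins outright. -/
lemma exists_mul_rpow_le (hp1 : 1 < p) (hp2 : p < 2) (hlam : 0 ≤ lam) :
    ∃ C : ℝ, 0 ≤ C ∧ ∀ s : ℝ, 0 ≤ s → lam / p * s ^ p ≤ 1 / 4 * s ^ (2 : ℝ) + C := by
  have hp0 : 0 < p := by linarith
  set S : ℝ := (4 * lam / p) ^ (1 / (2 - p)) with hS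
  have hS0 : 0 ≤ S := by positivity
  have hSp : S ^ (2 - p) = 4 * lam / p := by
    rw [hS, ← Real.rpow_mul (by positivity), one_div_mul_cancel (by linarith), Real.rpow_one]
  refine ⟨lam / p * S ^ p, by positivity, fun s hs => ?_⟩
  rcases le_total s S with h | h
  · have : lam / p * s ^ p ≤ lam / p * S ^ p := by gcongr
    have : 0 ≤ s ^ (2 : ℝ) := by positivity
    linarith
  · have h1 : S ^ (2 - p) ≤ s ^ (2 - p) := Real.rpow_le_rpow hS0 h (by linarith)
    have h2 : s ^ (2 : ℝ) = s ^ (2 - p) * s ^ p := by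
      rw [← Real.rpow_add_of_nonneg hs (by linarith) hp0.le]; ring_nf
    have h3 : 4 * lam / p * s ^ p ≤ s ^ (2 - p) * s ^ p := by
      rw [← hSp]; gcongr
    have : 0 ≤ lam / p * S ^ p := by positivity
    have e : 4 * lam / p * s ^ p = 4 * (lam / p * s ^ p) := by ring
    rw [h2]; linarith

lemma exists_energy_lower_bound [IsFiniteMeasure (volume.restrict Ω)] (hp1 : 1 < p) (hp2 : p < 2)
    (hlam : 0 ≤ lam) :
    ∃ C : ℝ, ∀ u g, MemEnergySpace Ω p u g →
      1 / p * (∫ x in Ω, ‖g x‖ ^ p) + 1 / 4 * (∫ x in Ω, ‖u x‖ ^ (2 : ℝ)) - C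
        ≤ energy Ω p lam u g := by
  obtain ⟨C, hC0, hC⟩ := exists_mul_rpow_le hp1 hp2 hlam
  refine ⟨∫ _ in Ω, C, fun u g hu => ?_⟩
  have i1 := integrable_norm_rpow hp1.le hu.1.memLp
  have i2 := integrable_norm_rpow (by norm_num) hu.2
  have h1 := integral_mono (i1.const_mul (lam / p)) ((i2.const_mul (1 / 4)).add
    (integrable_const C)) (fun x => hC ‖u x‖ (norm_nonneg _))
  have h2 : ∫ x in Ω, ((fun x => 1 / 4 * ‖u x‖ ^ (2 : ℝ)) + fun _ => C :
      EuclideanSpace ℝ (Fin N) → ℝ) x =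
      1 / 4 * (∫ x in Ω, ‖u x‖ ^ (2 : ℝ)) + ∫ _ in Ω, C := by
    rw [integral_add' (i2.const_mul (1 / 4)) (integrable_const C), integral_const_mul]
  rw [integral_const_mul, h2] at h1
  unfold energy
  linarith

lemma tendsto_energy (hp1 : 1 < p) {U : ℕ → EuclideanSpace ℝ (Fin N) → ℝ}
    {G : ℕ → EuclideanSpace ℝ (Fin N) → EuclideanSpace ℝ (Fin N)}
    (hU : ∀ n, MemEnergySpace Ω p (U n) (G n)) (hu : MemEnergySpace Ω p u g)
    (h1 : Tendsto (fun n => eLpNorm (fun x => U n x - u x) (ENNReal.ofReal p)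
      (volume.restrict Ω)) atTop (𝓝 0))
    (h2 : Tendsto (fun n => eLpNorm (fun x => G n x - g x) (ENNReal.ofReal p)
      (volume.restrict Ω)) atTop (𝓝 0))
    (h3 : Tendsto (fun n => eLpNorm (fun x => U n x - u x) (ENNReal.ofReal 2)
      (volume.restrict Ω)) atTop (𝓝 0)) :
    Tendsto (fun n => energy Ω p lam (U n) (G n)) atTop (𝓝 (energy Ω p lam u g)) := by
  have a1 := tendsto_integral_norm_rpow hp1.le (fun n => (hU n).1.memLp) hu.1.memLp h1
  have a2 := tendsto_integral_norm_rpow hp1.le (fun n => (hU n).1.memLp_grad) hu.1.memLp_grad h2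
  have a3 := tendsto_integral_norm_rpow (by norm_num) (fun n => (hU n).2) hu.2 h3
  exact ((a2.const_mul _).sub (a1.const_mul _)).add (a3.const_mul _)

/-- A minimizing sequence is bounded, so a subsequence converges in `L^p`. Comparing the energy at
midpoints with the infimum turns this into strong convergence of the gradients in `L^p` and of the
functions in `L²`; no weak lower semicontinuity is involved. -/
lemma exists_energy_minimizer [IsFiniteMeasure (volume.restrict Ω)] (hΩ : MeasurableSet Ω)
    (hp1 : 1 < p) (hp2 : p < 2) (hlam : 0 ≤ lam) :
    ∃ u g, MemEnergySpace Ω p u g ∧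
      ∀ v h, MemEnergySpace Ω p v h → energy Ω p lam u g ≤ energy Ω p lam v h := by
  have hp0 : 0 < p := by linarith
  obtain ⟨C, hC⟩ := exists_energy_lower_bound (Ω := Ω) hp1 hp2 hlam
  let S : Set ℝ := {a | ∃ u g, MemEnergySpace Ω p u g ∧ a = energy Ω p lam u g}
  have hIg : ∀ g : EuclideanSpace ℝ (Fin N) → EuclideanSpace ℝ (Fin N),
      0 ≤ ∫ x in Ω, ‖g x‖ ^ p := fun g => integral_nonneg fun x => by positivity
  have hI2 : ∀ u : EuclideanSpace ℝ (Fin N) → ℝ,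
      0 ≤ ∫ x in Ω, ‖u x‖ ^ (2 : ℝ) := fun u => integral_nonneg fun x => by positivity
  have hip : 0 < 1 / p := by positivity
  have hSb : BddBelow S := by
    refine ⟨-C, ?_⟩
    rintro a ⟨u, g, hu, rfl⟩
    have := hC u g hu
    have := mul_nonneg hip.le (hIg g)
    have := hI2 u
    linarith
  have hSne : S.Nonempty := ⟨_, 0, 0, memEnergySpace_zero hp1.le, rfl⟩
  set m := sInf S with hm
  have hmle : ∀ v h, MemEnergySpace Ω p v h → m ≤ energy Ω p lam v h := fun v h hv =>
    csInf_le hSb ⟨v, h, hv, rfl⟩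
  obtain ⟨a, ha_anti, ha_lim, haS⟩ := exists_seq_tendsto_sInf hSne hSb
  choose U₀ G₀ hU₀ haU using haS
  have hEb : ∀ n, energy Ω p lam (U₀ n) (G₀ n) ≤ a 0 := fun n => by
    rw [← haU]; exact ha_anti (Nat.zero_le n)
  have hGb : ∀ n, ∫ x in Ω, ‖G₀ n x‖ ^ p ≤ p * (a 0 + C) := fun n => by
    have h1 := hC _ _ (hU₀ n)
    have h2 := hEb n
    have h3 := hI2 (U₀ n)
    have h4 : 1 / p * (∫ x in Ω, ‖G₀ n x‖ ^ p) ≤ a 0 + C := by linarith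
    rwa [one_div, inv_mul_le_iff₀ hp0] at h4
  have hUb : ∀ n, ∫ x in Ω, ‖U₀ n x‖ ^ (2 : ℝ) ≤ 4 * (a 0 + C) := fun n => by
    have h1 := hC _ _ (hU₀ n)
    have h2 := hEb n
    have h3 := mul_nonneg hip.le (hIg (G₀ n))
    linarith
  obtain ⟨k, hk, v, hv, hvlim⟩ := exists_subseq_tendsto_of_memW01p hΩ hp1.le
    (fun n => (hU₀ n).1) (fun n => by simpa using (hU₀ n).2)
    (K := max (ENNReal.ofReal ((4 * (a 0 + C)) ^ (2 : ℝ)⁻¹))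
      (ENNReal.ofReal ((p * (a 0 + C)) ^ p⁻¹))) (by simp)
    (fun n => by
      refine le_max_of_le_left ?_
      have := eLpNorm_eq_ofReal_integral (by norm_num) (hU₀ n).2
      rw [ENNReal.ofReal_ofNat] at this
      rw [this]
      exact ENNReal.ofReal_le_ofReal (Real.rpow_le_rpow (hI2 _) (hUb n) (by norm_num)))
    (fun n => by
      refine le_max_of_le_right ?_
      rw [eLpNorm_eq_ofReal_integral hp1.le (hU₀ n).1.memLp_grad]
      exact ENNReal.ofReal_le_ofReal (Real.rpow_le_rpow (hIg _) (hGb n) (by positivity)))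
  set U := fun n => U₀ (k n) with hUdef
  set G := fun n => G₀ (k n) with hGdef
  have hU : ∀ n, MemEnergySpace Ω p (U n) (G n) := fun n => hU₀ (k n)
  have hE : Tendsto (fun n => energy Ω p lam (U n) (G n)) atTop (𝓝 m) := by
    have := ha_lim.comp hk.tendsto_atTop
    exact this.congr fun n => haU (k n)
  have hb : Tendsto (fun n => ∫ x in Ω, ‖U n x‖ ^ p) atTop (𝓝 (∫ x in Ω, ‖v x‖ ^ p)) :=
    tendsto_integral_norm_rpow hp1.le (fun n => (hU n).1.memLp) hv hvlim
  let M : ℕ × ℕ → EuclideanSpace ℝ (Fin N) → ℝ := fun nm x => 1 / 2 * (U nm.1 x + U nm.2 x)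
  let H : ℕ × ℕ → EuclideanSpace ℝ (Fin N) → EuclideanSpace ℝ (Fin N) :=
    fun nm x => (1 / 2 : ℝ) • (G nm.1 x + G nm.2 x)
  have hM : ∀ nm, MemEnergySpace Ω p (M nm) (H nm) := fun nm =>
    ((hU nm.1).add hp1.le (hU nm.2)).const_mul hp1.le (1 / 2)
  have hMb : Tendsto (fun nm => ∫ x in Ω, ‖M nm x‖ ^ p) atTop (𝓝 (∫ x in Ω, ‖v x‖ ^ p)) := by
    refine tendsto_integral_norm_rpow hp1.le (fun nm => (hM nm).1.memLp) hv ?_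
    rw [← prod_atTop_atTop_eq]
    have h1 := tendsto_eLpNorm_add (one_le_ofReal hp1.le)
      (fun nm : ℕ × ℕ => ((hU nm.1).1.memLp.sub hv).aestronglyMeasurable)
      (fun nm : ℕ × ℕ => ((hU nm.2).1.memLp.sub hv).aestronglyMeasurable)
      (hvlim.comp (tendsto_fst (g := atTop))) (hvlim.comp (tendsto_snd (f := atTop)))
    refine tendsto_eLpNorm_of_le_mul (1 / 2) (fun nm => Eventually.of_forall fun x => ?_) h1
    simp only [M, Pi.sub_apply]
    rw [show 1 / 2 * (U nm.1 x + U nm.2 x) - v x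
      = 1 / 2 * (U nm.1 x - v x + (U nm.2 x - v x)) by ring, norm_mul]
    norm_num
  have hp_fst : Tendsto (Prod.fst : ℕ × ℕ → ℕ) atTop atTop := by
    rw [← prod_atTop_atTop_eq]; exact tendsto_fst
  have hp_snd : Tendsto (Prod.snd : ℕ × ℕ → ℕ) atTop atTop := by
    rw [← prod_atTop_atTop_eq]; exact tendsto_snd
  let DG : ℕ × ℕ → ℝ := fun nm => 1 / 2 * (∫ x in Ω, ‖G nm.1 x‖ ^ p) +
    1 / 2 * (∫ x in Ω, ‖G nm.2 x‖ ^ p) - ∫ x in Ω, ‖H nm x‖ ^ p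
  let DU : ℕ × ℕ → ℝ := fun nm => 1 / 2 * (∫ x in Ω, ‖U nm.1 x‖ ^ (2 : ℝ)) +
    1 / 2 * (∫ x in Ω, ‖U nm.2 x‖ ^ (2 : ℝ)) - ∫ x in Ω, ‖M nm x‖ ^ (2 : ℝ)
  have hnn : ∀ {F : Type} [NormedAddCommGroup F] [InnerProductSpace ℝ F] (q : ℝ) (_ : 1 ≤ q)
      (a b : EuclideanSpace ℝ (Fin N) → F) (_ : MemLp a (ENNReal.ofReal q) (volume.restrict Ω))
      (_ : MemLp b (ENNReal.ofReal q) (volume.restrict Ω)),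
      0 ≤ 1 / 2 * (∫ x in Ω, ‖a x‖ ^ q) + 1 / 2 * (∫ x in Ω, ‖b x‖ ^ q) -
        ∫ x in Ω, ‖(1 / 2 : ℝ) • (a x + b x)‖ ^ q := by
    intro F _ _ q hq a b ha hb
    have i1 := integrable_norm_rpow hq ha
    have i2 := integrable_norm_rpow hq hb
    have i3 := integrable_norm_rpow hq ((ha.add hb).const_smul (1 / 2 : ℝ))
    rw [sub_nonneg, ← integral_const_mul, ← integral_const_mul,
      ← integral_add (i1.const_mul _) (i2.const_mul _)]
    exact integral_mono i3 ((i1.const_mul _).add (i2.const_mul _))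
      (fun x => norm_half_add_rpow_le hq (a x) (b x))
  have hDG : ∀ nm, 0 ≤ DG nm := fun nm =>
    hnn p hp1.le _ _ (hU nm.1).1.memLp_grad (hU nm.2).1.memLp_grad
  have hDU : ∀ nm, 0 ≤ DU nm := fun nm =>
    hnn 2 (by norm_num) _ _ (hU nm.1).2 (hU nm.2).2
  -- Rearrangement of `m ≤ energy` at the midpoint. The right side is an energy gap plus the
  -- midpoint defect of the `λ` term; the former vanishes by minimality and the latter by `L^p`
  -- convergence. Both defects on the left are nonnegative, so each tends to zero.
  have hsum : ∀ nm, 1 / p * DG nm + 1 / 2 * DU nm ≤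
      1 / 2 * (energy Ω p lam (U nm.1) (G nm.1) + energy Ω p lam (U nm.2) (G nm.2)) - m
      + lam / p * (1 / 2 * (∫ x in Ω, ‖U nm.1 x‖ ^ p) + 1 / 2 * (∫ x in Ω, ‖U nm.2 x‖ ^ p)
      - ∫ x in Ω, ‖M nm x‖ ^ p) := fun nm => by
    have h1 := hmle _ _ (hM nm)
    simp only [energy, DG, DU] at h1 ⊢
    linarith
  have hrhs : Tendsto (fun nm : ℕ × ℕ =>
      1 / 2 * (energy Ω p lam (U nm.1) (G nm.1) + energy Ω p lam (U nm.2) (G nm.2)) - m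
      + lam / p * (1 / 2 * (∫ x in Ω, ‖U nm.1 x‖ ^ p) + 1 / 2 * (∫ x in Ω, ‖U nm.2 x‖ ^ p)
      - ∫ x in Ω, ‖M nm x‖ ^ p)) atTop (𝓝 0) := by
    have h1 := (((hE.comp hp_fst).add (hE.comp hp_snd)).const_mul (1 / 2)).sub_const m
    have h2 := ((((hb.comp hp_fst).const_mul (1 / 2)).add
      ((hb.comp hp_snd).const_mul (1 / 2))).sub hMb).const_mul (lam / p)
    have h3 := h1.add h2
    rw [show 1 / 2 * (m + m) - m + lam / p * (1 / 2 * (∫ x in Ω, ‖v x‖ ^ p) +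
      1 / 2 * (∫ x in Ω, ‖v x‖ ^ p) - ∫ x in Ω, ‖v x‖ ^ p) = 0 by ring] at h3
    exact h3
  have hDGlim : Tendsto DG atTop (𝓝 0) := by
    have h1 := hrhs.const_mul p
    rw [mul_zero] at h1
    refine tendsto_of_tendsto_of_tendsto_of_le_of_le tendsto_const_nhds h1 hDG fun nm => ?_
    have h2 := hsum nm
    have h3 := hDU nm
    have h4 : 1 / p * DG nm ≤ _ := (by linarith : 1 / p * DG nm ≤ 1 / p * DG nm + 1 / 2 * DU nm).trans h2
    rw [one_div, inv_mul_le_iff₀ hp0] at h4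
    exact h4
  have hDUlim : Tendsto DU atTop (𝓝 0) := by
    have h1 := hrhs.const_mul 2
    rw [mul_zero] at h1
    refine tendsto_of_tendsto_of_tendsto_of_le_of_le tendsto_const_nhds h1 hDU fun nm => ?_
    have h2 := hsum nm
    have h3 := mul_nonneg hip.le (hDG nm)
    linarith
  have hUc := tendsto_eLpNorm_sub_of_midpoint (by norm_num : (1 : ℝ) < 2) (fun n => (hU n).2)
    (fun n => hUb (k n)) hDUlim
  have hGc := tendsto_eLpNorm_sub_of_midpoint hp1 (fun n => (hU n).1.memLp_grad)
    (fun n => hGb (k n)) hDGlim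
  obtain ⟨u, hu, hulim⟩ := exists_tendsto_eLpNorm_of_cauchy (by simp) (fun n => (hU n).2) hUc
  obtain ⟨g, hg, hglim⟩ := exists_tendsto_eLpNorm_of_cauchy (one_le_ofReal hp1.le)
    (fun n => (hU n).1.memLp_grad) hGc
  have hup : MemLp u (ENNReal.ofReal p) (volume.restrict Ω) :=
    hu.mono_exponent (ENNReal.ofReal_le_ofReal hp2.le)
  have hulimp := tendsto_eLpNorm_of_exponent_le (ofReal_ne_zero' hp1.le)
    (ENNReal.ofReal_le_ofReal hp2.le)
    (fun n => ((hU n).2.sub hu).aestronglyMeasurable) hulim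
  have hmem : MemEnergySpace Ω p u g :=
    ⟨MemW01p.of_tendsto hp1.le hup hg (fun n => (hU n).1) hulimp hglim, hu⟩
  refine ⟨u, g, hmem, fun w h hw => ?_⟩
  have hlim := tendsto_energy (lam := lam) hp1 hU hmem hulimp hglim hulim
  rw [tendsto_nhds_unique hlim hE]
  exact hmle w h hw

/-- Above the first eigenvalue, the energy takes a negative value. -/
lemma exists_energy_neg [IsFiniteMeasure (volume.restrict Ω)] (hΩ : IsOpen Ω) (hne : Ω.Nonempty)
    (hp1 : 1 < p) (hp2 : p < 2) (hlam : firstEigenvalue Ω p < lam) :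
    ∃ u g, MemEnergySpace Ω p u g ∧ energy Ω p lam u g < 0 := by
  have hp0 : 0 < p := by linarith
  -- Nonemptiness is essential: the infimum of the empty set is `0` by convention, and `λ₁ < λ`
  -- would then yield no competitor. A normalised bump function provides an element.
  have hset : {a : ℝ | ∃ u g, MemW01p Ω p u g ∧ ∫ x in Ω, |u x| ^ p = 1 ∧
      a = ∫ x in Ω, ‖g x‖ ^ p}.Nonempty := by
    obtain ⟨x₀, hx₀⟩ := hne
    obtain ⟨φ, hφs, hφc, hφd, -, hφ1⟩ := exists_contDiff_tsupport_subset (n := ⊤) (hΩ.mem_nhds hx₀)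
    have hφ : IsTestFunction Ω φ := ⟨hφd, hφc, hφs⟩
    have hpos : 0 < ∫ x in Ω, |φ x| ^ p := by
      have hc : Continuous fun x => |φ x| ^ p :=
        (Real.continuous_rpow_const hp0.le).comp hφ.smooth.continuous.abs
      have hi : IntegrableOn (fun x => |φ x| ^ p) Ω :=
        integrable_norm_rpow hp1.le (hφ.memLp _ (volume.restrict Ω))
      rw [setIntegral_pos_iff_support_of_nonneg_ae
        (Eventually.of_forall fun x => by simp only [Pi.zero_apply]; positivity) hi]
      refine (IsOpen.inter ?_ hΩ).measure_pos _ ⟨x₀, ?_, hx₀⟩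
      · exact isOpen_ne_fun hc continuous_const
      · simp [hφ1]
    set I := ∫ x in Ω, |φ x| ^ p with hI
    refine ⟨_, _, _, (hφ.memW01p hp1.le).const_mul hp1.le (I ^ (-1 / p)), ?_, rfl⟩
    simp only [abs_mul]
    have e : ∀ x, (|I ^ (-1 / p)| * |φ x|) ^ p = I⁻¹ * |φ x| ^ p := fun x => by
      rw [Real.mul_rpow (abs_nonneg _) (abs_nonneg _), abs_of_nonneg (by positivity),
        ← Real.rpow_mul hpos.le, div_mul_cancel₀ _ hp0.ne', Real.rpow_neg_one]
    simp only [e]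
    rw [integral_const_mul, ← hI, inv_mul_cancel₀ hpos.ne']
  obtain ⟨a, ⟨u, g, hu, hu1, rfl⟩, hlt⟩ := exists_lt_of_csInf_lt hset hlam
  -- The competitor `u` need not lie in `L²`. A test function close to it keeps `∫|∇φ|^p < λ∫|φ|^p`
  -- and belongs to the energy space.
  obtain ⟨φ, hφ, a1, a2⟩ := hu.approx
  have b1 := tendsto_integral_norm_rpow hp1.le (fun n => (hφ n).memLp _ _) hu.memLp a1
  have b2 := tendsto_integral_norm_rpow hp1.le (fun n => (hφ n).memLp_gradient _ _)
    hu.memLp_grad a2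
  have hu1' : ∫ x in Ω, ‖u x‖ ^ p = 1 := hu1
  rw [hu1'] at b1
  have b3 := b2.sub (b1.const_mul lam)
  obtain ⟨n, hn⟩ := (b3.eventually (gt_mem_nhds (by linarith :
    (∫ x in Ω, ‖g x‖ ^ p) - lam * 1 < 0))).exists
  set A := (∫ x in Ω, ‖gradient (φ n) x‖ ^ p) - lam * ∫ x in Ω, ‖φ n x‖ ^ p with hA
  set B := ∫ x in Ω, ‖φ n x‖ ^ (2 : ℝ) with hB
  have hφE : MemEnergySpace Ω p (φ n) (gradient (φ n)) :=
    ⟨(hφ n).memW01p hp1.le, (hφ n).memLp _ _⟩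
  -- After factoring out `t^p`, the quadratic term carries `t^{2-p}`, which disappears as `t → 0`;
  -- the sign is then that of `A < 0`.
  have hscale : ∀ t : ℝ, 0 < t → energy Ω p lam (fun x => t * φ n x) (fun x => t • gradient (φ n) x)
      = t ^ p * (1 / p * A + 1 / 2 * (t ^ (2 - p) * B)) := fun t ht => by
    have e1 : ∀ (q : ℝ) x, ‖t * φ n x‖ ^ q = t ^ q * ‖φ n x‖ ^ q := fun q x => by
      rw [norm_mul, Real.mul_rpow (norm_nonneg _) (norm_nonneg _), Real.norm_of_nonneg ht.le]
    have e2 : ∀ x, ‖t • gradient (φ n) x‖ ^ p = t ^ p * ‖gradient (φ n) x‖ ^ p := fun x => by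
      rw [norm_smul, Real.mul_rpow (norm_nonneg _) (norm_nonneg _), Real.norm_of_nonneg ht.le]
    have e3 : t ^ (2 : ℝ) = t ^ p * t ^ (2 - p) := by
      rw [← Real.rpow_add ht]; ring_nf
    simp only [energy, e1, e2, integral_const_mul]
    rw [e3, hA, hB]
    ring
  have hlim : Tendsto (fun t : ℝ => 1 / p * A + 1 / 2 * (t ^ (2 - p) * B)) (𝓝[>] 0)
      (𝓝 (1 / p * A + 1 / 2 * (0 * B))) := by
    have h0 : Tendsto (fun t : ℝ => t ^ (2 - p)) (𝓝[>] 0) (𝓝 0) := by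
      have := (Real.continuousAt_rpow_const 0 (2 - p) (Or.inr (by linarith))).tendsto
      rw [Real.zero_rpow (by linarith)] at this
      exact this.mono_left nhdsWithin_le_nhds
    exact ((h0.mul_const B).const_mul _).const_add _
  have hneg : 1 / p * A + 1 / 2 * (0 * B) < 0 := by
    have : 1 / p * A < 0 := mul_neg_of_pos_of_neg (by positivity) hn
    linarith
  obtain ⟨t, ht1, ht2⟩ := ((hlim.eventually (gt_mem_nhds hneg)).and self_mem_nhdsWithin).exists
  refine ⟨_, _, hφE.const_mul hp1.le t, ?_⟩
  rw [hscale t ht2]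
  exact mul_neg_of_pos_of_neg (Real.rpow_pos_of_pos ht2 _) ht1

lemma firstEigenvalue_nonneg : 0 ≤ firstEigenvalue Ω p := by
  refine Real.sInf_nonneg ?_
  rintro a ⟨u, g, -, -, rfl⟩
  exact integral_nonneg fun x => by positivity

/-- The Euler–Lagrange equation of the energy. -/
lemma euler_lagrange [IsFiniteMeasure (volume.restrict Ω)] (hp1 : 1 < p)
    (hu : MemEnergySpace Ω p u g)
    (hmin : ∀ v h, MemEnergySpace Ω p v h → energy Ω p lam u g ≤ energy Ω p lam v h)
    {φ : EuclideanSpace ℝ (Fin N) → ℝ}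
    {Φ : EuclideanSpace ℝ (Fin N) → EuclideanSpace ℝ (Fin N)} (hφ : MemEnergySpace Ω p φ Φ) :
    ∫ x in Ω, inner ℝ (flux p (g x)) (Φ x) = ∫ x in Ω, (lam * spow p (u x) - u x) * φ x := by
  have hp0 : 0 < p := by linarith
  have d1 := hasDerivAt_integral_norm_rpow hp1 hu.1.memLp_grad hφ.1.memLp_grad
  have d2 := hasDerivAt_integral_norm_rpow hp1 hu.1.memLp hφ.1.memLp
  have d3 := hasDerivAt_integral_norm_rpow (by norm_num : (1 : ℝ) < 2) hu.2 hφ.2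
  have d := ((d1.const_mul (1 / p)).sub (d2.const_mul (lam / p))).add (d3.const_mul (1 / 2))
  have hmin' : IsLocalMin (fun t : ℝ => energy Ω p lam (fun x => u x + t • φ x)
      (fun x => g x + t • Φ x)) 0 := by
    refine Eventually.of_forall fun t => ?_
    have := hmin _ _ (hu.add hp1.le (hφ.const_mul hp1.le t))
    simpa using this
  have h0 := hmin'.hasDerivAt_eq_zero d
  have i2 := integrable_spow_mul hp1 hu.1.memLp hφ.1.memLp
  have i3 : Integrable (fun x => u x * φ x) (volume.restrict Ω) := by
    have h1 := hu.2
    have h2 := hφ.2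
    rw [ENNReal.ofReal_ofNat] at h1 h2
    exact h1.integrable_mul h2
  have e1 : ∫ x in Ω, p * ‖g x‖ ^ (p - 2) * inner ℝ (g x) (Φ x) =
      p * ∫ x in Ω, inner ℝ (flux p (g x)) (Φ x) := by
    rw [← integral_const_mul]
    simp only [flux, real_inner_smul_left, mul_assoc]
  have e2 : ∫ x in Ω, p * ‖u x‖ ^ (p - 2) * inner ℝ (u x) (φ x) =
      p * ∫ x in Ω, spow p (u x) * φ x := by
    rw [← integral_const_mul]
    congr 1; ext x
    simp only [spow, Real.norm_eq_abs, RCLike.inner_apply, conj_trivial]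
    ring
  have e3 : ∫ x in Ω, 2 * ‖u x‖ ^ ((2 : ℝ) - 2) * inner ℝ (u x) (φ x) =
      2 * ∫ x in Ω, u x * φ x := by
    rw [← integral_const_mul]
    congr 1; ext x
    simp only [sub_self, Real.rpow_zero, RCLike.inner_apply, conj_trivial]
    ring
  rw [e1, e2, e3] at h0
  have e4 : ∫ x in Ω, (lam * spow p (u x) - u x) * φ x =
      lam * (∫ x in Ω, spow p (u x) * φ x) - ∫ x in Ω, u x * φ x := by
    rw [← integral_const_mul, ← integral_sub (i2.const_mul _) i3]
    congr 1; ext x; ring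
  rw [e4]
  field_simp at h0
  linarith

/-- A nonnegative, nontrivial solution of the logistic problem. -/
lemma exists_nonneg_logistic_solution [IsFiniteMeasure (volume.restrict Ω)] (hΩ : IsOpen Ω)
    (hne : Ω.Nonempty) (hp1 : 1 < p) (hp2 : p < 2) (hlam : firstEigenvalue Ω p < lam) :
    ∃ w g, MemEnergySpace Ω p w g ∧ (∀ x, 0 ≤ w x) ∧ ¬ (w =ᵐ[volume.restrict Ω] 0) ∧
      ∀ φ Φ, MemEnergySpace Ω p φ Φ →
      ∫ x in Ω, inner ℝ (flux p (g x)) (Φ x) = ∫ x in Ω, (lam * spow p (w x) - w x) * φ x := by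
  have hp0 : 0 < p := by linarith
  have hlam0 : 0 ≤ lam := firstEigenvalue_nonneg.trans hlam.le
  obtain ⟨u, g, hu, hmin⟩ := exists_energy_minimizer hΩ.measurableSet hp1 hp2 hlam0
  obtain ⟨u', g', hu', hneg⟩ := exists_energy_neg hΩ hne hp1 hp2 hlam
  have hw : MemEnergySpace Ω p (fun x => |u x|) (fun x => (SignType.sign (u x) : ℝ) • g x) :=
    ⟨hu.1.abs hp1.le, hu.2.abs⟩
  have hle : energy Ω p lam (fun x => |u x|) (fun x => (SignType.sign (u x) : ℝ) • g x) ≤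
      energy Ω p lam u g := by
    have h1 : ∫ x in Ω, ‖(SignType.sign (u x) : ℝ) • g x‖ ^ p ≤ ∫ x in Ω, ‖g x‖ ^ p := by
      refine integral_mono (integrable_norm_rpow hp1.le hw.1.memLp_grad)
        (integrable_norm_rpow hp1.le hu.1.memLp_grad) fun x => ?_
      refine Real.rpow_le_rpow (norm_nonneg _) ?_ hp0.le
      rw [norm_smul]
      refine mul_le_of_le_one_left (norm_nonneg _) ?_
      rcases lt_trichotomy (u x) 0 with h | h | h <;> simp [h]
    simp only [energy, norm_abs_eq_norm, Real.norm_eq_abs] at h1 ⊢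
    gcongr
  have hmin' := fun v h hv => hle.trans (hmin v h hv)
  refine ⟨_, _, hw, fun x => abs_nonneg _, fun h0 => ?_, fun φ Φ hφ =>
    euler_lagrange hp1 hw hmin' hφ⟩
  -- If the minimizer vanished, its energy would reduce to the gradient term, which is nonnegative,
  -- against the negative value found above.
  have hz : ∀ᵐ x ∂(volume.restrict Ω), ‖u x‖ = 0 := h0
  have hI : ∀ q : ℝ, q ≠ 0 → ∫ x in Ω, ‖u x‖ ^ q = 0 := fun q hq => by
    refine integral_eq_zero_of_ae ?_
    filter_upwards [hz] with x hx
    rw [hx, Real.zero_rpow hq]; rfl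
  have hnn : 0 ≤ energy Ω p lam u g := by
    simp only [energy, hI p hp0.ne', hI 2 two_ne_zero, mul_zero, sub_zero, add_zero]
    exact mul_nonneg (by positivity) (integral_nonneg fun x => by positivity)
  exact absurd (hmin u' g' hu') (by linarith)

end Energy

/-! ### Positivity: the logarithmic estimate -/

section Profile

variable {ε p : ℝ}

lemma hasDerivAt_sqrt_sq_add (hε : 0 < ε) (s : ℝ) :
    HasDerivAt (fun s : ℝ => √(s ^ 2 + ε ^ 2)) (s / √(s ^ 2 + ε ^ 2)) s := by
  have h1 : HasDerivAt (fun s : ℝ => s ^ 2 + ε ^ 2) (2 * s) s := by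
    simpa using (hasDerivAt_pow 2 s).add_const (ε ^ 2)
  convert h1.sqrt (by positivity) using 1
  field_simp

/-- A smooth positive function on `ℝ` comparable to `s + ε` for `s ≥ 0`. -/
def shift (ε s : ℝ) : ℝ := s + √(s ^ 2 + ε ^ 2)

lemma shift_pos (hε : 0 < ε) (s : ℝ) : 0 < shift ε s := by
  have h : |s| < √(s ^ 2 + ε ^ 2) := by
    rw [← Real.sqrt_sq_eq_abs]
    exact Real.sqrt_lt_sqrt (sq_nonneg _) (by nlinarith [sq_pos_of_pos hε])
  unfold shift
  linarith [neg_abs_le s]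

lemma shift_mul (hε : 0 < ε) (s : ℝ) : shift ε s * (√(s ^ 2 + ε ^ 2) - s) = ε ^ 2 := by
  have h := Real.sq_sqrt (by positivity : 0 ≤ s ^ 2 + ε ^ 2)
  unfold shift
  nlinarith

lemma hasDerivAt_shift_rpow (hε : 0 < ε) (s : ℝ) :
    HasDerivAt (fun s => shift ε s ^ (1 - p))
      (-((p - 1) * shift ε s ^ (1 - p) / √(s ^ 2 + ε ^ 2))) s := by
  have hR : 0 < √(s ^ 2 + ε ^ 2) := Real.sqrt_pos.2 (by positivity)
  have h1 : HasDerivAt (shift ε) (1 + s / √(s ^ 2 + ε ^ 2)) s :=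
    (hasDerivAt_id s).add (hasDerivAt_sqrt_sq_add hε s)
  have h2 := h1.rpow_const (p := 1 - p) (Or.inl (shift_pos hε s).ne')
  convert h2 using 1
  have e : shift ε s ^ (1 - p) = shift ε s ^ (1 - p - 1) * shift ε s := by
    rw [← Real.rpow_add_one (shift_pos hε s).ne']; ring_nf
  rw [e]
  unfold shift
  field_simp
  ring

lemma contDiff_shift_rpow (hε : 0 < ε) : ContDiff ℝ ∞ (fun s => shift ε s ^ (1 - p)) := by
  have h1 : ContDiff ℝ ∞ (shift ε) := contDiff_id.add (contDiff_sqrt_sq_add hε)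
  exact h1.rpow_const_of_ne fun s => (shift_pos hε s).ne'

/-- For very negative `s` the quantity `shift ε s` is tiny, and the conjugate identity `shift_mul`
limits how fast its inverse grows. The resulting global derivative bound is what `MemW01p.comp`
requires; it may blow up as `ε → 0`. -/
lemma shift_rpow_le (hε : 0 < ε) (hε1 : ε ≤ 1) (hp1 : 1 < p) (hp2 : p < 2) (s : ℝ) :
    shift ε s ^ (1 - p) ≤ 2 / ε ^ 2 * √(s ^ 2 + ε ^ 2) := by
  have hpos := shift_pos hε s
  have hR : 0 < √(s ^ 2 + ε ^ 2) := Real.sqrt_pos.2 (by positivity)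
  have hεR : ε ≤ √(s ^ 2 + ε ^ 2) := by
    have := abs_le_sqrt_sq_add ε s
    rwa [abs_of_pos hε, add_comm] at this
  have h1 : (shift ε s)⁻¹ ≤ 2 / ε ^ 2 * √(s ^ 2 + ε ^ 2) := by
    have h2 := shift_mul hε s
    have h3 : √(s ^ 2 + ε ^ 2) - s ≤ 2 * √(s ^ 2 + ε ^ 2) := by
      linarith [neg_abs_le s, abs_le_sqrt_sq_add s ε]
    have h4 : ε ^ 2 ≤ shift ε s * (2 * √(s ^ 2 + ε ^ 2)) :=
      h2.symm.le.trans (mul_le_mul_of_nonneg_left h3 hpos.le)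
    rw [inv_le_iff_one_le_mul₀ hpos]
    have e : 2 / ε ^ 2 * √(s ^ 2 + ε ^ 2) * shift ε s =
        shift ε s * (2 * √(s ^ 2 + ε ^ 2)) / ε ^ 2 := by ring
    rw [e, le_div_iff₀ (by positivity)]
    linarith
  have h5 : 1 ≤ 2 / ε ^ 2 * √(s ^ 2 + ε ^ 2) := by
    have : ε ^ 2 ≤ 2 * √(s ^ 2 + ε ^ 2) := by nlinarith
    rw [div_mul_eq_mul_div, le_div_iff₀ (by positivity)]
    linarith
  calc shift ε s ^ (1 - p) = ((shift ε s)⁻¹) ^ (p - 1) := by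
        rw [Real.inv_rpow hpos.le, ← Real.rpow_neg hpos.le]; ring_nf
    _ ≤ (2 / ε ^ 2 * √(s ^ 2 + ε ^ 2)) ^ (p - 1) :=
        Real.rpow_le_rpow (by positivity) h1 (by linarith)
    _ ≤ (2 / ε ^ 2 * √(s ^ 2 + ε ^ 2)) ^ (1 : ℝ) :=
        Real.rpow_le_rpow_of_exponent_le h5 (by linarith)
    _ = _ := Real.rpow_one _

lemma abs_deriv_shift_rpow_le (hε : 0 < ε) (hε1 : ε ≤ 1) (hp1 : 1 < p) (hp2 : p < 2) (s : ℝ) :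
    |deriv (fun s => shift ε s ^ (1 - p) - shift ε 0 ^ (1 - p)) s| ≤ 2 / ε ^ 2 := by
  have hR : 0 < √(s ^ 2 + ε ^ 2) := Real.sqrt_pos.2 (by positivity)
  have hpos := shift_pos hε s
  rw [((hasDerivAt_shift_rpow hε s).sub_const _).deriv, abs_neg,
    abs_of_nonneg (div_nonneg (mul_nonneg (by linarith) (by positivity)) hR.le),
    div_le_iff₀ hR]
  have h1 := shift_rpow_le hε hε1 hp1 hp2 s
  have h2 : 0 ≤ shift ε s ^ (1 - p) := by positivity
  nlinarith

lemma shift_rpow_le_sqrt (hε : 0 < ε) (hp1 : 1 < p) {s : ℝ} (hs : 0 ≤ s) :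
    shift ε s ^ (1 - p) ≤ √(s ^ 2 + ε ^ 2) ^ (1 - p) := by
  refine Real.rpow_le_rpow_of_nonpos (Real.sqrt_pos.2 (by positivity)) ?_ (by linarith)
  unfold shift; linarith

lemma sqrt_rpow_le_shift (hε : 0 < ε) (hp1 : 1 < p) (s : ℝ) :
    2 ^ (1 - p) * √(s ^ 2 + ε ^ 2) ^ (1 - p) ≤ shift ε s ^ (1 - p) := by
  rw [← Real.mul_rpow (by norm_num) (Real.sqrt_nonneg _)]
  refine Real.rpow_le_rpow_of_nonpos (shift_pos hε s) ?_ (by linarith)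
  unfold shift; linarith [le_abs_self s, abs_le_sqrt_sq_add s ε]

/-- `arsinh(s/ε)` is the regularised logarithm whose derivative is exactly the weight of the
logarithmic estimate, and it vanishes only at `s = 0`. -/
lemma hasDerivAt_arsinh_div (hε : 0 < ε) (s : ℝ) :
    HasDerivAt (fun s => Real.arsinh (s / ε)) (1 / √(s ^ 2 + ε ^ 2)) s := by
  have h := ((hasDerivAt_id s).div_const ε).arsinh
  change HasDerivAt (fun s => Real.arsinh (s / ε)) _ s at h
  convert h using 1
  have e : √(s ^ 2 + ε ^ 2) = √(1 + (id s / ε) ^ 2) * ε := by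
    rw [← Real.sqrt_sq hε.le, ← Real.sqrt_mul (by positivity), Real.sqrt_sq hε.le]
    congr 1
    simp only [id]
    field_simp
    ring
  rw [e, smul_eq_mul, one_div, mul_inv, one_div]

/-- Absorption of the cross term in the logarithmic estimate. -/
lemma absorb (hp1 : 1 < p) (hp2 : p < 2) {c M η Y : ℝ} (hc : 0 < c) (hM : 0 ≤ M) (hη0 : 0 ≤ η)
    (hη1 : η ≤ 1) (hY : 0 ≤ Y) :
    c / 2 * (η ^ 2 * Y ^ p) - 2 * M * (4 * M / c) ^ (p - 1) ≤
      c * (η ^ 2 * Y ^ p) - 2 * M * (η * Y ^ (p - 1)) := by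
  have hYp : Y ^ p = Y ^ (p - 1) * Y := by
    rw [← Real.rpow_add_one' hY (by linarith)]; ring_nf
  have hK : 0 ≤ 2 * M * (4 * M / c) ^ (p - 1) := by positivity
  -- For large `η Y` the cross term is at most half the main term. Otherwise `η ≤ η^{p-1}`, valid as
  -- `0 ≤ η ≤ 1` and `p - 1 < 1`, bounds it by a constant.
  rcases le_total (4 * M / c) (η * Y) with h | h
  · have h1 : 2 * M * (η * Y ^ (p - 1)) ≤ c / 2 * (η ^ 2 * Y ^ p) := by
      rw [hYp]
      have h2 : 4 * M ≤ η * Y * c := (div_le_iff₀ hc).1 h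
      have h3 : 0 ≤ η * Y ^ (p - 1) := by positivity
      nlinarith
    linarith
  · have h1 : η * Y ^ (p - 1) ≤ (4 * M / c) ^ (p - 1) := by
      calc η * Y ^ (p - 1) ≤ η ^ (p - 1) * Y ^ (p - 1) := by
            gcongr
            rcases eq_or_lt_of_le hη0 with h0 | h0
            · rw [← h0, Real.zero_rpow (by linarith)]
            · calc η = η ^ (1 : ℝ) := (Real.rpow_one η).symm
                _ ≤ η ^ (p - 1) := Real.rpow_le_rpow_of_exponent_ge h0 hη1 (by linarith)
        _ = (η * Y) ^ (p - 1) := (Real.mul_rpow hη0 hY).symm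
        _ ≤ _ := Real.rpow_le_rpow (by positivity) h (by linarith)
    have h2 : 2 * M * (η * Y ^ (p - 1)) ≤ 2 * M * (4 * M / c) ^ (p - 1) := by gcongr
    have h3 : 0 ≤ c / 2 * (η ^ 2 * Y ^ p) := by positivity
    linarith

end Profile

section LogEstimate

variable {Ω : Set (EuclideanSpace ℝ (Fin N))} {p lam : ℝ}
  {w : EuclideanSpace ℝ (Fin N) → ℝ}
  {g : EuclideanSpace ℝ (Fin N) → EuclideanSpace ℝ (Fin N)}

/-- The chain rule needs a function vanishing at `0`, so `shift ε 0 ^ (1 - p)` is subtracted first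
and restored as a multiple of the test function `η²`. Boundedness, hence `L²`, uses `w ≥ 0`, which
gives `shift ε (w x) ≥ ε`. -/
lemma memEnergySpace_cutoff [IsFiniteMeasure (volume.restrict Ω)] (hp1 : 1 < p) (hp2 : p < 2)
    (hw : MemEnergySpace Ω p w g) (hw0 : ∀ x, 0 ≤ w x)
    {η : EuclideanSpace ℝ (Fin N) → ℝ} (hη : IsTestFunction Ω η) {ε : ℝ} (hε : 0 < ε)
    (hε1 : ε ≤ 1) :
    MemEnergySpace Ω p (fun x => η x ^ 2 * shift ε (w x) ^ (1 - p))
      (fun x => -((p - 1) * η x ^ 2 * shift ε (w x) ^ (1 - p) / √(w x ^ 2 + ε ^ 2)) • g x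
        + (2 * η x * shift ε (w x) ^ (1 - p)) • gradient η x) := by
  have hη2 : IsTestFunction Ω (fun x => η x * η x) := hη.mul_left hη.smooth
  have h1 := hw.1.comp hp1.le (F := fun s => shift ε s ^ (1 - p) - shift ε 0 ^ (1 - p))
    ((contDiff_shift_rpow hε).sub contDiff_const) (sub_self _)
    (abs_deriv_shift_rpow_le hε hε1 hp1 hp2)
  have h2 := (h1.mul_test hp1.le hη2).add hp1.le
    ((hη2.memW01p hp1.le).const_mul hp1.le (shift ε 0 ^ (1 - p)))
  have h3 : MemW01p Ω p (fun x => η x ^ 2 * shift ε (w x) ^ (1 - p))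
      (fun x => -((p - 1) * η x ^ 2 * shift ε (w x) ^ (1 - p) / √(w x ^ 2 + ε ^ 2)) • g x
        + (2 * η x * shift ε (w x) ^ (1 - p)) • gradient η x) := by
    refine h2.congr hp1.le (Eventually.of_forall fun x => ?_) (Eventually.of_forall fun x => ?_)
    · ring
    · beta_reduce
      rw [((hasDerivAt_shift_rpow hε (w x)).sub_const _).deriv, hη.gradient_mul_left hη.smooth]
      module
  refine ⟨h3, MemLp.of_bound h3.memLp.aestronglyMeasurable
    ((hη.bounded.choose) ^ 2 * ε ^ (1 - p)) (Eventually.of_forall fun x => ?_)⟩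
  have hb := hη.bounded.choose_spec x
  have h4 : shift ε (w x) ^ (1 - p) ≤ ε ^ (1 - p) := by
    refine Real.rpow_le_rpow_of_nonpos hε ?_ (by linarith)
    have := abs_le_sqrt_sq_add ε (w x)
    rw [abs_of_pos hε, add_comm] at this
    unfold shift; linarith [hw0 x]
  have hpos := shift_pos hε (w x)
  rw [norm_mul, norm_pow, Real.norm_of_nonneg (by positivity : 0 ≤ shift ε (w x) ^ (1 - p))]
  gcongr

/-- Estimate for `∇ log` of a nonnegative solution, uniform in the regularisation `ε`. -/
lemma exists_log_estimate [IsFiniteMeasure (volume.restrict Ω)] (hp1 : 1 < p) (hp2 : p < 2)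
    (hlam : 0 ≤ lam) (hw : MemEnergySpace Ω p w g) (hw0 : ∀ x, 0 ≤ w x)
    (heq : ∀ φ Φ, MemEnergySpace Ω p φ Φ →
      ∫ x in Ω, inner ℝ (flux p (g x)) (Φ x) = ∫ x in Ω, (lam * spow p (w x) - w x) * φ x)
    {η : EuclideanSpace ℝ (Fin N) → ℝ} (hη : IsTestFunction Ω η) (hη0 : ∀ x, 0 ≤ η x)
    (hη1 : ∀ x, η x ≤ 1) :
    ∃ C : ℝ, ∀ ε, 0 < ε → ε ≤ 1 →
      ∫ x in Ω, η x ^ 2 * (‖g x‖ / √(w x ^ 2 + ε ^ 2)) ^ p ≤ C := by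
  obtain ⟨M, hM⟩ := hη.bounded_gradient
  have hM0 : 0 ≤ M := (norm_nonneg _).trans (hM 0)
  -- `p - 1` comes from differentiating the power, and `2^{1-p}` from `shift ≤ 2√(w² + ε²)`.
  set c : ℝ := (p - 1) * 2 ^ (1 - p) with hc
  have hc0 : 0 < c := mul_pos (by linarith) (by positivity)
  set K : ℝ := 2 * M * (4 * M / c) ^ (p - 1) with hK
  have hwi : Integrable w (volume.restrict Ω) := hw.1.memLp.integrable (one_le_ofReal hp1.le)
  refine ⟨2 / c * ∫ x in Ω, (w x + 1 + K), fun ε hε hε1 => ?_⟩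
  have hφ := memEnergySpace_cutoff hp1 hp2 hw hw0 hη hε hε1
  have e := heq _ _ hφ
  have hRpos : ∀ x, 0 < √(w x ^ 2 + ε ^ 2) := fun x => Real.sqrt_pos.2 (by positivity)
  have i1 := integrable_inner_flux hp1 hw.1.memLp_grad hφ.1.memLp_grad
  have i2 : Integrable (fun x => (lam * spow p (w x) - w x) *
      (η x ^ 2 * shift ε (w x) ^ (1 - p))) (volume.restrict Ω) := by
    have j1 := (integrable_spow_mul hp1 hw.1.memLp hφ.1.memLp).const_mul lam
    have a1 := hw.2
    have a2 := hφ.2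
    rw [ENNReal.ofReal_ofNat] at a1 a2
    have j2 : Integrable (fun x => w x * (η x ^ 2 * shift ε (w x) ^ (1 - p)))
      (volume.restrict Ω) := a1.integrable_mul a2
    refine (j1.sub j2).congr (Eventually.of_forall fun x => ?_)
    simp only [Pi.sub_apply]; ring
  have hYm : AEStronglyMeasurable (fun x => η x ^ 2 * (‖g x‖ / √(w x ^ 2 + ε ^ 2)) ^ p)
      (volume.restrict Ω) := by
    have hm1 : AEMeasurable (fun x => η x ^ 2) (volume.restrict Ω) :=
      (hη.smooth.continuous.pow 2).measurable.aemeasurable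
    have hm2 := hw.1.memLp_grad.aestronglyMeasurable.norm.aemeasurable
    have hm3 : AEMeasurable (fun x => √(w x ^ 2 + ε ^ 2)) (volume.restrict Ω) :=
      (contDiff_sqrt_sq_add hε).continuous.measurable.comp_aemeasurable
        hw.1.memLp.aestronglyMeasurable.aemeasurable
    exact (hm1.mul ((hm2.div hm3).pow_const p)).aestronglyMeasurable
  have i3 : Integrable (fun x => η x ^ 2 * (‖g x‖ / √(w x ^ 2 + ε ^ 2)) ^ p)
      (volume.restrict Ω) := by
    refine ((integrable_norm_rpow hp1.le hw.1.memLp_grad).const_mul (1 / ε ^ p)).mono' hYm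
      (Eventually.of_forall fun x => ?_)
    have h1 : ‖g x‖ / √(w x ^ 2 + ε ^ 2) ≤ ‖g x‖ / ε := by
      gcongr
      have := abs_le_sqrt_sq_add ε (w x)
      rwa [abs_of_pos hε, add_comm] at this
    have h2 : η x ^ 2 ≤ 1 := pow_le_one₀ (hη0 x) (hη1 x)
    rw [Real.norm_of_nonneg (mul_nonneg (sq_nonneg _) (Real.rpow_nonneg
      (div_nonneg (norm_nonneg _) (hRpos x).le) _))]
    calc _ ≤ 1 * (‖g x‖ / ε) ^ p := by
          gcongr
      _ = _ := by rw [Real.div_rpow (norm_nonneg _) hε.le]; ring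
  -- Pointwise form of the estimate. The inner bracket is the difference of the two integrands of
  -- the weak equation, so it integrates to zero, and `w + 1 + K` is free of `ε`.
  have hpt : ∀ x, c / 2 * (η x ^ 2 * (‖g x‖ / √(w x ^ 2 + ε ^ 2)) ^ p) ≤
      (w x + 1 + K) + ((lam * spow p (w x) - w x) * (η x ^ 2 * shift ε (w x) ^ (1 - p))
      - inner ℝ (flux p (g x))
        (-((p - 1) * η x ^ 2 * shift ε (w x) ^ (1 - p) / √(w x ^ 2 + ε ^ 2)) • g x
        + (2 * η x * shift ε (w x) ^ (1 - p)) • gradient η x)) := by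
    intro x
    set R := √(w x ^ 2 + ε ^ 2) with hR
    set S := shift ε (w x) ^ (1 - p) with hS
    set X := ‖g x‖ with hX
    have hR0 : 0 < R := hRpos x
    have hX0 : 0 ≤ X := norm_nonneg _
    have hS0 : 0 ≤ S := Real.rpow_nonneg (shift_pos hε _).le _
    have hSu : S ≤ R ^ (1 - p) := shift_rpow_le_sqrt hε hp1 (hw0 x)
    have hSl : 2 ^ (1 - p) * R ^ (1 - p) ≤ S := sqrt_rpow_le_shift hε hp1 (w x)
    have hxη0 := hη0 x
    have hxη1 := hη1 x
    have hw0x := hw0 x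
    have hη2 : η x ^ 2 ≤ 1 := pow_le_one₀ hxη0 hxη1
    have hXX : inner ℝ (flux p (g x)) (g x) = X ^ p := by
      rw [flux, real_inner_smul_left, real_inner_self_eq_norm_sq, pow_two, ← mul_assoc, ← hX,
        ← Real.rpow_add_one' hX0 (by linarith), ← Real.rpow_add_one' hX0 (by linarith)]
      ring_nf
    have hXη : |inner ℝ (flux p (g x)) (gradient η x)| ≤ X ^ (p - 1) * M := by
      refine (abs_real_inner_le_norm _ _).trans ?_
      rw [norm_flux hp1]
      gcongr
      exact hM x
    have hYp : (X / R) ^ p = R ^ (1 - p) * X ^ p / R := by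
      rw [Real.div_rpow hX0 hR0.le, Real.rpow_sub hR0, Real.rpow_one]
      field_simp
    have hYp1 : (X / R) ^ (p - 1) = R ^ (1 - p) * X ^ (p - 1) := by
      rw [Real.div_rpow hX0 hR0.le, show 1 - p = -(p - 1) by ring, Real.rpow_neg hR0.le]
      field_simp
    have hab := absorb hp1 hp2 hc0 hM0 hxη0 hxη1 (div_nonneg hX0 hR0.le : 0 ≤ X / R)
    have t1 : c * (η x ^ 2 * (X / R) ^ p) ≤ (p - 1) * η x ^ 2 * S / R * X ^ p := by
      rw [hYp, hc]
      calc (p - 1) * 2 ^ (1 - p) * (η x ^ 2 * (R ^ (1 - p) * X ^ p / R))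
          = (p - 1) * η x ^ 2 * (2 ^ (1 - p) * R ^ (1 - p)) / R * X ^ p := by ring
        _ ≤ _ := by
            have : 0 ≤ p - 1 := by linarith
            gcongr
    have t2 : 2 * η x * S * inner ℝ (flux p (g x)) (gradient η x) ≤
        2 * M * (η x * (X / R) ^ (p - 1)) := by
      rw [hYp1]
      calc 2 * η x * S * inner ℝ (flux p (g x)) (gradient η x)
          ≤ 2 * η x * S * (X ^ (p - 1) * M) := by
            gcongr
            exact (le_abs_self _).trans hXη
        _ ≤ 2 * η x * R ^ (1 - p) * (X ^ (p - 1) * M) := by gcongr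
        _ = _ := by ring
    -- The `λ` part is nonnegative and is discarded; the absorption part satisfies `w S ≤ R^{2-p} ≤
    -- w + 1` because `0 < 2 - p < 1` and `ε ≤ 1`.
    have t3 : -(w x + 1) ≤ (lam * spow p (w x) - w x) * (η x ^ 2 * S) := by
      have h1 : 0 ≤ lam * spow p (w x) := mul_nonneg hlam (mul_nonneg (by positivity) hw0x)
      have h2 : w x * S ≤ w x + 1 := by
        have hRw : R ≤ w x + 1 := by
          have := sqrt_sq_add_le (w x) hε.le
          rw [abs_of_nonneg hw0x] at this
          linarith
        have hwR : w x ≤ R := by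
          have := abs_le_sqrt_sq_add (w x) ε
          rwa [abs_of_nonneg hw0x] at this
        calc w x * S ≤ R * R ^ (1 - p) := mul_le_mul hwR hSu hS0 hR0.le
          _ = R ^ (2 - p) := by
            rw [mul_comm, ← Real.rpow_add_one hR0.ne']; ring_nf
          _ ≤ (w x + 1) ^ (2 - p) := Real.rpow_le_rpow hR0.le hRw (by linarith)
          _ ≤ (w x + 1) ^ (1 : ℝ) :=
            Real.rpow_le_rpow_of_exponent_le (by linarith) (by linarith)
          _ = w x + 1 := Real.rpow_one _
      have h3 : 0 ≤ lam * spow p (w x) * (η x ^ 2 * S) := by positivity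
      have h4 : w x * (η x ^ 2 * S) ≤ w x + 1 := by
        calc w x * (η x ^ 2 * S) = η x ^ 2 * (w x * S) := by ring
          _ ≤ 1 * (w x * S) := by gcongr
          _ ≤ _ := by linarith
      linarith
    rw [inner_add_right, real_inner_smul_right, real_inner_smul_right, hXX]
    linarith
  have hint := integral_mono (i3.const_mul (c / 2))
    (((hwi.add (integrable_const 1)).add (integrable_const K)).add (i2.sub i1)) hpt
  have hsum : ∫ x in Ω, (((w + fun _ => 1) + fun _ => K) + ((fun x => (lam * spow p (w x) - w x) *
      (η x ^ 2 * shift ε (w x) ^ (1 - p))) - fun x => inner ℝ (flux p (g x))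
        (-((p - 1) * η x ^ 2 * shift ε (w x) ^ (1 - p) / √(w x ^ 2 + ε ^ 2)) • g x
        + (2 * η x * shift ε (w x) ^ (1 - p)) • gradient η x)) :
        EuclideanSpace ℝ (Fin N) → ℝ) x = ∫ x in Ω, (w x + 1 + K) := by
    rw [integral_add' ((hwi.add (integrable_const 1)).add (integrable_const K)) (i2.sub i1),
      integral_sub' i2 i1, e, sub_self, add_zero]
    rfl
  rw [integral_const_mul] at hint
  have h5 := hint.trans hsum.le
  rw [div_mul_eq_mul_div, le_div_iff₀ hc0]
  linarith

end LogEstimate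

/-! ### Positivity: the dichotomy -/

section Positivity

variable {Ω : Set (EuclideanSpace ℝ (Fin N))} {p lam : ℝ}
  {w : EuclideanSpace ℝ (Fin N) → ℝ}
  {g : EuclideanSpace ℝ (Fin N) → EuclideanSpace ℝ (Fin N)}

/-- Restrict `y` to the zero set, where the inner integral is `∫|u|^p`, and apply Chebyshev's
inequality in `x`. -/
lemma mul_measure_mul_measure_le {α : Type*} [MeasurableSpace α] {μ : Measure α} {u : α → ℝ}
    (hu : AEMeasurable u μ) (hp : 0 < p) {b : ℝ} :
    ENNReal.ofReal b ^ p * μ {x | b ≤ u x} * μ {x | u x = 0} ≤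
      ∫⁻ y, ∫⁻ x, ‖u x - u y‖ₑ ^ p ∂μ ∂μ := by
  have hZ : NullMeasurableSet {x | u x = 0} μ := hu.nullMeasurable (measurableSet_singleton 0)
  calc ENNReal.ofReal b ^ p * μ {x | b ≤ u x} * μ {x | u x = 0}
      = ∫⁻ _ in {x | u x = 0}, ENNReal.ofReal b ^ p * μ {x | b ≤ u x} ∂μ := by simp
    _ ≤ ∫⁻ y in {x | u x = 0}, ∫⁻ x, ‖u x - u y‖ₑ ^ p ∂μ ∂μ := by
        refine lintegral_mono_ae ?_
        filter_upwards [ae_restrict_mem₀ hZ] with y hy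
        have hy0 : u y = 0 := hy
        simp only [hy0, sub_zero]
        refine le_trans ?_ (mul_meas_ge_le_lintegral₀ (hu.enorm.pow_const p)
          (ENNReal.ofReal b ^ p))
        gcongr with x
        intro (hx : b ≤ u x)
        refine ENNReal.rpow_le_rpow ?_ hp.le
        rw [← ofReal_norm]
        exact ENNReal.ofReal_le_ofReal (hx.trans (le_abs_self _))
    _ ≤ _ := lintegral_mono' Measure.restrict_le_self le_rfl

/-- On the zero set of `w` the function `arsinh(w/ε)` is `0`, while on `{w ≥ a}` it is at least
`arsinh(a/ε)`, which tends to infinity as `ε → 0`. Its mean oscillation on the ball stays bounded by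
the logarithmic and Poincaré estimates, so the two sets cannot both have positive measure. -/
lemma ae_zero_or_ae_pos_ball [IsFiniteMeasure (volume.restrict Ω)] (hp1 : 1 < p) (hp2 : p < 2)
    (hlam : 0 ≤ lam) (hw : MemEnergySpace Ω p w g) (hw0 : ∀ x, 0 ≤ w x)
    (heq : ∀ φ Φ, MemEnergySpace Ω p φ Φ →
      ∫ x in Ω, inner ℝ (flux p (g x)) (Φ x) = ∫ x in Ω, (lam * spow p (w x) - w x) * φ x)
    {x₀ : EuclideanSpace ℝ (Fin N)} {r : ℝ} (hr : 0 < r)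
    (hball : Metric.closedBall x₀ (2 * r) ⊆ Ω) :
    (∀ᵐ x ∂(volume.restrict (Metric.ball x₀ r)), w x = 0) ∨
      (∀ᵐ x ∂(volume.restrict (Metric.ball x₀ r)), 0 < w x) := by
  have hp0 : 0 < p := by linarith
  let b : ContDiffBump x₀ := ⟨r, 2 * r, hr, by linarith⟩
  have hη : IsTestFunction Ω b := ⟨b.contDiff, b.hasCompactSupport, by
    rw [b.tsupport_eq]; exact hball⟩
  obtain ⟨C, hC⟩ := exists_log_estimate hp1 hp2 hlam hw hw0 heq hη (fun x => b.nonneg)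
    (fun x => b.le_one)
  set D := Metric.ball x₀ r with hD
  have hDΩ : D ⊆ Ω := (Metric.ball_subset_closedBall.trans
    (Metric.closedBall_subset_closedBall (by linarith))).trans hball
  set μ := volume.restrict D with hμ
  have hwm : AEMeasurable w μ :=
    hw.1.memLp.aestronglyMeasurable.aemeasurable.mono_measure (Measure.restrict_mono_set _ hDΩ)
  have hfin : IsFiniteMeasure μ := ⟨by simpa [hμ, hD] using measure_ball_lt_top⟩
  set A : ℝ≥0∞ := volume (Metric.closedBall (0 : EuclideanSpace ℝ (Fin N)) (2 * r)) *
    ENNReal.ofReal (2 * r) ^ p * ENNReal.ofReal C with hA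
  have hAtop : A ≠ ⊤ := ENNReal.mul_ne_top (ENNReal.mul_ne_top measure_closedBall_lt_top.ne
    (ENNReal.rpow_ne_top_of_nonneg hp0.le ENNReal.ofReal_ne_top)) ENNReal.ofReal_ne_top
  have key : ∀ ε, 0 < ε → ε ≤ 1 → ∀ a, 0 < a → ENNReal.ofReal (Real.arsinh (a / ε)) ^ p *
      μ {x | a ≤ w x} * μ {x | w x = 0} ≤ A := by
    intro ε hε hε1 a ha
    have hRpos : ∀ x, 0 < √(w x ^ 2 + ε ^ 2) := fun x => Real.sqrt_pos.2 (by positivity)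
    have hd : ∀ s, deriv (fun s => Real.arsinh (s / ε)) s = 1 / √(s ^ 2 + ε ^ 2) := fun s =>
      (hasDerivAt_arsinh_div hε s).deriv
    have hv := hw.1.comp hp1.le (F := fun s => Real.arsinh (s / ε))
      (Real.contDiff_arsinh.comp (contDiff_id.div_const ε)) (by simp) (C := 1 / ε) (fun s => by
        rw [hd, abs_of_nonneg (by positivity)]
        gcongr
        have := abs_le_sqrt_sq_add ε s
        rwa [abs_of_pos hε, add_comm] at this)
    simp only [hd] at hv
    have h1 := hv.lintegral_lintegral_sub_le hp1.le (D := D) measurableSet_ball hDΩ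
      (convex_ball x₀ r) (R := 2 * r) (fun x hx y hy => by
        have := dist_triangle_right x y x₀
        rw [hD, Metric.mem_ball] at hx hy
        linarith)
    have h2 : ∫⁻ x in D, ‖(1 / √(w x ^ 2 + ε ^ 2)) • g x‖ₑ ^ p ≤ ENNReal.ofReal C := by
      have hi := integrable_norm_rpow hp1.le hv.memLp_grad
      have h3 : ∫⁻ x in D, ‖(1 / √(w x ^ 2 + ε ^ 2)) • g x‖ₑ ^ p =
          ENNReal.ofReal (∫ x in D, ‖(1 / √(w x ^ 2 + ε ^ 2)) • g x‖ ^ p) := by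
        rw [ofReal_integral_eq_lintegral_ofReal
          (IntegrableOn.mono_set (s := D) (t := Ω) hi hDΩ)
          (Eventually.of_forall fun x => by positivity)]
        refine lintegral_congr fun x => ?_
        rw [← ofReal_norm, ENNReal.ofReal_rpow_of_nonneg (norm_nonneg _) hp0.le]
      rw [h3]
      refine ENNReal.ofReal_le_ofReal (le_trans ?_ (hC ε hε hε1))
      have hYe : ∀ x, ‖(1 / √(w x ^ 2 + ε ^ 2)) • g x‖ = ‖g x‖ / √(w x ^ 2 + ε ^ 2) := fun x => by
        rw [norm_smul, Real.norm_of_nonneg (by positivity)]; ring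
      simp only [hYe] at hi ⊢
      have hbi : Integrable (fun x => b x ^ 2 * (‖g x‖ / √(w x ^ 2 + ε ^ 2)) ^ p)
          (volume.restrict Ω) := by
        refine hi.mono' ((hη.smooth.continuous.pow 2).aestronglyMeasurable.mul
          hi.aestronglyMeasurable) (Eventually.of_forall fun x => ?_)
        have h4 : (b x : ℝ) ^ 2 ≤ 1 := pow_le_one₀ b.nonneg b.le_one
        rw [Real.norm_of_nonneg (by positivity)]
        exact mul_le_of_le_one_left (by positivity) h4
      calc ∫ x in D, (‖g x‖ / √(w x ^ 2 + ε ^ 2)) ^ p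
          = ∫ x in D, b x ^ 2 * (‖g x‖ / √(w x ^ 2 + ε ^ 2)) ^ p := by
            refine setIntegral_congr_fun measurableSet_ball fun x hx => ?_
            beta_reduce
            rw [b.one_of_mem_closedBall (Metric.ball_subset_closedBall hx)]; ring
        _ ≤ _ := setIntegral_mono_set hbi (Eventually.of_forall fun x => by
            change 0 ≤ b x ^ 2 * (‖g x‖ / √(w x ^ 2 + ε ^ 2)) ^ p
            positivity) (LE.le.eventuallyLE hDΩ)
    have h5 : AEMeasurable (fun x => Real.arsinh (w x / ε)) μ :=
      Real.continuous_arsinh.measurable.comp_aemeasurable (hwm.div_const ε)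
    have h6 := mul_measure_mul_measure_le h5 hp0 (b := Real.arsinh (a / ε))
    have e1 : {x | Real.arsinh (a / ε) ≤ Real.arsinh (w x / ε)} = {x | a ≤ w x} := by
      ext x
      simp [Real.arsinh_le_arsinh, div_le_div_iff_of_pos_right hε]
    have e2 : {x | Real.arsinh (w x / ε) = 0} = {x | w x = 0} := by
      ext x; simp [Real.arsinh_eq_zero_iff, hε.ne']
    rw [e1, e2] at h6
    exact h6.trans (h1.trans (mul_le_mul_right h2 _))
  -- A nonzero product would make the left side of `key` tend to infinity as `ε → 0`, beyond the
  -- finite bound `A`.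
  have key2 : ∀ a, 0 < a → μ {x | a ≤ w x} * μ {x | w x = 0} = 0 := by
    intro a ha
    by_contra hne
    have hlim : Tendsto (fun ε : ℝ => ENNReal.ofReal (Real.arsinh (a / ε)) ^ p *
        (μ {x | a ≤ w x} * μ {x | w x = 0})) (𝓝[>] 0) (𝓝 ⊤) := by
      have l1 : Tendsto (fun ε : ℝ => Real.arsinh (a / ε)) (𝓝[>] 0) atTop := by
        have l2 : Tendsto (fun ε : ℝ => a / ε) (𝓝[>] 0) atTop := by
          simpa [div_eq_mul_inv] using tendsto_inv_nhdsGT_zero.const_mul_atTop ha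
        exact Real.sinhOrderIso.symm.tendsto_atTop.comp l2
      have l3 := (ENNReal.continuous_rpow_const (y := p)).tendsto ⊤
      rw [ENNReal.top_rpow_of_pos hp0] at l3
      have l4 := l3.comp (ENNReal.tendsto_ofReal_atTop.comp l1)
      have l5 := ENNReal.Tendsto.mul_const (b := μ {x | a ≤ w x} * μ {x | w x = 0}) l4
        (Or.inl ENNReal.top_ne_zero)
      rwa [ENNReal.top_mul hne] at l5
    have hle : ∀ᶠ ε : ℝ in 𝓝[>] 0, ENNReal.ofReal (Real.arsinh (a / ε)) ^ p *
        (μ {x | a ≤ w x} * μ {x | w x = 0}) ≤ A := by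
      filter_upwards [Ioc_mem_nhdsGT (zero_lt_one' ℝ)] with ε hε
      rw [← mul_assoc]
      exact key ε hε.1 hε.2 a ha
    exact hAtop (top_le_iff.1 (le_of_tendsto hlim hle))
  by_cases hZ : μ {x | w x = 0} = 0
  · right
    have : ∀ᵐ x ∂μ, w x ≠ 0 := by
      rw [ae_iff]; simpa using hZ
    filter_upwards [this] with x hx
    exact lt_of_le_of_ne (hw0 x) hx.symm
  · left
    have h1 : ∀ n : ℕ, ∀ᵐ x ∂μ, ¬ (1 / ((n : ℝ) + 1) ≤ w x) := fun n => by
      rw [ae_iff]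
      have := key2 (1 / ((n : ℝ) + 1)) (by positivity)
      simpa [hZ] using this
    filter_upwards [ae_all_iff.2 h1] with x hx
    by_contra hne
    obtain ⟨n, hn⟩ := exists_nat_one_div_lt (lt_of_le_of_ne (hw0 x) (Ne.symm hne))
    exact hx n hn.le

/-- Strong maximum principle for the logistic problem, in almost-everywhere form. -/
lemma ae_pos_of_nonneg_solution [IsFiniteMeasure (volume.restrict Ω)] (hΩ : IsOpen Ω)
    (hconn : IsPreconnected Ω) (hp1 : 1 < p) (hp2 : p < 2)
    (hlam : 0 ≤ lam) (hw : MemEnergySpace Ω p w g) (hw0 : ∀ x, 0 ≤ w x)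
    (hne : ¬ (w =ᵐ[volume.restrict Ω] 0))
    (heq : ∀ φ Φ, MemEnergySpace Ω p φ Φ →
      ∫ x in Ω, inner ℝ (flux p (g x)) (Φ x) = ∫ x in Ω, (lam * spow p (w x) - w x) * φ x) :
    ∀ᵐ x ∂(volume.restrict Ω), 0 < w x := by
  -- The points near which `w` satisfies `P` almost everywhere. These sets are open for any `P`, and
  -- by the dichotomy those for `w = 0` and `w > 0` cover `Ω`.
  let U : (ℝ → Prop) → Set (EuclideanSpace ℝ (Fin N)) := fun P =>
    {x | ∃ r, 0 < r ∧ ∀ᵐ y ∂(volume.restrict (Metric.ball x r)), P (w y)}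
  have hUo : ∀ P, IsOpen (U P) := fun P => by
    rw [Metric.isOpen_iff]
    rintro x ⟨r, hr, h⟩
    refine ⟨r / 2, half_pos hr, fun y hy => ⟨r / 2, half_pos hr, ?_⟩⟩
    refine ae_restrict_of_ae_restrict_of_subset (Metric.ball_subset_ball' ?_) h
    rw [Metric.mem_ball] at hy
    linarith
  have hcover : Ω ⊆ U (fun s => s = 0) ∪ U (fun s => 0 < s) := by
    intro x hx
    obtain ⟨R, hR, hRΩ⟩ := Metric.isOpen_iff.1 hΩ x hx
    have hb : Metric.closedBall x (2 * (R / 4)) ⊆ Ω :=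
      (Metric.closedBall_subset_ball (by linarith)).trans hRΩ
    rcases ae_zero_or_ae_pos_ball hp1 hp2 hlam hw hw0 heq (by linarith : 0 < R / 4) hb with h | h
    · exact Or.inl ⟨_, by linarith, h⟩
    · exact Or.inr ⟨_, by linarith, h⟩
  have hlocal : ∀ P : ℝ → Prop, Ω ⊆ U P → ∀ᵐ x ∂(volume.restrict Ω), P (w x) := by
    intro P hP
    rw [ae_restrict_iff' hΩ.measurableSet, ae_iff]
    refine measure_null_of_locally_null _ fun x hx => ?_
    have hxΩ : x ∈ Ω := by by_contra h; exact hx (fun h' => absurd h' h)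
    obtain ⟨r, hr, h⟩ := hP hxΩ
    refine ⟨{y | ¬ P (w y)} ∩ Metric.ball x r, ?_, ?_⟩
    · refine mem_of_superset (inter_mem_nhdsWithin _ (Metric.ball_mem_nhds x hr)) ?_
      rintro y ⟨hy1, hy2⟩
      exact ⟨fun hPy => hy1 (fun _ => hPy), hy2⟩
    · rw [ae_iff, Measure.restrict_apply' measurableSet_ball] at h
      exact h
  by_cases h1 : (Ω ∩ U (fun s => s = 0)).Nonempty
  · by_cases h2 : (Ω ∩ U (fun s => 0 < s)).Nonempty
    · obtain ⟨x, -, ⟨r, hr, hx1⟩, s, hs, hx2⟩ := hconn (U fun s => s = 0) (U fun s => 0 < s)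
        (hUo fun s => s = 0) (hUo fun s => 0 < s) hcover h1 h2
      exfalso
      have hm : 0 < min r s := lt_min hr hs
      have k1 := ae_restrict_of_ae_restrict_of_subset
        (Metric.ball_subset_ball (min_le_left r s) (x := x)) hx1
      have k2 := ae_restrict_of_ae_restrict_of_subset
        (Metric.ball_subset_ball (min_le_right r s) (x := x)) hx2
      have k3 : ∀ᵐ y ∂(volume.restrict (Metric.ball x (min r s))), False := by
        filter_upwards [k1, k2] with y hy1 hy2
        linarith
      rw [ae_iff] at k3
      simp only [not_false_eq_true, Set.ofPred_true, Measure.restrict_apply_univ] at k3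
      exact (Metric.measure_ball_pos volume x hm).ne' k3
    · exfalso
      refine hne (hlocal (fun s => s = 0) fun x hx => ?_)
      rcases hcover hx with h | h
      · exact h
      · exact absurd ⟨x, hx, h⟩ h2
  · refine hlocal (fun s => 0 < s) fun x hx => ?_
    rcases hcover hx with h | h
    · exact absurd ⟨x, hx, h⟩ h1
    · exact h

theorem exists_isPositiveLogisticSolution [IsFiniteMeasure (volume.restrict Ω)] (hΩ : IsOpen Ω)
    (hconn : IsConnected Ω) (hp1 : 1 < p) (hp2 : p < 2) (hlam : firstEigenvalue Ω p < lam) :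
    ∃ w, IsPositiveLogisticSolution Ω p lam w := by
  obtain ⟨w, g, hw, hw0, hne, heq⟩ :=
    exists_nonneg_logistic_solution hΩ hconn.nonempty hp1 hp2 hlam
  have hlam0 : 0 ≤ lam := firstEigenvalue_nonneg.trans hlam.le
  refine ⟨w, ae_pos_of_nonneg_solution hΩ hconn.isPreconnected hp1 hp2 hlam0 hw hw0 hne heq,
    by simpa using hw.2, g, hw.1, fun φ Φ hφ2 hφ => heq φ Φ ⟨hφ, by simpa using hφ2⟩⟩

end Positivity

/-! ### Separated solutions of the parabolic problem -/

section Parabolic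

variable {Ω : Set (EuclideanSpace ℝ (Fin N))} {p lam T τ : ℝ}
  {w : EuclideanSpace ℝ (Fin N) → ℝ} {g : EuclideanSpace ℝ (Fin N) → EuclideanSpace ℝ (Fin N)}
  {φ ψ : EuclideanSpace ℝ (Fin N) × ℝ → ℝ}

lemma restrict_cyl (Ω : Set (EuclideanSpace ℝ (Fin N))) (τ : ℝ) :
    volume.restrict (cyl Ω τ) = (volume.restrict Ω).prod (volume.restrict (Ioo 0 τ)) :=
  (Measure.prod_restrict Ω (Ioo 0 τ)).symm

lemma one_lt_inv_two_sub (hp1 : 1 < p) (hp2 : p < 2) : 1 < 1 / (2 - p) := by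
  rw [lt_div_iff₀ (by linarith)]; linarith

lemma timeProfile_zero (hp2 : p < 2) : timeProfile p 0 = 0 := by
  have : 0 < 2 - p := by linarith
  simp only [timeProfile, mul_zero]
  exact Real.zero_rpow (by positivity)

lemma timeProfile_pos (hp2 : p < 2) {t : ℝ} (ht : 0 < t) : 0 < timeProfile p t :=
  Real.rpow_pos_of_pos (mul_pos (by linarith) ht) _

lemma timeProfile_nonneg (hp2 : p < 2) {t : ℝ} (ht : 0 ≤ t) : 0 ≤ timeProfile p t :=
  Real.rpow_nonneg (mul_nonneg (by linarith) ht) _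

lemma timeProfile_le (hp2 : p < 2) {s t : ℝ} (hs : 0 ≤ s) (hst : s ≤ t) :
    timeProfile p s ≤ timeProfile p t := by
  have : 0 < 2 - p := by linarith
  refine Real.rpow_le_rpow (by positivity) (by gcongr) (by positivity)

/-- `p > 1` makes the exponent `1/(2-p)` exceed `1`, so the profile leaves zero with zero slope and
is `C¹` across `t = 0`. -/
lemma contDiff_timeProfile (hp1 : 1 < p) (hp2 : p < 2) : ContDiff ℝ 1 (timeProfile p) := by
  refine (Real.contDiff_rpow_const_of_le (n := 1) ?_).comp (contDiff_const.mul contDiff_id)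
  exact_mod_cast (one_lt_inv_two_sub hp1 hp2).le

/-- The ODE behind the construction; it rests on `(p-1)/(2-p) = 1/(2-p) - 1`. -/
lemma deriv_timeProfile (hp1 : 1 < p) (hp2 : p < 2) {t : ℝ} (ht : 0 ≤ t) :
    deriv (timeProfile p) t = timeProfile p t ^ (p - 1) := by
  have h2 : 0 < 2 - p := by linarith
  have h := (Real.hasDerivAt_rpow_const (x := (2 - p) * t)
    (Or.inr (one_lt_inv_two_sub hp1 hp2).le)).comp t ((hasDerivAt_id t).const_mul (2 - p))
  have he : (1 / (2 - p)) * (p - 1) = 1 / (2 - p) - 1 := by field_simp; ring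
  refine h.deriv.trans ?_
  rw [timeProfile, ← Real.rpow_mul (by positivity), he]
  field_simp

lemma spow_mul_of_nonneg (hp1 : 1 < p) {c : ℝ} (hc : 0 ≤ c) (s : ℝ) :
    spow p (s * c) = c ^ (p - 1) * spow p s := by
  have : c ^ (p - 2) * c = c ^ (p - 1) := by
    rw [← Real.rpow_add_one' hc (by linarith)]; ring_nf
  rw [spow, spow, abs_mul, abs_of_nonneg hc, Real.mul_rpow (abs_nonneg _) hc, ← this]
  ring

lemma flux_smul_of_nonneg (hp1 : 1 < p) {c : ℝ} (hc : 0 ≤ c) (ξ : EuclideanSpace ℝ (Fin N)) :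
    flux p (c • ξ) = c ^ (p - 1) • flux p ξ := by
  have : c ^ (p - 2) * c = c ^ (p - 1) := by
    rw [← Real.rpow_add_one' hc (by linarith)]; ring_nf
  rw [flux, flux, norm_smul, Real.norm_of_nonneg hc, Real.mul_rpow hc (norm_nonneg _), ← this,
    smul_smul, smul_smul]
  ring_nf

lemma spow_neg (s : ℝ) : spow p (-s) = -spow p s := by
  simp [spow]

lemma flux_neg (ξ : EuclideanSpace ℝ (Fin N)) : flux p (-ξ) = -flux p ξ := by
  simp [flux]

lemma memLp_timeProfile_smul {E : Type*} [NormedAddCommGroup E] [NormedSpace ℝ E]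
    (hp1 : 1 < p) (hp2 : p < 2) (T : ℝ) {q : ℝ≥0∞} {F : EuclideanSpace ℝ (Fin N) → E}
    (hF : MemLp F q (volume.restrict Ω)) :
    MemLp (fun z : EuclideanSpace ℝ (Fin N) × ℝ => timeProfile p z.2 • F z.1) q
      (volume.restrict (cyl Ω T)) := by
  rw [restrict_cyl]
  have hF' := hF.comp_fst (volume.restrict (Ioo (0 : ℝ) T))
  refine hF'.of_le_mul (c := timeProfile p T)
    (((contDiff_timeProfile hp1 hp2).continuous.comp continuous_snd).aestronglyMeasurable.smul
      hF'.aestronglyMeasurable) ?_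
  rw [← restrict_cyl]
  have : ∀ᵐ z ∂(volume.restrict (cyl Ω T)), z.2 ∈ Ioo 0 T := by
    rw [restrict_cyl]
    exact Measure.quasiMeasurePreserving_snd.ae (ae_restrict_mem measurableSet_Ioo)
  filter_upwards [this] with z hz
  rw [norm_smul, Real.norm_of_nonneg (timeProfile_nonneg hp2 hz.1.le)]
  exact mul_le_mul_of_nonneg_right (timeProfile_le hp2 hz.1.le hz.2.le) (norm_nonneg _)

lemma memLp_separated (hp1 : 1 < p) (hp2 : p < 2) (T : ℝ) {q : ℝ≥0∞}
    (hw : MemLp w q (volume.restrict Ω)) :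
    MemLp (separated p w) q (volume.restrict (cyl Ω T)) := by
  refine (memLp_timeProfile_smul hp1 hp2 T hw).ae_eq (Eventually.of_forall fun z => ?_)
  exact mul_comm _ _

lemma memCL2_separated (hp1 : 1 < p) (hp2 : p < 2) (hw : MemLp w 2 (volume.restrict Ω)) :
    MemCL2 Ω T (separated p w) := by
  refine ⟨fun t _ => ?_, fun s _ => ?_⟩
  · simpa only [separated, mul_comm] using hw.const_mul (timeProfile p t)
  · have he : ∀ t, eLpNorm (fun x => separated p w (x, t) - separated p w (x, s)) 2
        (volume.restrict Ω)
        = ‖timeProfile p t - timeProfile p s‖ₑ * eLpNorm w 2 (volume.restrict Ω) := by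
      intro t
      rw [← eLpNorm_const_smul]
      congr 1
      funext x
      simp only [separated, Pi.smul_apply, smul_eq_mul]
      ring
    simp only [he]
    have h1 : Tendsto (fun t => ‖timeProfile p t - timeProfile p s‖ₑ) (𝓝[Icc 0 T] s) (𝓝 0) := by
      have hc : Continuous fun t => ‖timeProfile p t - timeProfile p s‖ₑ :=
        ((contDiff_timeProfile hp1 hp2).continuous.sub continuous_const).enorm
      simpa using (hc.tendsto s).mono_left nhdsWithin_le_nhds
    simpa using ENNReal.Tendsto.mul_const h1 (Or.inr hw.eLpNorm_ne_top)

lemma memLpW01p_separated [IsFiniteMeasure (volume.restrict Ω)] (hp1 : 1 < p) (hp2 : p < 2)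
    (hw : MemW01p Ω p w g) :
    MemLpW01p Ω T p (separated p w) (fun z => timeProfile p z.2 • g z.1) := by
  refine ⟨memLp_separated hp1 hp2 T hw.memLp, memLp_timeProfile_smul hp1 hp2 T hw.memLp_grad,
    Eventually.of_forall fun t => ?_⟩
  simpa only [separated, mul_comm] using hw.const_mul hp1.le (timeProfile p t)

lemma MemW12L2.integrable_mul_deriv [IsFiniteMeasure (volume.restrict Ω)]
    (hw : MemLp w 2 (volume.restrict Ω)) (h : MemW12L2 Ω τ φ ψ) :
    Integrable (fun z : EuclideanSpace ℝ (Fin N) × ℝ => w z.1 * ψ z)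
      ((volume.restrict Ω).prod (volume.restrict (Ioo 0 τ))) := by
  have h1 := hw.comp_fst (volume.restrict (Ioo (0 : ℝ) τ))
  have h2 := h.memLp_deriv
  rw [restrict_cyl] at h2
  exact h1.integrable_mul h2

/-- The function `t ↦ ∫ w φ(·, t)` is a primitive of `t ↦ ∫ w ∂_t φ(·, t)`. -/
lemma MemW12L2.integral_mul_eq [IsFiniteMeasure (volume.restrict Ω)]
    (hw : MemLp w 2 (volume.restrict Ω)) (h : MemW12L2 Ω τ φ ψ) {t : ℝ} (ht : t ∈ Icc 0 τ) :
    ∫ x in Ω, w x * φ (x, t)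
      = (∫ x in Ω, w x * φ (x, 0)) + ∫ r in (0 : ℝ)..t, ∫ x in Ω, w x * ψ (x, r) := by
  have h0 : (0 : ℝ) ∈ Icc 0 τ := ⟨le_rfl, ht.1.trans ht.2⟩
  have hit : Integrable (fun x => w x * φ (x, t)) (volume.restrict Ω) :=
    hw.integrable_mul (h.slice t ht)
  have hi0 : Integrable (fun x => w x * φ (x, 0)) (volume.restrict Ω) :=
    hw.integrable_mul (h.slice 0 h0)
  rw [← sub_eq_iff_eq_add', ← integral_sub hit hi0, intervalIntegral.integral_of_le ht.1]
  have hint : Integrable (Function.uncurry fun (x : EuclideanSpace ℝ (Fin N)) r => w x * ψ (x, r))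
      ((volume.restrict Ω).prod (volume.restrict (Ioc 0 t))) := by
    refine (h.integrable_mul_deriv hw).mono_measure (Measure.prod_mono le_rfl ?_)
    rw [← restrict_Ioo_eq_restrict_Ioc]
    exact Measure.restrict_mono (Ioo_subset_Ioo_right ht.2) le_rfl
  rw [← integral_integral_swap hint]
  refine integral_congr_ae ?_
  filter_upwards [h.ftc 0 h0 t ht] with x hx
  rw [integral_const_mul, ← intervalIntegral.integral_of_le ht.1, ← hx]
  exact (mul_sub _ _ _).symm

/-- Integration by parts in time against the profile. -/
lemma timeProfile_mul_eq_integral (hp1 : 1 < p) (hp2 : p < 2) (hτ : 0 ≤ τ) {H k : ℝ → ℝ}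
    (hk : IntervalIntegrable k volume 0 τ)
    (hH : ∀ t ∈ Icc 0 τ, H t = H 0 + ∫ r in (0 : ℝ)..t, k r) :
    timeProfile p τ * H τ
      = ∫ t in Ioo 0 τ, (timeProfile p t ^ (p - 1) * H t + timeProfile p t * k t) := by
  -- `H` is only a primitive of an integrable function, so the product rule is applied to absolutely
  -- continuous functions, with `H' = k` almost everywhere. The boundary term at `0` vanishes with
  -- the profile.
  have hv : AbsolutelyContinuousOnInterval (timeProfile p) 0 τ :=
    (contDiff_timeProfile hp1 hp2).contDiffOn.absolutelyContinuousOnInterval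
  have hK := hk.absolutelyContinuousOnInterval_intervalIntegral (c := 0) (by simp)
  have hc : AbsolutelyContinuousOnInterval (fun _ : ℝ => H 0) 0 τ :=
    contDiff_const.contDiffOn.absolutelyContinuousOnInterval
  have key := hv.integral_deriv_mul_eq_sub (hc.fun_add hK)
  rw [timeProfile_zero hp2, zero_mul, sub_zero, ← hH τ ⟨hτ, le_rfl⟩] at key
  rw [← key, intervalIntegral.integral_of_le hτ, ← restrict_Ioo_eq_restrict_Ioc]
  refine integral_congr_ae ?_
  filter_upwards [ae_restrict_mem measurableSet_Ioo, ae_restrict_of_ae hk.ae_hasDerivAt_integral]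
    with t ht hd
  have hd' := ((hd (by rw [uIcc_of_le hτ]; exact Ioo_subset_Icc_self ht) 0 (by simp)).const_add
    (H 0)).deriv
  simp only [deriv_timeProfile hp1 hp2 ht.1.le, hH t (Ioo_subset_Icc_self ht), hd']

/-- A weak solution `w` of the logistic equation gives the weak solution `w(x) v(t)` of the
parabolic problem with vanishing data. -/
theorem isWeakSolution_separated [IsFiniteMeasure (volume.restrict Ω)] (hp1 : 1 < p)
    (hp2 : p < 2) (hw2 : MemLp w 2 (volume.restrict Ω)) (hw : MemW01p Ω p w g)
    (heq : ∀ φ Φ, MemLp φ 2 (volume.restrict Ω) → MemW01p Ω p φ Φ →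
      ∫ x in Ω, inner ℝ (flux p (g x)) (Φ x) = ∫ x in Ω, (lam * spow p (w x) - w x) * φ x) :
    IsWeakSolution Ω T p lam 0 0 (separated p w) := by
  refine ⟨memCL2_separated hp1 hp2 hw2, Eventually.of_forall fun x => ?_,
    fun z => timeProfile p z.2 • g z.1, memLpW01p_separated hp1 hp2 hw, ?_⟩
  · simp [separated, timeProfile_zero hp2]
  intro τ hτ φ ψ Φ hφ hΦ
  have hG := memLpW01p_separated (T := τ) hp1 hp2 hw
  have iA : Integrable (fun z => separated p w z * ψ z) (volume.restrict (cyl Ω τ)) :=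
    (memLp_separated hp1 hp2 τ hw2).integrable_mul hφ.memLp_deriv
  have iB := integrable_inner_flux hp1 hG.memLp_grad hΦ.memLp_grad
  have iC := integrable_spow_mul hp1 hG.memLp hΦ.memLp
  simp only [Pi.zero_apply, zero_mul, integral_zero, add_zero]
  rw [integral_add (f := fun z => -(separated p w z * ψ z)) iA.neg iB, integral_neg]
  rw [restrict_cyl] at iA iB iC ⊢
  rw [integral_prod_symm _ iA, integral_prod_symm _ iB, integral_prod_symm _ iC]
  have jA := iA.integral_prod_right
  have jB := iB.integral_prod_right
  have jC := iC.integral_prod_right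
  set H : ℝ → ℝ := fun t => ∫ x in Ω, w x * φ (x, t) with hH
  set k : ℝ → ℝ := fun t => ∫ x in Ω, w x * ψ (x, t) with hk
  have eA : ∀ t, ∫ x in Ω, separated p w (x, t) * ψ (x, t) = timeProfile p t * k t := by
    intro t
    rw [hk, ← integral_const_mul]
    refine integral_congr_ae (Eventually.of_forall fun x => ?_)
    simp only [separated]; ring
  -- For a.e. `t` the slice `φ(·, t)` is an admissible test function of the logistic equation;
  -- homogeneity pulls out `v(t)^{p-1}`.
  have eB : ∀ᵐ t ∂(volume.restrict (Ioo 0 τ)),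
      ∫ x in Ω, inner ℝ (flux p (timeProfile p t • g x)) (Φ (x, t))
        = lam * (∫ x in Ω, spow p (separated p w (x, t)) * φ (x, t))
          - timeProfile p t ^ (p - 1) * H t := by
    filter_upwards [hΦ.slice, ae_restrict_mem measurableSet_Ioo] with t hst ht
    have hv := timeProfile_nonneg hp2 ht.1.le
    have hφt := hφ.slice t (Ioo_subset_Icc_self ht)
    have e := heq _ _ hφt hst
    have i1 := (integrable_spow_mul hp1 hw.memLp hst.memLp).const_mul lam
    have i2 : Integrable (fun x => w x * φ (x, t)) (volume.restrict Ω) :=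
      hw2.integrable_mul hφt
    have e' : ∫ x in Ω, (lam * spow p (w x) - w x) * φ (x, t)
        = lam * (∫ x in Ω, spow p (w x) * φ (x, t)) - H t := by
      rw [hH, ← integral_const_mul, ← integral_sub i1 i2]
      refine integral_congr_ae (Eventually.of_forall fun x => ?_)
      ring
    simp only [separated, flux_smul_of_nonneg hp1 hv, spow_mul_of_nonneg hp1 hv,
      real_inner_smul_left, mul_assoc, integral_const_mul]
    rw [e, e']; ring
  -- By `eB` this function is a difference of two integrable ones, so no separate bound on `H` is
  -- needed.
  have iD : Integrable (fun t => timeProfile p t ^ (p - 1) * H t) (volume.restrict (Ioo 0 τ)) := by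
    refine ((jC.const_mul lam).sub jB).congr ?_
    filter_upwards [eB] with t ht
    simp only [Pi.sub_apply, ht]; ring
  have ik : IntervalIntegrable k volume 0 τ := by
    rw [intervalIntegrable_iff_integrableOn_Ioo_of_le hτ.1.le]
    exact (hφ.integrable_mul_deriv hw2).integral_prod_right
  have hHt := timeProfile_mul_eq_integral hp1 hp2 hτ.1.le ik
    fun t ht => hφ.integral_mul_eq hw2 ht
  simp only [eA] at jA ⊢
  rw [integral_congr_ae eB, integral_sub (jC.const_mul lam) iD, integral_const_mul]
  rw [integral_add iD jA] at hHt
  have e1 : ∫ x in Ω, separated p w (x, τ) * φ (x, τ) = timeProfile p τ * H τ := by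
    rw [hH, ← integral_const_mul]
    refine integral_congr_ae (Eventually.of_forall fun x => ?_)
    simp only [separated]; ring
  have e0 : ∫ x in Ω, separated p w (x, 0) * φ (x, 0) = 0 := by
    simp [separated, timeProfile_zero hp2]
  rw [e1, e0, hHt]
  ring

end Parabolic

/-! ### Three solutions with zero data -/

section Counterexamples

variable {Ω : Set (EuclideanSpace ℝ (Fin N))} {p lam T : ℝ} {w : EuclideanSpace ℝ (Fin N) → ℝ}

lemma separated_zero (p : ℝ) : separated p (0 : EuclideanSpace ℝ (Fin N) → ℝ) = 0 := by
  funext z; simp [separated]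

lemma separated_neg (p : ℝ) (w : EuclideanSpace ℝ (Fin N) → ℝ) :
    separated p (fun x => -w x) = -separated p w := by
  funext z; simp [separated]

lemma isWeakSolution_zero [IsFiniteMeasure (volume.restrict Ω)] (hp1 : 1 < p) (hp2 : p < 2) :
    IsWeakSolution Ω T p lam 0 0 0 := by
  have h : IsWeakSolution Ω T p lam 0 0 (separated p 0) :=
    isWeakSolution_separated hp1 hp2 MemLp.zero (memW01p_zero hp1.le) fun φ Φ _ _ => by
      simp [flux, spow]
  rwa [separated_zero] at h

lemma IsPositiveLogisticSolution.isWeakSolution [IsFiniteMeasure (volume.restrict Ω)]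
    (hp1 : 1 < p) (hp2 : p < 2) (hw : IsPositiveLogisticSolution Ω p lam w) :
    IsWeakSolution Ω T p lam 0 0 (separated p w) := by
  obtain ⟨-, hw2, g, hg, heq⟩ := hw
  exact isWeakSolution_separated hp1 hp2 hw2 hg heq

lemma IsPositiveLogisticSolution.isWeakSolution_neg [IsFiniteMeasure (volume.restrict Ω)]
    (hp1 : 1 < p) (hp2 : p < 2) (hw : IsPositiveLogisticSolution Ω p lam w) :
    IsWeakSolution Ω T p lam 0 0 (-separated p w) := by
  obtain ⟨-, hw2, g, hg, heq⟩ := hw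
  rw [← separated_neg]
  have hg' : MemW01p Ω p (fun x => -w x) (fun x => -g x) := by
    simpa using hg.const_mul hp1.le (-1)
  refine isWeakSolution_separated hp1 hp2 hw2.neg hg' fun φ Φ hφ hΦ => ?_
  simp only [flux_neg, spow_neg, inner_neg_left, integral_neg, heq φ Φ hφ hΦ]
  rw [← integral_neg]
  refine integral_congr_ae (Eventually.of_forall fun x => ?_)
  ring

lemma IsPositiveLogisticSolution.separated_pos (hp2 : p < 2)
    (hw : IsPositiveLogisticSolution Ω p lam w) :
    ∀ᵐ z ∂(volume.restrict (cyl Ω T)), 0 < separated p w z := by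
  rw [restrict_cyl]
  filter_upwards [Measure.quasiMeasurePreserving_fst.ae hw.1,
    Measure.quasiMeasurePreserving_snd.ae (ae_restrict_mem measurableSet_Ioo)] with z h1 h2
  exact mul_pos h1 (timeProfile_pos hp2 h2.1)

lemma neBot_ae_restrict_cyl (hΩ : IsOpen Ω) (hne : Ω.Nonempty) (hT : 0 < T) :
    (ae (volume.restrict (cyl Ω T))).NeBot := by
  rw [ae_neBot, Ne, Measure.restrict_eq_zero]
  exact ((hΩ.prod isOpen_Ioo).measure_pos volume (hne.prod (nonempty_Ioo.2 hT))).ne'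

lemma admissibleData_zero [IsFiniteMeasure (volume.restrict Ω)] (hp1 : 1 < p) :
    AdmissibleData Ω T p 0 0 :=
  ⟨MemLp.zero, MemLp.zero, 0, memW01p_zero hp1.le⟩

end Counterexamples

end PLap

end

theorem mainTheorem10 {N : ℕ} (hN : 1 ≤ N) (Ω : Set (EuclideanSpace ℝ (Fin N)))
    (hΩ_open : IsOpen Ω) (hΩ_conn : IsConnected Ω) (hΩ_bdd : Bornology.IsBounded Ω)
    (T : ℝ) (hT : 0 < T) (p lam : ℝ) (hp1 : 1 < p) (hp2 : p < 2)
    (hlam : PLap.firstEigenvalue Ω p < lam) :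
    (∃ w, PLap.IsPositiveLogisticSolution Ω p lam w) ∧
    (∀ w, PLap.IsPositiveLogisticSolution Ω p lam w →
      (PLap.IsWeakSolution Ω T p lam 0 0 0 ∧
        PLap.IsWeakSolution Ω T p lam 0 0 (PLap.separated p w) ∧
        PLap.IsWeakSolution Ω T p lam 0 0 (-PLap.separated p w)) ∧
      (∀ᵐ z ∂(volume.restrict (PLap.cyl Ω T)), 0 < PLap.separated p w z) ∧
      (∀ᵐ z ∂(volume.restrict (PLap.cyl Ω T)), (-PLap.separated p w) z < 0) ∧
      ¬ (PLap.separated p w =ᵐ[volume.restrict (PLap.cyl Ω T)] 0) ∧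
      ¬ (-PLap.separated p w =ᵐ[volume.restrict (PLap.cyl Ω T)] 0) ∧
      ¬ (PLap.separated p w =ᵐ[volume.restrict (PLap.cyl Ω T)] -PLap.separated p w)) ∧
    ¬ PLap.WeakMaximumPrinciple Ω T p lam 0 0 ∧
    ¬ PLap.StrongMaximumPrinciple Ω T p lam 0 0 ∧
    ¬ PLap.WeakComparisonPrinciple Ω T p lam 0 0 0 0 ∧
    ¬ PLap.StrongComparisonPrinciple Ω T p lam 0 0 0 0 := by
  have hfin : IsFiniteMeasure (volume.restrict Ω) :=
    isFiniteMeasure_restrict.2 hΩ_bdd.measure_lt_top.ne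
  have hex := PLap.exists_isPositiveLogisticSolution hΩ_open hΩ_conn hp1 hp2 hlam
  have hne := PLap.neBot_ae_restrict_cyl hΩ_open hΩ_conn.nonempty hT
  have hdata := PLap.admissibleData_zero (Ω := Ω) (T := T) hp1
  have h0 := PLap.isWeakSolution_zero (Ω := Ω) (T := T) (lam := lam) hp1 hp2
  refine ⟨hex, fun w hw => ?_, ?_⟩
  · have hpos := hw.separated_pos (T := T) hp2
    refine ⟨⟨h0, hw.isWeakSolution hp1 hp2, hw.isWeakSolution_neg hp1 hp2⟩, hpos, ?_, ?_, ?_, ?_⟩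
    · filter_upwards [hpos] with z hz
      simpa using hz
    · intro h
      obtain ⟨z, hz, hz'⟩ := (hpos.and h).exists
      simp [hz'] at hz
    · intro h
      obtain ⟨z, hz, hz'⟩ := (hpos.and h).exists
      simp only [Pi.neg_apply, Pi.zero_apply, neg_eq_zero] at hz'
      exact hz.ne' hz'
    · intro h
      obtain ⟨z, hz, hz'⟩ := (hpos.and h).exists
      rw [Pi.neg_apply] at hz'
      linarith
  · obtain ⟨w, hw⟩ := hex
    have hpos := hw.separated_pos (T := T) hp2
    have hplus := hw.isWeakSolution (T := T) hp1 hp2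
    have hminus := hw.isWeakSolution_neg (T := T) hp1 hp2
    -- The negative solution refutes both maximum principles. The ordered pair `w v`, `0` refutes
    -- both comparison principles, as equal data may be compared in either order. The strong
    -- versions fail through their first clause, so vanishing points play no role.
    have hmax : ¬ ∀ᵐ z ∂(volume.restrict (PLap.cyl Ω T)), 0 ≤ (-PLap.separated p w) z := by
      intro h
      obtain ⟨z, hz, hz'⟩ := (hpos.and h).exists
      rw [Pi.neg_apply] at hz'
      linarith
    have hcomp : ¬ ∀ᵐ z ∂(volume.restrict (PLap.cyl Ω T)),
        PLap.separated p w z ≤ (0 : EuclideanSpace ℝ (Fin N) × ℝ → ℝ) z := by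
      intro h
      obtain ⟨z, hz, hz'⟩ := (hpos.and h).exists
      exact hz.not_ge hz'
    have le_f : ∀ᵐ z ∂(volume.restrict (PLap.cyl Ω T)),
        (0 : EuclideanSpace ℝ (Fin N) × ℝ → ℝ) z ≤ (0 : EuclideanSpace ℝ (Fin N) × ℝ → ℝ) z :=
      Eventually.of_forall fun _ => le_rfl
    have le_u : ∀ᵐ x ∂(volume.restrict Ω),
        (0 : EuclideanSpace ℝ (Fin N) → ℝ) x ≤ (0 : EuclideanSpace ℝ (Fin N) → ℝ) x :=
      Eventually.of_forall fun _ => le_rfl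
    exact ⟨fun h => hmax (h hdata le_f le_u _ hminus),
      fun h => hmax (h hdata le_f le_u _ hminus).1,
      fun h => hcomp (h hdata hdata le_f le_u _ _ hplus h0),
      fun h => hcomp (h hdata hdata le_f le_u _ _ hplus h0).1⟩
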